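/- Let $(N^{m+1},h)$ be a smooth Riemannian manifold of dimension $m+1$ with constant sectional curvature $c\in\mathbb R$, let $(M^m,g)$ be a connected smooth Riemannian manifold of dimension $m$, and let $\varphi:(M,g)\to(N,h)$ be a smooth isometric immersion (a hypersurface). Denote by $B=\nabla d\varphi$ its second fundamental form, by $\tau(\varphi)=\operatorname{trace}_g\nabla d\varphi$ its tension field, by $H=\frac1m\operatorname{trace}_g B=\frac1m\tau(\varphi)$ its mean curvature vector field, and by $$\tau_2(\varphi)=-\Delta\tau(\varphi)-\operatorname{trace}_g R^N(d\varphi\,\cdot,\tau(\varphi))\,d\varphi\,\cdot$$ its bitension field, where $\Delta=-\operatorname{trace}_g\nabla^2$ is the rough Laplacian on sections of $\varphi^{-1}TN$ and $R^N(X,Y)Z=\nabla_X\nabla_YZ-\nabla_Y\nabla_XZ-\nabla_{[X,Y]}Z$. Suppose that (i) at every point $p\in M$ the hypersurface has at most two distinct principal curvatures, i.e. for every unit normal vector $\eta$ at $p$ the Weingarten operator $A$ of $T_pM$, defined by $\langle AX,Y\rangle=\langle B(X,Y),\eta\rangle$, has at most two distinct eigenvalues; (ii) $\varphi$ is proper biharmonic,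 i.e. $\tau_2(\varphi)=0$ on $M$ and $\tau(\varphi)$ does not vanish identically. Then $M$ has constant mean curvature: the function $|H|$ is constant on $M$. -/

import Mathlib

open scoped Manifold ContDiff

noncomputable section

/-! ## Tensor calculus in local coordinates

All objects of this section live on (open parts of) coordinate spaces `ℝⁿ`. A metric is given by
its matrix of components, a map by its coordinate expression and a vector field along a map by its
components. -/

/-- The coordinate space `ℝⁿ`. -/
abbrev Coord (n : ℕ) := EuclideanSpace ℝ (Fin n)

namespace Coord

variable {m n : ℕ}

/-- The partial derivative `∂ᵢ f`. -/
def pd (i : Fin n) (f : Coord n → ℝ) (x : Coord n) : ℝ :=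
  fderiv ℝ f x (EuclideanSpace.single i 1)

/-- The Christoffel symbol `Γᵏᵢⱼ` of the Levi-Civita connection of the metric `g`:
`Γᵏᵢⱼ = ½ ∑ₗ gᵏˡ (∂ᵢ gⱼₗ + ∂ⱼ gᵢₗ - ∂ₗ gᵢⱼ)`. -/
def christoffel (g : Coord n → Matrix (Fin n) (Fin n) ℝ) (k i j : Fin n) (x : Coord n) : ℝ :=
  (1 / 2) * ∑ l, (g x)⁻¹ k l *
    (pd i (fun y => g y j l) x + pd j (fun y => g y i l) x - pd l (fun y => g y i j) x)

/-- The component `Rˡₖᵢⱼ` of the curvature tensor of the metric `g`, that is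
`R(∂ᵢ, ∂ⱼ) ∂ₖ = ∑ₗ Rˡₖᵢⱼ ∂ₗ` with the sign convention
`R(X, Y) Z = ∇_X ∇_Y Z - ∇_Y ∇_X Z - ∇_[X,Y] Z`. -/
def riemann (g : Coord n → Matrix (Fin n) (Fin n) ℝ) (l k i j : Fin n) (x : Coord n) : ℝ :=
  pd i (christoffel g l j k) x - pd j (christoffel g l i k) x
    + ∑ p, (christoffel g l i p x * christoffel g p j k x
        - christoffel g l j p x * christoffel g p i k x)

/-- The components of the vector `R(X, Y) Z` at the point `x`. -/
def riemannVec (g : Coord n → Matrix (Fin n) (Fin n) ℝ) (x : Coord n) (X Y Z : Fin n → ℝ) :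
    Fin n → ℝ :=
  fun l => ∑ i, ∑ j, ∑ k, riemann g l k i j x * X i * Y j * Z k

/-- The scalar product `⟨X, Y⟩` of two vectors with respect to the matrix `G` of a metric. -/
def dot (G : Matrix (Fin n) (Fin n) ℝ) (X Y : Fin n → ℝ) : ℝ :=
  ∑ i, ∑ j, G i j * X i * Y j

/-- The components of `dΦ(∂ᵢ)`. -/
def dmap (Φ : Coord m → Coord n) (i : Fin m) (x : Coord m) : Fin n → ℝ :=
  fun a => pd i (fun y => Φ y a) x

/-- The covariant derivative `∇_{∂ᵢ} V` of a vector field `V` along the map `Φ` into a space with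
metric `h` (the connection pulled back from the Levi-Civita connection of `h`). -/
def covAlong (h : Coord n → Matrix (Fin n) (Fin n) ℝ) (Φ : Coord m → Coord n)
    (V : Coord m → Fin n → ℝ) (i : Fin m) (x : Coord m) : Fin n → ℝ :=
  fun a => pd i (fun y => V y a) x
    + ∑ b, ∑ c, christoffel h a b c (Φ x) * dmap Φ i x b * V x c

/-- The component `(∇dΦ)(∂ᵢ, ∂ⱼ) = ∇_{∂ᵢ} (dΦ(∂ⱼ)) - dΦ(∇_{∂ᵢ} ∂ⱼ)` of the second fundamental form
of the map `Φ` from a space with metric `g` to a space with metric `h`. When `Φ` is an isometric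
immersion, this is the second fundamental form `B(∂ᵢ, ∂ⱼ)` of the submanifold. -/
def secondFundForm (g : Coord m → Matrix (Fin m) (Fin m) ℝ)
    (h : Coord n → Matrix (Fin n) (Fin n) ℝ) (Φ : Coord m → Coord n) (i j : Fin m)
    (x : Coord m) : Fin n → ℝ :=
  fun a => covAlong h Φ (dmap Φ j) i x a - ∑ k, christoffel g k i j x * dmap Φ k x a

/-- The tension field `τ(Φ) = trace ∇dΦ`. -/
def tension (g : Coord m → Matrix (Fin m) (Fin m) ℝ)
    (h : Coord n → Matrix (Fin n) (Fin n) ℝ) (Φ : Coord m → Coord n)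
    (x : Coord m) : Fin n → ℝ :=
  fun a => ∑ i, ∑ j, (g x)⁻¹ i j * secondFundForm g h Φ i j x a

/-- The rough Laplacian `Δ V = - trace ∇² V` on vector fields along `Φ`, where
`∇² V (∂ᵢ, ∂ⱼ) = ∇_{∂ᵢ} ∇_{∂ⱼ} V - ∇_{∇_{∂ᵢ} ∂ⱼ} V`. -/
def roughLaplacian (g : Coord m → Matrix (Fin m) (Fin m) ℝ)
    (h : Coord n → Matrix (Fin n) (Fin n) ℝ) (Φ : Coord m → Coord n)
    (V : Coord m → Fin n → ℝ) (x : Coord m) : Fin n → ℝ :=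
  fun a => - ∑ i, ∑ j, (g x)⁻¹ i j *
    (covAlong h Φ (covAlong h Φ V j) i x a - ∑ k, christoffel g k i j x * covAlong h Φ V k x a)

/-- The bitension field `τ₂(Φ) = - Δ τ(Φ) - trace R(dΦ ·, τ(Φ)) dΦ ·`. -/
def bitension (g : Coord m → Matrix (Fin m) (Fin m) ℝ)
    (h : Coord n → Matrix (Fin n) (Fin n) ℝ) (Φ : Coord m → Coord n)
    (x : Coord m) : Fin n → ℝ :=
  fun a => - roughLaplacian g h Φ (tension g h Φ) x a
    - ∑ i, ∑ j, (g x)⁻¹ i j *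
        riemannVec h (Φ x) (dmap Φ i x) (tension g h Φ x) (dmap Φ j x) a

/-- The length `|H|` of the mean curvature vector field `H = (1/m) trace B` of an isometric
immersion `Φ`. -/
def meanCurvature (g : Coord m → Matrix (Fin m) (Fin m) ℝ)
    (h : Coord n → Matrix (Fin n) (Fin n) ℝ) (Φ : Coord m → Coord n) (x : Coord m) : ℝ :=
  let H : Fin n → ℝ :=
    fun a => (1 / (m : ℝ)) * ∑ i, ∑ j, (g x)⁻¹ i j * secondFundForm g h Φ i j x a
  √(dot (h (Φ x)) H H)

/-- `η` is a unit normal vector of `Φ` at `x`. -/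
def IsUnitNormal (h : Coord n → Matrix (Fin n) (Fin n) ℝ) (Φ : Coord m → Coord n)
    (x : Coord m) (η : Fin n → ℝ) : Prop :=
  (∀ i, dot (h (Φ x)) η (dmap Φ i x) = 0) ∧ dot (h (Φ x)) η η = 1

/-- `k` is a principal curvature at `x` with respect to the unit normal vector `η`, that is, an
eigenvalue of the Weingarten operator `A`, `⟨A X, Y⟩ = ⟨B(X, Y), η⟩`: there is `X ≠ 0` with
`⟨B(X, ∂ⱼ), η⟩ = k ⟨X, ∂ⱼ⟩` for all `j`. -/
def IsPrincipalCurvature (g : Coord m → Matrix (Fin m) (Fin m) ℝ)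
    (h : Coord n → Matrix (Fin n) (Fin n) ℝ) (Φ : Coord m → Coord n)
    (x : Coord m) (η : Fin n → ℝ) (k : ℝ) : Prop :=
  ∃ X : Fin m → ℝ, X ≠ 0 ∧ ∀ j,
    ∑ i, X i * dot (h (Φ x)) (secondFundForm g h Φ i j x) η = k * ∑ i, X i * g x i j

end Coord

/-! ## Riemannian manifolds and isometric immersions -/

section Manifolds

variable {m n : ℕ}
  {M : Type*} [TopologicalSpace M] [ChartedSpace (Coord m) M] [IsManifold 𝓘(ℝ, Coord m) ∞ M]
  {N : Type*} [TopologicalSpace N] [ChartedSpace (Coord n) N] [IsManifold 𝓘(ℝ, Coord n) ∞ N]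

/-- Smooth Riemannian metrics on an `n`-dimensional smooth manifold `N` (without boundary). -/
abbrev SmoothMetric (n : ℕ) (N : Type*) [TopologicalSpace N] [ChartedSpace (Coord n) N]
    [IsManifold 𝓘(ℝ, Coord n) ∞ N] :=
  Bundle.ContMDiffRiemannianMetric 𝓘(ℝ, Coord n) ∞ (Coord n)
    (fun p : N => TangentSpace 𝓘(ℝ, Coord n) p)

/-- `e` is a smooth chart of the manifold `N`. -/
def IsSmoothChart (e : OpenPartialHomeomorph N (Coord n)) : Prop :=
  e ∈ IsManifold.maximalAtlas 𝓘(ℝ, Coord n) ∞ N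

/-- The components `hᵢⱼ = h(∂ᵢ, ∂ⱼ)` of the metric `h` in the chart `e`, as functions of the
coordinates; `∂ᵢ` is the image of the `i`-th basis vector under the differential of `e⁻¹`. -/
def SmoothMetric.inChart (h : SmoothMetric n N) (e : OpenPartialHomeomorph N (Coord n))
    (x : Coord n) : Matrix (Fin n) (Fin n) ℝ :=
  Matrix.of fun i j => h.inner (e.symm x)
    (mfderiv 𝓘(ℝ, Coord n) 𝓘(ℝ, Coord n) e.symm x (EuclideanSpace.single i (1 : ℝ)))
    (mfderiv 𝓘(ℝ, Coord n) 𝓘(ℝ, Coord n) e.symm x (EuclideanSpace.single j (1 : ℝ)))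

/-- The Riemannian manifold `(N, h)` has constant sectional curvature `c`:
`⟨R(X, Y) Y, X⟩ = c (|X|² |Y|² - ⟨X, Y⟩²)` for all tangent vectors `X`, `Y` at all points. -/
def HasConstSectionalCurvature (h : SmoothMetric n N) (c : ℝ) : Prop :=
  ∀ e : OpenPartialHomeomorph N (Coord n), IsSmoothChart e → ∀ x ∈ e.target,
    ∀ X Y : Fin n → ℝ,
      Coord.dot (h.inChart e x) (Coord.riemannVec (h.inChart e) x X Y Y) X
        = c * (Coord.dot (h.inChart e x) X X * Coord.dot (h.inChart e x) Y Y
            - Coord.dot (h.inChart e x) X Y ^ 2)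

/-- `φ : (M, g) → (N, h)` is a smooth isometric (Riemannian) immersion: `φ^* h = g`. -/
def IsIsometricImmersion (g : SmoothMetric m M) (h : SmoothMetric n N) (φ : M → N) : Prop :=
  ContMDiff 𝓘(ℝ, Coord m) 𝓘(ℝ, Coord n) ∞ φ ∧
    ∀ (p : M) (u v : TangentSpace 𝓘(ℝ, Coord m) p),
      h.inner (φ p) (mfderiv 𝓘(ℝ, Coord m) 𝓘(ℝ, Coord n) φ p u)
        (mfderiv 𝓘(ℝ, Coord m) 𝓘(ℝ, Coord n) φ p v) = g.inner p u v

/-- The coordinate expression of `φ` in the charts `e` and `e'`. -/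
def mapInCharts (φ : M → N) (e : OpenPartialHomeomorph M (Coord m))
    (e' : OpenPartialHomeomorph N (Coord n)) (x : Coord m) : Coord n :=
  e' (φ (e.symm x))

/-- A property of the coordinate expression of `φ` (in terms of the components of the two metrics)
holds at all points and in all charts. -/
def InAllCharts (g : SmoothMetric m M) (h : SmoothMetric n N) (φ : M → N)
    (P : (Coord m → Matrix (Fin m) (Fin m) ℝ) → (Coord n → Matrix (Fin n) (Fin n) ℝ) →
      (Coord m → Coord n) → Coord m → Prop) : Prop :=
  ∀ (e : OpenPartialHomeomorph M (Coord m)) (e' : OpenPartialHomeomorph N (Coord n)),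
    IsSmoothChart e → IsSmoothChart e' → ∀ x ∈ e.target, φ (e.symm x) ∈ e'.source →
      P (g.inChart e) (h.inChart e') (mapInCharts φ e e') x

/-- `φ` is harmonic: its tension field vanishes identically. -/
def IsHarmonicMap (g : SmoothMetric m M) (h : SmoothMetric n N) (φ : M → N) : Prop :=
  InAllCharts g h φ fun G K Φ x => Coord.tension G K Φ x = 0

/-- `φ` is biharmonic: its bitension field vanishes identically. -/
def IsBiharmonicMap (g : SmoothMetric m M) (h : SmoothMetric n N) (φ : M → N) : Prop :=
  InAllCharts g h φ fun G K Φ x => Coord.bitension G K Φ x = 0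

/-- `φ` is proper biharmonic: it is biharmonic and not harmonic. -/
def IsProperBiharmonicMap (g : SmoothMetric m M) (h : SmoothMetric n N) (φ : M → N) : Prop :=
  IsBiharmonicMap g h φ ∧ ¬ IsHarmonicMap g h φ

/-- At every point there are at most two distinct principal curvatures. -/
def HasAtMostTwoPrincipalCurvatures (g : SmoothMetric m M) (h : SmoothMetric n N) (φ : M → N) :
    Prop :=
  InAllCharts g h φ fun G K Φ x => ∀ η : Fin n → ℝ, Coord.IsUnitNormal K Φ x η →
    {k : ℝ | Coord.IsPrincipalCurvature G K Φ x η k}.encard ≤ 2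

/-- The mean curvature `|H|` of the isometric immersion `φ` at `p`, computed in the preferred
charts around `p` and `φ p`. -/
def meanCurvatureAt (g : SmoothMetric m M) (h : SmoothMetric n N) (φ : M → N) (p : M) : ℝ :=
  Coord.meanCurvature (g.inChart (chartAt (Coord m) p)) (h.inChart (chartAt (Coord n) (φ p)))
    (mapInCharts φ (chartAt (Coord m) p) (chartAt (Coord n) (φ p))) (chartAt (Coord m) p p)

end Manifolds

end

/-!
Let `τ` be the tension field and `F = |τ|`. The function `F ^ 2` is smooth, so it is enough to see
that its derivative vanishes; suppose that it does not, and work in a pair of charts on the open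
set where `F > 0` and `dF ≠ 0`. There `τ = F η` with a unit normal `η`, and in a space form the
normal and tangential parts of `τ₂ = 0` read `ΔF = (|A| ^ 2 - m c) F` and `A (∇F) = -(F / 2) ∇F`.

So `-F / 2` is a principal curvature with eigenvector `∇F`. There is at most one other, and as the
trace of `A` is `F` it equals `t F`, where `t` depends only on the multiplicity of `-F / 2`. The
continuous function `|A| ^ 2 / F ^ 2` is a strictly increasing function of this multiplicity,
which is therefore locally constant. If it is at least two, the Codazzi equation for `∇F` and an
orthogonal eigenvector of `-F / 2` forces `dF (∇F) = 0`, a contradiction. If it is one, the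
Codazzi equation shows that the integral curves of `∇F` are geodesics and that the level sets of
`F` are umbilic. The Riccati equation for their principal curvature, combined with the equation
for `ΔF`, expresses `|∇F| ^ 2` as a polynomial in `F`, and differentiating this relation along
`∇F` contradicts the equation for `ΔF` unless `F` is constant.
-/

/-! ### Calculus in coordinates -/

namespace Coord

section DirectionalDerivatives

variable {m n : ℕ} {U : Set (Coord m)} {x X Y : Coord m} {f f₁ f₂ : Coord m → ℝ}

/-- The derivative of the function `f` in the constant direction `X`. Using constant directions
instead of general vector fields makes all Lie brackets vanish. -/
noncomputable def dd (X : Coord m) (f : Coord m → ℝ) (x : Coord m) : ℝ := fderiv ℝ f x X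

/-- The componentwise derivative of the vector-valued function `V` in the constant direction `X`. -/
noncomputable def ddVec (X : Coord m) (V : Coord m → Fin n → ℝ) (x : Coord m) : Fin n → ℝ :=
  fun a => dd X (fun y => V y a) x

/-- The componentwise derivative of the matrix-valued function `A` in the constant direction
`X`. -/
noncomputable def ddMat (X : Coord m) (A : Coord m → Matrix (Fin n) (Fin n) ℝ) (x : Coord m) :
    Matrix (Fin n) (Fin n) ℝ :=
  Matrix.of fun a b => dd X (fun y => A y a b) x

/-- The differential of `Φ` in the constant direction `X`, as a vector field along `Φ`. -/
noncomputable def dmapDir (Φ : Coord m → Coord n) (X : Coord m) : Coord m → Fin n → ℝ :=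
  ddVec X fun y => Φ y

theorem pd_eq_dd (i : Fin m) (f : Coord m → ℝ) (x : Coord m) :
    pd i f x = dd (EuclideanSpace.single i 1) f x := rfl

theorem dmap_eq_dmapDir (Φ : Coord m → Coord n) (i : Fin m) :
    dmap Φ i = dmapDir Φ (EuclideanSpace.single i 1) := rfl

theorem eq_sum_smul_single (X : Coord m) : X = ∑ i, X i • EuclideanSpace.single i (1 : ℝ) := by
  simpa using ((EuclideanSpace.basisFun (Fin m) ℝ).sum_repr X).symm

theorem dd_eq_sum_pd (X : Coord m) (f : Coord m → ℝ) (x : Coord m) :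
    dd X f x = ∑ i, X i * pd i f x := by
  conv_lhs => rw [dd, eq_sum_smul_single X]
  simp [pd]

theorem dmapDir_eq_sum (Φ : Coord m → Coord n) (X x : Coord m) :
    dmapDir Φ X x = ∑ i, X i • dmap Φ i x := by
  ext a
  simp [dmapDir, ddVec, dd_eq_sum_pd, dmap, Finset.sum_apply]

theorem dd_add (h₁ : DifferentiableAt ℝ f₁ x) (h₂ : DifferentiableAt ℝ f₂ x) :
    dd X (fun y => f₁ y + f₂ y) x = dd X f₁ x + dd X f₂ x := by
  simp [dd, fderiv_fun_add h₁ h₂]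

theorem dd_mul (h₁ : DifferentiableAt ℝ f₁ x) (h₂ : DifferentiableAt ℝ f₂ x) :
    dd X (fun y => f₁ y * f₂ y) x = dd X f₁ x * f₂ x + f₁ x * dd X f₂ x := by
  simp [dd, fderiv_fun_mul h₁ h₂, mul_comm, add_comm]

theorem dd_const_mul (c : ℝ) (hf : DifferentiableAt ℝ f x) :
    dd X (fun y => c * f y) x = c * dd X f x := by
  simp [dd, fderiv_const_mul hf]

theorem dd_div_const (hf : DifferentiableAt ℝ f x) (c : ℝ) :
    dd X (fun y => f y / c) x = dd X f x / c := by
  simp [dd, div_eq_mul_inv, fderiv_mul_const hf, mul_comm]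

theorem dd_pow (hf : DifferentiableAt ℝ f x) (k : ℕ) :
    dd X (fun y => f y ^ k) x = k * f x ^ (k - 1) * dd X f x := by
  simp [dd, fderiv_fun_pow k hf]

theorem dd_inv (hf : DifferentiableAt ℝ f x) (h₀ : f x ≠ 0) :
    dd X (fun y => (f y)⁻¹) x = -dd X f x / f x ^ 2 := by
  have deriv := (hasDerivAt_inv h₀).comp_hasFDerivAt x hf.hasFDerivAt
  rw [dd, show (fun y => (f y)⁻¹) = Inv.inv ∘ f from rfl, deriv.fderiv]
  simp [dd, div_eq_inv_mul]

theorem dd_neg (f : Coord m → ℝ) : dd X (fun y => -f y) x = -dd X f x := by simp [dd]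

theorem dd_const (c : ℝ) : dd X (fun _ => c) x = 0 := by simp [dd]

theorem dd_sum {ι : Type*} {s : Finset ι} {f : ι → Coord m → ℝ}
    (hf : ∀ i ∈ s, DifferentiableAt ℝ (f i) x) :
    dd X (fun y => ∑ i ∈ s, f i y) x = ∑ i ∈ s, dd X (f i) x := by
  simp [dd, fderiv_fun_sum hf]

theorem dd_congr (hU : IsOpen U) (hx : x ∈ U) (h : ∀ y ∈ U, f₁ y = f₂ y) :
    dd X f₁ x = dd X f₂ x := by
  rw [dd, dd, (Filter.eventuallyEq_of_mem (hU.mem_nhds hx) h).fderiv_eq]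

theorem dd_eq_zero_of_const (hU : IsOpen U) (hx : x ∈ U) {c : ℝ} (h : ∀ y ∈ U, f y = c) :
    dd X f x = 0 := by
  rw [dd_congr hU hx h, dd_const]

theorem contDiffOn_dd (hU : IsOpen U) (hf : ContDiffOn ℝ ∞ f U) : ContDiffOn ℝ ∞ (dd X f) U :=
  (hf.fderiv_of_isOpen hU (by simp)).clm_apply contDiffOn_const

theorem dd_comm (hU : IsOpen U) (hx : x ∈ U) (hf : ContDiffOn ℝ ∞ f U) :
    dd X (dd Y f) x = dd Y (dd X f) x := by
  have hf' : DifferentiableAt ℝ (fderiv ℝ f) x :=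
    ((hf.fderiv_of_isOpen (m := ∞) hU (by simp)).contDiffAt (hU.mem_nhds hx)).differentiableAt
      (by simp)
  have dd_dd (X Y : Coord m) : dd X (dd Y f) x = fderiv ℝ (fderiv ℝ f) x X Y := by
    change fderiv ℝ (fun y => fderiv ℝ f y Y) x X = _
    simp [fderiv_clm_apply hf' (differentiableAt_const _)]
  rw [dd_dd, dd_dd]
  exact (hf.contDiffAt (hU.mem_nhds hx)).isSymmSndFDerivAt
    (by simpa using WithTop.coe_le_coe.2 (le_top : (2 : ℕ∞) ≤ ⊤)) X Y

theorem differentiableAt_of_contDiffOn {E : Type*} [NormedAddCommGroup E] [NormedSpace ℝ E]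
    {F : Coord m → E} (hU : IsOpen U) (hx : x ∈ U) (hF : ContDiffOn ℝ ∞ F U) :
    DifferentiableAt ℝ F x :=
  (hF.contDiffAt (hU.mem_nhds hx)).differentiableAt (by simp)

theorem contDiffOn_ddVec {V : Coord m → Fin n → ℝ} (hU : IsOpen U) (hV : ContDiffOn ℝ ∞ V U) :
    ContDiffOn ℝ ∞ (ddVec X V) U :=
  contDiffOn_pi.2 fun a => contDiffOn_dd hU (contDiffOn_pi.1 hV a)

theorem contDiffOn_dmapDir {Φ : Coord m → Coord n} (hU : IsOpen U) (hΦ : ContDiffOn ℝ ∞ Φ U) :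
    ContDiffOn ℝ ∞ (dmapDir Φ X) U :=
  contDiffOn_ddVec hU (contDiffOn_pi.2 fun a => contDiffOn_euclidean.1 hΦ a)

theorem ofLp_fderiv {Φ : Coord m → Coord n} (hΦ : DifferentiableAt ℝ Φ x) :
    (fderiv ℝ Φ x X).ofLp = dmapDir Φ X x :=
  funext fun a => (congrArg (· X)
    ((PiLp.hasFDerivAt_apply (𝕜 := ℝ) 2 (Φ x) a).comp x hΦ.hasFDerivAt).fderiv).symm

theorem dd_comp {Φ : Coord m → Coord n} {f : Coord n → ℝ}
    (hΦ : DifferentiableAt ℝ Φ x) (hf : DifferentiableAt ℝ f (Φ x)) :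
    dd X (fun y => f (Φ y)) x = ∑ a, dmapDir Φ X x a * pd a f (Φ x) := by
  rw [dd, show (fun y => f (Φ y)) = f ∘ Φ from rfl, fderiv_comp x hf hΦ,
    ContinuousLinearMap.comp_apply, ← dd, dd_eq_sum_pd, ofLp_fderiv hΦ]

section ProductRules

variable {u v : Coord m → Fin n → ℝ} {A : Coord m → Matrix (Fin n) (Fin n) ℝ}

theorem ddVec_smul (hf : DifferentiableAt ℝ f x) (hv : DifferentiableAt ℝ v x) :
    ddVec X (fun y => f y • v y) x = dd X f x • v x + f x • ddVec X v x :=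
  funext fun a => dd_mul hf (differentiableAt_pi.1 hv a)

theorem ddVec_add (hu : DifferentiableAt ℝ u x) (hv : DifferentiableAt ℝ v x) :
    ddVec X (fun y => u y + v y) x = ddVec X u x + ddVec X v x :=
  funext fun a => dd_add (differentiableAt_pi.1 hu a) (differentiableAt_pi.1 hv a)

theorem ddVec_sum {ι : Type*} {s : Finset ι} {v : ι → Coord m → Fin n → ℝ}
    (hv : ∀ i ∈ s, DifferentiableAt ℝ (v i) x) :
    ddVec X (fun y => ∑ i ∈ s, v i y) x = ∑ i ∈ s, ddVec X (v i) x := by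
  funext a
  simp only [ddVec, Finset.sum_apply]
  exact dd_sum fun i hi => differentiableAt_pi.1 (hv i hi) a

theorem dd_dotProduct (hu : DifferentiableAt ℝ u x) (hv : DifferentiableAt ℝ v x) :
    dd X (fun y => u y ⬝ᵥ v y) x = ddVec X u x ⬝ᵥ v x + u x ⬝ᵥ ddVec X v x := by
  rw [differentiableAt_pi] at hu hv
  simp only [dotProduct, ddVec, ← Finset.sum_add_distrib]
  rw [dd_sum fun a _ => (hu a).fun_mul (hv a)]
  exact Finset.sum_congr rfl fun a _ => dd_mul (hu a) (hv a)

theorem ddVec_mulVec (hA : ∀ a b, DifferentiableAt ℝ (fun y => A y a b) x)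
    (hv : DifferentiableAt ℝ v x) :
    ddVec X (fun y => (A y).mulVec (v y)) x
      = (ddMat X A x).mulVec (v x) + (A x).mulVec (ddVec X v x) :=
  funext fun a => dd_dotProduct (differentiableAt_pi.2 (hA a)) hv

theorem contDiffOn_mulVec {A : Coord m → Matrix (Fin n) (Fin n) ℝ}
    (hA : ∀ a b, ContDiffOn ℝ ∞ (fun y => A y a b) U) (hv : ContDiffOn ℝ ∞ v U) :
    ContDiffOn ℝ ∞ (fun y => (A y).mulVec (v y)) U :=
  contDiffOn_pi.2 fun a => by
    simpa only [Matrix.mulVec, dotProduct] using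
      ContDiffOn.sum fun c _ => (hA a c).mul (contDiffOn_pi.1 hv c)

end ProductRules

end DirectionalDerivatives

section ScalarProduct

variable {n : ℕ} (G : Matrix (Fin n) (Fin n) ℝ) (u v w : Fin n → ℝ)

theorem dot_eq_dotProduct : dot G u v = u ⬝ᵥ G.mulVec v := by
  simp only [dot, dotProduct, Matrix.mulVec, Finset.mul_sum]
  exact Finset.sum_congr rfl fun i _ => Finset.sum_congr rfl fun j _ => by ring

theorem dot_add_left : dot G (u + v) w = dot G u w + dot G v w := by
  simp only [dot_eq_dotProduct, add_dotProduct]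

theorem dot_add_right : dot G u (v + w) = dot G u v + dot G u w := by
  simp only [dot_eq_dotProduct, Matrix.mulVec_add, dotProduct_add]

theorem dot_smul_left (c : ℝ) : dot G (c • u) v = c * dot G u v := by
  simp only [dot_eq_dotProduct, smul_dotProduct, smul_eq_mul]

theorem dot_smul_right (c : ℝ) : dot G u (c • v) = c * dot G u v := by
  simp only [dot_eq_dotProduct, Matrix.mulVec_smul, dotProduct_smul, smul_eq_mul]

theorem dot_zero_left : dot G 0 v = 0 := by
  simp only [dot_eq_dotProduct, zero_dotProduct]

theorem dot_zero_right : dot G u 0 = 0 := by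
  simp only [dot_eq_dotProduct, Matrix.mulVec_zero, dotProduct_zero]

theorem dot_neg_left : dot G (-u) v = -dot G u v := by
  simp only [dot_eq_dotProduct, neg_dotProduct]

theorem dot_sub_left : dot G (u - v) w = dot G u w - dot G v w := by
  simp only [dot_eq_dotProduct, sub_dotProduct]

theorem dot_sub_right : dot G u (v - w) = dot G u v - dot G u w := by
  simp only [dot_eq_dotProduct, Matrix.mulVec_sub, dotProduct_sub]

theorem dot_sum_left {ι : Type*} (s : Finset ι) (u : ι → Fin n → ℝ) :
    dot G (∑ i ∈ s, u i) v = ∑ i ∈ s, dot G (u i) v := by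
  simp only [dot_eq_dotProduct, sum_dotProduct]

theorem dot_sum_right {ι : Type*} (s : Finset ι) (v : ι → Fin n → ℝ) :
    dot G u (∑ i ∈ s, v i) = ∑ i ∈ s, dot G u (v i) := by
  simp only [dot_eq_dotProduct, Matrix.mulVec_sum, dotProduct_sum]

variable {G}

theorem dot_comm (hG : G.IsSymm) : dot G u v = dot G v u := by
  rw [dot_eq_dotProduct, dot_eq_dotProduct, dotProduct_comm, Matrix.dotProduct_mulVec,
    ← Matrix.mulVec_transpose, hG.eq, dotProduct_comm, dotProduct_comm]

variable {u}

theorem dot_self_pos (hG : G.PosDef) (hu : u ≠ 0) : 0 < dot G u u := by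
  simpa [dot_eq_dotProduct] using hG.dotProduct_mulVec_pos hu

theorem eq_zero_of_dot_self_eq_zero (hG : G.PosDef) (hu : dot G u u = 0) : u = 0 := by
  by_contra h
  exact (dot_self_pos hG h).ne' hu

end ScalarProduct

/-- `h` is a smooth Riemannian metric on the open set `W`. -/
structure MetricOn {n : ℕ} (h : Coord n → Matrix (Fin n) (Fin n) ℝ) (W : Set (Coord n)) :
    Prop where
  isOpen : IsOpen W
  smooth : ∀ i j, ContDiffOn ℝ ∞ (fun y => h y i j) W
  posDef : ∀ y ∈ W, (h y).PosDef

/-- The Christoffel symbols `Γᵃᵢ꜀` with fixed lower index `i`, as a matrix in `a` and `c`. -/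
noncomputable def christoffelMatrix {n : ℕ} (h : Coord n → Matrix (Fin n) (Fin n) ℝ) (i : Fin n)
    (z : Coord n) : Matrix (Fin n) (Fin n) ℝ :=
  Matrix.of fun a c => christoffel h a i c z

theorem contDiffOn_det {E : Type*} [NormedAddCommGroup E] [NormedSpace ℝ E] {W : Set E} {k : ℕ}
    {A : E → Matrix (Fin k) (Fin k) ℝ} (hA : ∀ i j, ContDiffOn ℝ ∞ (fun y => A y i j) W) :
    ContDiffOn ℝ ∞ (fun y => (A y).det) W := by
  simp only [Matrix.det_apply']
  exact ContDiffOn.sum fun σ _ => contDiffOn_const.mul (contDiffOn_prod fun i _ => hA _ _)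

namespace MetricOn

variable {n : ℕ} {h : Coord n → Matrix (Fin n) (Fin n) ℝ} {W : Set (Coord n)} {y : Coord n}

theorem contDiffOn_inv (H : MetricOn h W) (i j : Fin n) :
    ContDiffOn ℝ ∞ (fun y => (h y)⁻¹ i j) W := by
  have inv_apply : ∀ y ∈ W, (h y)⁻¹ i j = ((h y).det)⁻¹ * (h y).adjugate i j := fun y _ => by
    rw [Matrix.inv_def, Ring.inverse_eq_inv', Matrix.smul_apply, smul_eq_mul]
  refine ContDiffOn.congr (.mul ((contDiffOn_det H.smooth).inv fun y hy =>
    (H.posDef y hy).det_pos.ne') ?_) inv_apply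
  simp only [Matrix.adjugate_apply]
  refine contDiffOn_det fun k l => ?_
  obtain rfl | hk := eq_or_ne k j
  · simpa [Matrix.updateRow_self] using contDiffOn_const
  · simpa [Matrix.updateRow_ne hk] using H.smooth k l

theorem isSymm (H : MetricOn h W) (hy : y ∈ W) : (h y).IsSymm :=
  Matrix.isHermitian_iff_isSymm.1 (H.posDef y hy).isHermitian

theorem inv_symm (H : MetricOn h W) (hy : y ∈ W) (i j : Fin n) : (h y)⁻¹ i j = (h y)⁻¹ j i := by
  rw [← Matrix.transpose_apply (h y)⁻¹ j i, Matrix.transpose_nonsing_inv, (H.isSymm hy).eq]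

theorem isUnit_det (H : MetricOn h W) (hy : y ∈ W) : IsUnit (h y).det :=
  (H.posDef y hy).det_pos.ne'.isUnit

theorem inv_mul (H : MetricOn h W) (hy : y ∈ W) : (h y)⁻¹ * h y = 1 :=
  Matrix.nonsing_inv_mul _ (H.isUnit_det hy)

theorem mul_inv (H : MetricOn h W) (hy : y ∈ W) : h y * (h y)⁻¹ = 1 :=
  Matrix.mul_nonsing_inv _ (H.isUnit_det hy)

theorem sum_inv_mul (H : MetricOn h W) (hy : y ∈ W) : ∑ i, ∑ j, (h y)⁻¹ i j * h y i j = n := by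
  calc ∑ i, ∑ j, (h y)⁻¹ i j * h y i j = ((h y)⁻¹ * h y).trace := by
        simp only [Matrix.trace, Matrix.mul_apply, Matrix.diag_apply]
        refine Finset.sum_congr rfl fun i _ => Finset.sum_congr rfl fun j _ => ?_
        rw [(H.isSymm hy).apply]
    _ = n := by rw [H.inv_mul hy, Matrix.trace_one, Fintype.card_fin]

theorem contDiffOn_christoffel (H : MetricOn h W) (k i j : Fin n) :
    ContDiffOn ℝ ∞ (christoffel h k i j) W :=
  contDiffOn_const.mul (ContDiffOn.sum fun l _ => (H.contDiffOn_inv k l).mul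
    (((contDiffOn_dd H.isOpen (H.smooth j l)).add (contDiffOn_dd H.isOpen (H.smooth i l))).sub
      (contDiffOn_dd H.isOpen (H.smooth i j))))

theorem pd_symm (H : MetricOn h W) (hy : y ∈ W) (l i j : Fin n) :
    pd l (fun z => h z i j) y = pd l (fun z => h z j i) y :=
  dd_congr H.isOpen hy fun _ hz => (H.isSymm hz).apply j i

theorem christoffel_symm (H : MetricOn h W) (hy : y ∈ W) (k i j : Fin n) :
    christoffel h k i j y = christoffel h k j i y := by
  simp only [christoffel, H.pd_symm hy _ i j]
  congr! 3
  ring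

theorem metric_mulVec_christoffel (H : MetricOn h W) (hy : y ∈ W) (i j : Fin n) :
    (h y).mulVec (fun k => christoffel h k i j y) = fun a => (1 / 2) *
      (pd i (fun z => h z j a) y + pd j (fun z => h z i a) y - pd a (fun z => h z i j) y) := by
  have christoffel_eq : (fun k => christoffel h k i j y) = ((h y)⁻¹).mulVec fun l => (1 / 2) *
      (pd i (fun z => h z j l) y + pd j (fun z => h z i l) y - pd l (fun z => h z i j) y) := by
    funext k
    simp only [christoffel, Matrix.mulVec, dotProduct, Finset.mul_sum]
    exact Finset.sum_congr rfl fun l _ => by ring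
  rw [christoffel_eq, Matrix.mulVec_mulVec, H.mul_inv hy, Matrix.one_mulVec]

theorem pd_metric (H : MetricOn h W) (hy : y ∈ W) (d a b : Fin n) :
    pd d (fun z => h z a b) y
      = (h y * christoffelMatrix h d y + (christoffelMatrix h d y).transpose * h y) a b := by
  have lower (a b : Fin n) : (h y * christoffelMatrix h d y) a b = (1 / 2) *
      (pd d (fun z => h z b a) y + pd b (fun z => h z d a) y - pd a (fun z => h z d b) y) :=
    congrFun (H.metric_mulVec_christoffel hy d b) a
  have transpose_mul : (christoffelMatrix h d y).transpose * h y
      = (h y * christoffelMatrix h d y).transpose := by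
    rw [Matrix.transpose_mul, (H.isSymm hy).eq]
  rw [transpose_mul, Matrix.add_apply, Matrix.transpose_apply, lower, lower, H.pd_symm hy d b a]
  ring

end MetricOn

end Coord

namespace Coord

variable {m n : ℕ}

/-- The connection matrix, in the direction `X`, of the Levi-Civita connection of `h` pulled back
by `Φ`. -/
noncomputable def conn (h : Coord n → Matrix (Fin n) (Fin n) ℝ) (Φ : Coord m → Coord n)
    (X x : Coord m) : Matrix (Fin n) (Fin n) ℝ :=
  ∑ b, dmapDir Φ X x b • christoffelMatrix h b (Φ x)

/-- The covariant derivative of a field along `Φ` in the constant direction `X`. -/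
noncomputable def covDir (h : Coord n → Matrix (Fin n) (Fin n) ℝ) (Φ : Coord m → Coord n)
    (X : Coord m) (V : Coord m → Fin n → ℝ) (x : Coord m) : Fin n → ℝ :=
  ddVec X V x + (conn h Φ X x).mulVec (V x)

theorem covAlong_eq (h : Coord n → Matrix (Fin n) (Fin n) ℝ) (Φ : Coord m → Coord n)
    (V : Coord m → Fin n → ℝ) (i : Fin m) :
    covAlong h Φ V i = covDir h Φ (EuclideanSpace.single i 1) V := by
  funext x a
  simp only [covAlong, covDir, conn, pd_eq_dd, dmap_eq_dmapDir, ddVec, Matrix.sum_mulVec,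
    Matrix.smul_mulVec, Pi.add_apply, Finset.sum_apply, Pi.smul_apply, smul_eq_mul, Matrix.mulVec,
    dotProduct, Finset.mul_sum, christoffelMatrix, Matrix.of_apply]
  congr! 3
  ring

theorem conn_eq_sum (h : Coord n → Matrix (Fin n) (Fin n) ℝ) (Φ : Coord m → Coord n)
    (X x : Coord m) : conn h Φ X x = ∑ i, X i • conn h Φ (EuclideanSpace.single i 1) x := by
  simp only [conn, dmapDir_eq_sum Φ X, dmap_eq_dmapDir, Finset.sum_apply, Pi.smul_apply,
    Finset.sum_smul, Finset.smul_sum, smul_assoc]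
  exact Finset.sum_comm

theorem covDir_eq_sum (h : Coord n → Matrix (Fin n) (Fin n) ℝ) (Φ : Coord m → Coord n)
    (X : Coord m) (V : Coord m → Fin n → ℝ) (x : Coord m) :
    covDir h Φ X V x = ∑ i, X i • covAlong h Φ V i x := by
  have ddVec_eq : ddVec X V x = ∑ i, X i • ddVec (EuclideanSpace.single i 1) V x := by
    ext a
    simp [ddVec, dd_eq_sum_pd X, pd_eq_dd]
  simp only [covAlong_eq, covDir, smul_add, Finset.sum_add_distrib, ddVec_eq, conn_eq_sum h Φ X,
    Matrix.sum_mulVec, Matrix.smul_mulVec]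

/-- The curvature endomorphism `R(∂ᵢ, ∂ⱼ)` as a matrix. -/
noncomputable def riemannMatrix (h : Coord n → Matrix (Fin n) (Fin n) ℝ) (i j : Fin n)
    (y : Coord n) : Matrix (Fin n) (Fin n) ℝ :=
  ddMat (EuclideanSpace.single i 1) (christoffelMatrix h j) y
    - ddMat (EuclideanSpace.single j 1) (christoffelMatrix h i) y
    + (christoffelMatrix h i y * christoffelMatrix h j y
      - christoffelMatrix h j y * christoffelMatrix h i y)

theorem riemannMatrix_apply (h : Coord n → Matrix (Fin n) (Fin n) ℝ) (i j l k : Fin n)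
    (y : Coord n) : riemannMatrix h i j y l k = riemann h l k i j y := by
  simp only [riemann, Finset.sum_sub_distrib]
  rfl

theorem riemannVec_eq_mulVec (h : Coord n → Matrix (Fin n) (Fin n) ℝ) (y : Coord n)
    (X Y Z : Fin n → ℝ) :
    riemannVec h y X Y Z = (∑ i, ∑ j, (X i * Y j) • riemannMatrix h i j y).mulVec Z := by
  ext l
  simp only [riemannVec, Matrix.sum_mulVec, Matrix.smul_mulVec, Finset.sum_apply, Pi.smul_apply]
  simp only [Matrix.mulVec, dotProduct, smul_eq_mul, Finset.mul_sum, riemannMatrix_apply]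
  refine Finset.sum_congr rfl fun i _ => Finset.sum_congr rfl fun j _ =>
    Finset.sum_congr rfl fun k _ => ?_
  ring

/-- `Φ` is a smooth map from the open set `U` to the open set `W` with the metric `h`. -/
structure MapOn (h : Coord n → Matrix (Fin n) (Fin n) ℝ) (W : Set (Coord n))
    (Φ : Coord m → Coord n) (U : Set (Coord m)) : Prop where
  metric : MetricOn h W
  isOpen : IsOpen U
  smooth : ContDiffOn ℝ ∞ Φ U
  mapsTo : Set.MapsTo Φ U W

namespace MapOn

variable {h : Coord n → Matrix (Fin n) (Fin n) ℝ} {W : Set (Coord n)}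
  {Φ : Coord m → Coord n} {U : Set (Coord m)} {x : Coord m} {X Y : Coord m}
  {V V₁ V₂ : Coord m → Fin n → ℝ} {f f₁ f₂ : Coord m → ℝ}

theorem restrict {U' : Set (Coord m)} {W' : Set (Coord n)} (H : MapOn h W Φ U) (hU : U' ⊆ U)
    (hU' : IsOpen U') (hW : W' ⊆ W) (hW' : IsOpen W') (mapsTo : Set.MapsTo Φ U' W') :
    MapOn h W' Φ U' where
  metric := ⟨hW', fun i j => (H.metric.smooth i j).mono hW, fun y hy => H.metric.posDef y (hW hy)⟩
  isOpen := hU'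
  smooth := H.smooth.mono hU
  mapsTo := mapsTo

theorem differentiableAt {E : Type*} [NormedAddCommGroup E] [NormedSpace ℝ E] {F : Coord m → E}
    (H : MapOn h W Φ U) (hx : x ∈ U) (hF : ContDiffOn ℝ ∞ F U) : DifferentiableAt ℝ F x :=
  differentiableAt_of_contDiffOn H.isOpen hx hF

theorem contDiffOn_dmapDir (H : MapOn h W Φ U) : ContDiffOn ℝ ∞ (dmapDir Φ X) U :=
  Coord.contDiffOn_dmapDir H.isOpen H.smooth

theorem contDiffOn_dmap (H : MapOn h W Φ U) (i : Fin m) : ContDiffOn ℝ ∞ (dmap Φ i) U :=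
  H.contDiffOn_dmapDir

theorem contDiffOn_conn (H : MapOn h W Φ U) (a c : Fin n) :
    ContDiffOn ℝ ∞ (fun y => conn h Φ X y a c) U := by
  simp only [conn, Matrix.sum_apply, Matrix.smul_apply]
  exact ContDiffOn.sum fun b _ => (contDiffOn_pi.1 H.contDiffOn_dmapDir b).smul
    ((H.metric.contDiffOn_christoffel a b c).comp H.smooth H.mapsTo)

theorem contDiffOn_covDir (H : MapOn h W Φ U) (hV : ContDiffOn ℝ ∞ V U) :
    ContDiffOn ℝ ∞ (covDir h Φ X V) U :=
  (contDiffOn_ddVec H.isOpen hV).add (contDiffOn_mulVec H.contDiffOn_conn hV)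

theorem contDiffOn_metric_comp (H : MapOn h W Φ U) (a b : Fin n) :
    ContDiffOn ℝ ∞ (fun y => h (Φ y) a b) U :=
  (H.metric.smooth a b).comp H.smooth H.mapsTo

theorem contDiffOn_dot (H : MapOn h W Φ U) (h₁ : ContDiffOn ℝ ∞ V₁ U)
    (h₂ : ContDiffOn ℝ ∞ V₂ U) :
    ContDiffOn ℝ ∞ (fun y => dot (h (Φ y)) (V₁ y) (V₂ y)) U :=
  ContDiffOn.sum fun a _ => ContDiffOn.sum fun b _ =>
    ((H.contDiffOn_metric_comp a b).mul (contDiffOn_pi.1 h₁ a)).mul (contDiffOn_pi.1 h₂ b)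

theorem isSymm (H : MapOn h W Φ U) (hx : x ∈ U) : (h (Φ x)).IsSymm :=
  H.metric.isSymm (H.mapsTo hx)

theorem covDir_congr (H : MapOn h W Φ U) (hx : x ∈ U) (hV : ∀ y ∈ U, V₁ y = V₂ y) :
    covDir h Φ X V₁ x = covDir h Φ X V₂ x := by
  have ddVec_eq : ddVec X V₁ x = ddVec X V₂ x :=
    funext fun a => dd_congr H.isOpen hx fun y hy => congrFun (hV y hy) a
  rw [covDir, covDir, ddVec_eq, hV x hx]

theorem covDir_smul (H : MapOn h W Φ U) (hx : x ∈ U) (hf : ContDiffOn ℝ ∞ f U)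
    (hV : ContDiffOn ℝ ∞ V U) : covDir h Φ X (fun y => f y • V y) x
      = dd X f x • V x + f x • covDir h Φ X V x := by
  rw [covDir, covDir, ddVec_smul (H.differentiableAt hx hf) (H.differentiableAt hx hV),
    Matrix.mulVec_smul, smul_add, add_assoc]

theorem covDir_add (H : MapOn h W Φ U) (hx : x ∈ U) (h₁ : ContDiffOn ℝ ∞ V₁ U)
    (h₂ : ContDiffOn ℝ ∞ V₂ U) : covDir h Φ X (fun y => V₁ y + V₂ y) x
      = covDir h Φ X V₁ x + covDir h Φ X V₂ x := by
  rw [covDir, ddVec_add (H.differentiableAt hx h₁) (H.differentiableAt hx h₂),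
    Matrix.mulVec_add, add_add_add_comm]
  rfl

theorem covDir_smul_add_smul (H : MapOn h W Φ U) (hx : x ∈ U) (hf₁ : ContDiffOn ℝ ∞ f₁ U)
    (hV₁ : ContDiffOn ℝ ∞ V₁ U) (hf₂ : ContDiffOn ℝ ∞ f₂ U) (hV₂ : ContDiffOn ℝ ∞ V₂ U) :
    covDir h Φ X (fun y => f₁ y • V₁ y + f₂ y • V₂ y) x
      = dd X f₁ x • V₁ x + f₁ x • covDir h Φ X V₁ x
        + (dd X f₂ x • V₂ x + f₂ x • covDir h Φ X V₂ x) := by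
  rw [← H.covDir_smul hx hf₁ hV₁, ← H.covDir_smul hx hf₂ hV₂]
  exact H.covDir_add hx (hf₁.smul hV₁) (hf₂.smul hV₂)

theorem covDir_sub (H : MapOn h W Φ U) (hx : x ∈ U) (h₁ : ContDiffOn ℝ ∞ V₁ U)
    (h₂ : ContDiffOn ℝ ∞ V₂ U) : covDir h Φ X (fun y => V₁ y - V₂ y) x
      = covDir h Φ X V₁ x - covDir h Φ X V₂ x := by
  rw [eq_sub_iff_add_eq, ← H.covDir_add hx (h₁.sub h₂) h₂]
  simp only [sub_add_cancel]

theorem covDir_sum (H : MapOn h W Φ U) (hx : x ∈ U) {ι : Type*} {s : Finset ι}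
    {V : ι → Coord m → Fin n → ℝ} (hV : ∀ i ∈ s, ContDiffOn ℝ ∞ (V i) U) :
    covDir h Φ X (fun y => ∑ i ∈ s, V i y) x = ∑ i ∈ s, covDir h Φ X (V i) x := by
  rw [covDir, ddVec_sum fun i hi => H.differentiableAt hx (hV i hi), Matrix.mulVec_sum,
    ← Finset.sum_add_distrib]
  rfl

theorem ddMat_metric (H : MapOn h W Φ U) (hx : x ∈ U) :
    ddMat X (fun y => h (Φ y)) x
      = h (Φ x) * conn h Φ X x + (conn h Φ X x).transpose * h (Φ x) := by
  ext a b
  have dd_metric : dd X (fun y => h (Φ y) a b) x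
      = ∑ d, dmapDir Φ X x d * pd d (fun z => h z a b) (Φ x) :=
    dd_comp (H.differentiableAt hx H.smooth)
      (differentiableAt_of_contDiffOn H.metric.isOpen (H.mapsTo hx) (H.metric.smooth a b))
  simp only [ddMat, Matrix.of_apply, dd_metric, H.metric.pd_metric (H.mapsTo hx), conn,
    Matrix.mul_sum, Matrix.transpose_sum, Matrix.sum_mul, ← Finset.sum_add_distrib,
    Matrix.transpose_smul, Matrix.mul_smul, Matrix.smul_mul, ← smul_add, Matrix.sum_apply,
    Matrix.smul_apply, smul_eq_mul]

theorem dd_dot (H : MapOn h W Φ U) (hx : x ∈ U) (h₁ : ContDiffOn ℝ ∞ V₁ U)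
    (h₂ : ContDiffOn ℝ ∞ V₂ U) :
    dd X (fun y => dot (h (Φ y)) (V₁ y) (V₂ y)) x
      = dot (h (Φ x)) (covDir h Φ X V₁ x) (V₂ x) + dot (h (Φ x)) (V₁ x) (covDir h Φ X V₂ x) := by
  have adjoint : (conn h Φ X x).mulVec (V₁ x) ⬝ᵥ (h (Φ x)).mulVec (V₂ x)
      = V₁ x ⬝ᵥ (conn h Φ X x).transpose.mulVec ((h (Φ x)).mulVec (V₂ x)) := by
    rw [Matrix.dotProduct_mulVec _ (conn h Φ X x).transpose, Matrix.vecMul_transpose]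
  simp only [dot_eq_dotProduct]
  rw [dd_dotProduct (H.differentiableAt hx h₁)
      (H.differentiableAt hx (contDiffOn_mulVec H.contDiffOn_metric_comp h₂)),
    ddVec_mulVec (fun a b => H.differentiableAt hx (H.contDiffOn_metric_comp a b))
      (H.differentiableAt hx h₂), H.ddMat_metric hx]
  simp only [covDir, add_dotProduct, dotProduct_add, Matrix.mulVec_add, Matrix.add_mulVec,
    adjoint, Matrix.mulVec_mulVec]
  ring

theorem ddVec_dmapDir_comm (H : MapOn h W Φ U) (hx : x ∈ U) :
    ddVec X (dmapDir Φ Y) x = ddVec Y (dmapDir Φ X) x :=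
  funext fun a => dd_comm H.isOpen hx (contDiffOn_euclidean.1 H.smooth a)

theorem pd_dot (H : MapOn h W Φ U) (hx : x ∈ U) (i : Fin m) (h₁ : ContDiffOn ℝ ∞ V₁ U)
    (h₂ : ContDiffOn ℝ ∞ V₂ U) : pd i (fun y => dot (h (Φ y)) (V₁ y) (V₂ y)) x
      = dot (h (Φ x)) (covAlong h Φ V₁ i x) (V₂ x)
        + dot (h (Φ x)) (V₁ x) (covAlong h Φ V₂ i x) := by
  rw [covAlong_eq, covAlong_eq]
  exact H.dd_dot hx h₁ h₂

theorem covDir_dmapDir_comm (H : MapOn h W Φ U) (hx : x ∈ U) :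
    covDir h Φ X (dmapDir Φ Y) x = covDir h Φ Y (dmapDir Φ X) x := by
  have conn_mulVec (X Y : Coord m) : (conn h Φ X x).mulVec (dmapDir Φ Y x) = fun a =>
      ∑ b, ∑ c, christoffel h a b c (Φ x) * (dmapDir Φ X x b * dmapDir Φ Y x c) := by
    ext a
    simp only [conn, Matrix.sum_mulVec, Matrix.smul_mulVec, Finset.sum_apply, Pi.smul_apply]
    simp only [Matrix.mulVec, dotProduct, smul_eq_mul, Finset.mul_sum, christoffelMatrix,
      Matrix.of_apply]
    exact Finset.sum_congr rfl fun b _ => Finset.sum_congr rfl fun c _ => by ring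
  rw [covDir, covDir, H.ddVec_dmapDir_comm hx, conn_mulVec, conn_mulVec]
  congr 1
  funext a
  rw [Finset.sum_comm]
  congr! 2 with b _ c _
  rw [H.metric.christoffel_symm (H.mapsTo hx)]
  ring

theorem covAlong_dmap_comm (H : MapOn h W Φ U) (hx : x ∈ U) (i j : Fin m) :
    covAlong h Φ (dmap Φ j) i x = covAlong h Φ (dmap Φ i) j x := by
  rw [covAlong_eq, covAlong_eq]
  exact H.covDir_dmapDir_comm hx

theorem ddMat_conn (H : MapOn h W Φ U) (hx : x ∈ U) :
    ddMat X (conn h Φ Y) x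
      = ∑ i, ∑ j, (dmapDir Φ X x i * dmapDir Φ Y x j) •
          ddMat (EuclideanSpace.single i 1) (christoffelMatrix h j) (Φ x)
        + ∑ j, ddVec X (dmapDir Φ Y) x j • christoffelMatrix h j (Φ x) := by
  ext a c
  have smooth_dmap (j : Fin n) : ContDiffOn ℝ ∞ (fun y => dmapDir Φ Y y j) U :=
    contDiffOn_pi.1 H.contDiffOn_dmapDir j
  have smooth_christoffel (j : Fin n) : ContDiffOn ℝ ∞ (fun y => christoffel h a j c (Φ y)) U :=
    (H.metric.contDiffOn_christoffel a j c).comp H.smooth H.mapsTo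
  have dd_christoffel (j : Fin n) : dd X (fun y => christoffel h a j c (Φ y)) x
      = ∑ i, dmapDir Φ X x i * pd i (christoffel h a j c) (Φ x) :=
    dd_comp (H.differentiableAt hx H.smooth) (differentiableAt_of_contDiffOn H.metric.isOpen
      (H.mapsTo hx) (H.metric.contDiffOn_christoffel a j c))
  have dd_conn : dd X (fun y => conn h Φ Y y a c) x = ∑ j, (ddVec X (dmapDir Φ Y) x j *
      christoffel h a j c (Φ x)
        + dmapDir Φ Y x j * ∑ i, dmapDir Φ X x i * pd i (christoffel h a j c) (Φ x)) := by
    simp only [conn, Matrix.sum_apply, Matrix.smul_apply, smul_eq_mul, christoffelMatrix,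
      Matrix.of_apply]
    rw [dd_sum fun j _ => H.differentiableAt hx ((smooth_dmap j).mul (smooth_christoffel j))]
    refine Finset.sum_congr rfl fun j _ => ?_
    rw [dd_mul (H.differentiableAt hx (smooth_dmap j))
      (H.differentiableAt hx (smooth_christoffel j)), dd_christoffel]
    rfl
  rw [ddMat, Matrix.of_apply, dd_conn, Finset.sum_add_distrib, add_comm, Finset.sum_comm]
  simp only [Matrix.add_apply, Matrix.sum_apply, Matrix.smul_apply, smul_eq_mul, ddMat,
    Matrix.of_apply, christoffelMatrix, Finset.mul_sum]
  congr! 3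
  rw [pd_eq_dd]
  ring

theorem curvature_conn (H : MapOn h W Φ U) (hx : x ∈ U) :
    ddMat X (conn h Φ Y) x - ddMat Y (conn h Φ X) x
        + (conn h Φ X x * conn h Φ Y x - conn h Φ Y x * conn h Φ X x)
      = ∑ i, ∑ j, (dmapDir Φ X x i * dmapDir Φ Y x j) • riemannMatrix h i j (Φ x) := by
  have conn_mul (X Y : Coord m) : conn h Φ X x * conn h Φ Y x
      = ∑ i, ∑ j, (dmapDir Φ X x i * dmapDir Φ Y x j) •
          (christoffelMatrix h i (Φ x) * christoffelMatrix h j (Φ x)) := by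
    simp only [conn, Finset.sum_mul_sum, smul_mul_smul_comm]
  have swap (A : Fin n → Fin n → Matrix (Fin n) (Fin n) ℝ) :
      ∑ i, ∑ j, (dmapDir Φ Y x i * dmapDir Φ X x j) • A i j
        = ∑ i, ∑ j, (dmapDir Φ X x i * dmapDir Φ Y x j) • A j i := by
    rw [Finset.sum_comm]
    simp only [mul_comm]
  simp only [H.ddMat_conn hx, conn_mul, H.ddVec_dmapDir_comm hx (X := Y),
    swap fun i j => ddMat (EuclideanSpace.single i 1) (christoffelMatrix h j) (Φ x),
    swap fun i j => christoffelMatrix h i (Φ x) * christoffelMatrix h j (Φ x), riemannMatrix,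
    smul_add, smul_sub, Finset.sum_add_distrib, Finset.sum_sub_distrib]
  abel

theorem covDir_covDir (H : MapOn h W Φ U) (hx : x ∈ U) (hV : ContDiffOn ℝ ∞ V U) :
    covDir h Φ X (covDir h Φ Y V) x = ddVec X (ddVec Y V) x
      + ((conn h Φ Y x).mulVec (ddVec X V x) + (conn h Φ X x).mulVec (ddVec Y V x))
      + (ddMat X (conn h Φ Y) x + conn h Φ X x * conn h Φ Y x).mulVec (V x) := by
  have ddVec_covDir : ddVec X (covDir h Φ Y V) x = ddVec X (ddVec Y V) x
      + ((ddMat X (conn h Φ Y) x).mulVec (V x) + (conn h Φ Y x).mulVec (ddVec X V x)) := by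
    rw [← ddVec_mulVec (fun a b => H.differentiableAt hx (H.contDiffOn_conn a b))
      (H.differentiableAt hx hV)]
    exact ddVec_add (H.differentiableAt hx (contDiffOn_ddVec H.isOpen hV))
      (H.differentiableAt hx (contDiffOn_mulVec H.contDiffOn_conn hV))
  rw [covDir, ddVec_covDir]
  simp only [covDir, Matrix.mulVec_add, Matrix.add_mulVec, Matrix.mulVec_mulVec]
  abel

theorem covDir_covDir_sub (H : MapOn h W Φ U) (hx : x ∈ U) (hV : ContDiffOn ℝ ∞ V U) :
    covDir h Φ X (covDir h Φ Y V) x - covDir h Φ Y (covDir h Φ X V) x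
      = riemannVec h (Φ x) (dmapDir Φ X x) (dmapDir Φ Y x) (V x) := by
  have ddVec_comm : ddVec X (ddVec Y V) x = ddVec Y (ddVec X V) x :=
    funext fun a => dd_comm H.isOpen hx (contDiffOn_pi.1 hV a)
  rw [H.covDir_covDir hx hV, H.covDir_covDir hx hV, riemannVec_eq_mulVec, ← H.curvature_conn hx,
    ddVec_comm]
  simp only [Matrix.add_mulVec, Matrix.sub_mulVec]
  abel

theorem dot_comm (H : MapOn h W Φ U) (hx : x ∈ U) (u v : Fin n → ℝ) :
    dot (h (Φ x)) u v = dot (h (Φ x)) v u :=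
  Coord.dot_comm u v (H.isSymm hx)

end MapOn

end Coord

namespace Coord

theorem curvature_eq_zero_of_sectional_eq_zero {E : Type*} [Add E] (S : E → E → E → E → ℝ)
    (add : ∀ X X' Y Z W, S (X + X') Y Z W = S X Y Z W + S X' Y Z W)
    (skew₁₂ : ∀ X Y Z W, S X Y Z W = -S Y X Z W) (skew₃₄ : ∀ X Y Z W, S X Y Z W = -S X Y W Z)
    (bianchi : ∀ X Y Z W, S X Y Z W + S Y Z X W + S Z X Y W = 0)
    (sectional : ∀ X Y, S X Y Y X = 0) (X Y Z W : E) : S X Y Z W = 0 := by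
  have pair (X Y Z W : E) : S X Y Z W = S Z W X Y := by
    linarith [bianchi X Y Z W, bianchi Y Z W X, bianchi Z W X Y, bianchi W X Y Z,
      skew₃₄ Y Z W X, skew₃₄ Z W Y X, skew₁₂ X Z W Y, skew₃₄ Z X W Y, skew₁₂ Y W X Z,
      skew₃₄ W Y X Z, skew₃₄ W X Y Z, skew₃₄ X Y W Z]
  have add₃ (X Y Z Z' W : E) : S X Y (Z + Z') W = S X Y Z W + S X Y Z' W := by
    rw [pair, add, ← pair X Y, ← pair X Y]
  have add₂ (X Y Y' Z W : E) : S X (Y + Y') Z W = S X Y Z W + S X Y' Z W := by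
    linarith [skew₁₂ X (Y + Y') Z W, add Y Y' X Z W, skew₁₂ X Y Z W, skew₁₂ X Y' Z W]
  have add₄ (X Y Z W W' : E) : S X Y Z (W + W') = S X Y Z W + S X Y Z W' := by
    linarith [skew₃₄ X Y Z (W + W'), add₃ X Y W W' Z, skew₃₄ X Y Z W, skew₃₄ X Y Z W']
  have skew₂₃_zero (X Y W : E) : S X Y Y W = 0 := by
    have polarized := sectional (X + W) Y
    rw [add, add₄, add₄, sectional, sectional] at polarized
    have swap : S W Y Y X = S X Y Y W := by rw [pair, skew₁₂, skew₃₄, neg_neg]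
    linarith
  have skew₂₃ (X Y Z W : E) : S X Y Z W = -S X Z Y W := by
    have polarized := skew₂₃_zero X (Y + Z) W
    rw [add₂, add₃, add₃, skew₂₃_zero, skew₂₃_zero] at polarized
    linarith
  linarith [bianchi X Y Z W, skew₂₃ Y Z X W, skew₁₂ Y X Z W, skew₁₂ Z X Y W, skew₂₃ X Z Y W]

variable {m n : ℕ}

theorem riemannVec_add_left (h : Coord n → Matrix (Fin n) (Fin n) ℝ) (x : Coord n)
    (X X' Y Z : Fin n → ℝ) :
    riemannVec h x (X + X') Y Z = riemannVec h x X Y Z + riemannVec h x X' Y Z := by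
  simp only [riemannVec_eq_mulVec, Pi.add_apply, add_mul, add_smul, Finset.sum_add_distrib,
    Matrix.add_mulVec]

theorem MapOn.dd_dd_dot {h : Coord n → Matrix (Fin n) (Fin n) ℝ} {W : Set (Coord n)}
    {Φ : Coord m → Coord n} {U : Set (Coord m)} {x X Y : Coord m} {V₁ V₂ : Coord m → Fin n → ℝ}
    (H : MapOn h W Φ U) (hx : x ∈ U) (h₁ : ContDiffOn ℝ ∞ V₁ U) (h₂ : ContDiffOn ℝ ∞ V₂ U) :
    dd X (dd Y fun y => dot (h (Φ y)) (V₁ y) (V₂ y)) x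
      = dot (h (Φ x)) (covDir h Φ X (covDir h Φ Y V₁) x) (V₂ x)
        + dot (h (Φ x)) (covDir h Φ Y V₁ x) (covDir h Φ X V₂ x)
        + (dot (h (Φ x)) (covDir h Φ X V₁ x) (covDir h Φ Y V₂ x)
          + dot (h (Φ x)) (V₁ x) (covDir h Φ X (covDir h Φ Y V₂) x)) := by
  rw [dd_congr H.isOpen hx fun y hy => H.dd_dot hy h₁ h₂,
    dd_add (H.differentiableAt hx (H.contDiffOn_dot (H.contDiffOn_covDir h₁) h₂))
      (H.differentiableAt hx (H.contDiffOn_dot h₁ (H.contDiffOn_covDir h₂))),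
    H.dd_dot hx (H.contDiffOn_covDir h₁) h₂, H.dd_dot hx h₁ (H.contDiffOn_covDir h₂)]

theorem dmapDir_id (X : Fin n → ℝ) :
    dmapDir (id : Coord n → Coord n) (WithLp.toLp 2 X) = fun _ => X := by
  funext x
  rw [← ofLp_fderiv differentiableAt_id, fderiv_id]
  rfl

namespace MetricOn

variable {h : Coord n → Matrix (Fin n) (Fin n) ℝ} {W : Set (Coord n)} {x : Coord n}

theorem mapOn_id (H : MetricOn h W) : MapOn h W id W :=
  ⟨H, H.isOpen, contDiffOn_id, Set.mapsTo_id W⟩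

theorem riemannVec_eq (H : MetricOn h W) (hx : x ∈ W) (X Y Z : Fin n → ℝ) :
    riemannVec h x X Y Z
      = covDir h id (WithLp.toLp 2 X) (covDir h id (WithLp.toLp 2 Y) fun _ => Z) x
        - covDir h id (WithLp.toLp 2 Y) (covDir h id (WithLp.toLp 2 X) fun _ => Z) x := by
  rw [H.mapOn_id.covDir_covDir_sub hx contDiffOn_const, dmapDir_id, dmapDir_id]
  rfl

theorem riemannVec_skew (H : MetricOn h W) (hx : x ∈ W) (X Y Z : Fin n → ℝ) :
    riemannVec h x X Y Z = -riemannVec h x Y X Z := by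
  rw [H.riemannVec_eq hx, H.riemannVec_eq hx, neg_sub]

theorem riemannVec_bianchi (H : MetricOn h W) (hx : x ∈ W) (X Y Z : Fin n → ℝ) :
    riemannVec h x X Y Z + riemannVec h x Y Z X + riemannVec h x Z X Y = 0 := by
  have torsion_free (X Y Z : Fin n → ℝ) :
      covDir h id (WithLp.toLp 2 X) (covDir h id (WithLp.toLp 2 Y) fun _ => Z) x
        = covDir h id (WithLp.toLp 2 X) (covDir h id (WithLp.toLp 2 Z) fun _ => Y) x :=
    H.mapOn_id.covDir_congr hx fun y hy => by
      simpa only [dmapDir_id] using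
        H.mapOn_id.covDir_dmapDir_comm hy (X := WithLp.toLp 2 Y) (Y := WithLp.toLp 2 Z)
  rw [H.riemannVec_eq hx, H.riemannVec_eq hx, H.riemannVec_eq hx, torsion_free X Y Z,
    torsion_free Y Z X, torsion_free Z X Y]
  abel

theorem dot_riemannVec_skew (H : MetricOn h W) (hx : x ∈ W) (X Y Z V : Fin n → ℝ) :
    dot (h x) (riemannVec h x X Y Z) V = -dot (h x) (riemannVec h x X Y V) Z := by
  have M := H.mapOn_id
  have smooth_const (v : Fin n → ℝ) : ContDiffOn ℝ ∞ (fun _ : Coord n => v) W := contDiffOn_const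
  have comm := dd_comm (X := WithLp.toLp 2 X) (Y := WithLp.toLp 2 Y) H.isOpen hx
    (M.contDiffOn_dot (smooth_const Z) (smooth_const V))
  rw [M.dd_dd_dot hx (smooth_const Z) (smooth_const V),
    M.dd_dd_dot hx (smooth_const Z) (smooth_const V)] at comm
  rw [H.riemannVec_eq hx, H.riemannVec_eq hx, dot_sub_left, dot_sub_left,
    dot_comm _ Z (H.isSymm hx), dot_comm _ Z (H.isSymm hx)]
  simp only [id] at comm
  linarith

theorem riemannVec_of_const (H : MetricOn h W) (hx : x ∈ W) {c : ℝ}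
    (hc : ∀ X Y : Fin n → ℝ, dot (h x) (riemannVec h x X Y Y) X
      = c * (dot (h x) X X * dot (h x) Y Y - dot (h x) X Y ^ 2)) (X Y Z : Fin n → ℝ) :
    riemannVec h x X Y Z = c • (dot (h x) Y Z • X - dot (h x) X Z • Y) := by
  have sym (u v : Fin n → ℝ) : dot (h x) u v = dot (h x) v u := dot_comm u v (H.isSymm hx)
  have dot_sub_eq_zero := curvature_eq_zero_of_sectional_eq_zero
    (fun X Y Z V => dot (h x) (riemannVec h x X Y Z) V
      - c * (dot (h x) Y Z * dot (h x) X V - dot (h x) X Z * dot (h x) Y V))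
    (fun X X' Y Z V => by simp only [riemannVec_add_left, dot_add_left]; ring)
    (fun X Y Z V => by rw [H.riemannVec_skew hx X Y, dot_neg_left]; ring)
    (fun X Y Z V => by rw [H.dot_riemannVec_skew hx X Y Z]; ring)
    (fun X Y Z V => by
      have bianchi := congrArg (dot (h x) · V) (H.riemannVec_bianchi hx X Y Z)
      simp only [dot_add_left, dot_zero_left] at bianchi
      rw [sym Y Z, sym X Z, sym Y X]
      linarith)
    (fun X Y => by rw [hc, sym Y X]; ring)
  refine sub_eq_zero.1 (eq_zero_of_dot_self_eq_zero (H.posDef x hx) ?_)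
  rw [dot_sub_left, dot_smul_left, dot_sub_left, dot_smul_left, dot_smul_left]
  exact dot_sub_eq_zero X Y Z _

end MetricOn

end Coord

/-! ### Hypersurfaces -/

namespace Coord

variable {m n : ℕ}

/-- `Φ` is an isometric immersion of the open set `U` with the metric `g` into the open set `W`
with the metric `h`. -/
structure IsometricOn (g : Coord m → Matrix (Fin m) (Fin m) ℝ)
    (h : Coord n → Matrix (Fin n) (Fin n) ℝ) (W : Set (Coord n))
    (Φ : Coord m → Coord n) (U : Set (Coord m)) : Prop extends MapOn h W Φ U where
  posDef : ∀ x ∈ U, (g x).PosDef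
  isometric : ∀ x ∈ U, ∀ i j, g x i j = dot (h (Φ x)) (dmap Φ i x) (dmap Φ j x)

/-- The frame of tangent vectors along `Φ` dual to the coordinate frame `dmap Φ i`. -/
noncomputable def dualFrame (g : Coord m → Matrix (Fin m) (Fin m) ℝ) (Φ : Coord m → Coord n)
    (i : Fin m) (x : Coord m) : Fin n → ℝ :=
  ∑ j, (g x)⁻¹ i j • dmap Φ j x

theorem dot_dualFrame (G : Matrix (Fin n) (Fin n) ℝ) (g : Coord m → Matrix (Fin m) (Fin m) ℝ)
    (Φ : Coord m → Coord n) (u : Fin n → ℝ) (i : Fin m) (x : Coord m) :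
    dot G u (dualFrame g Φ i x) = ∑ j, (g x)⁻¹ i j * dot G u (dmap Φ j x) := by
  simp only [dualFrame, dot_sum_right, dot_smul_right]

section Traces

variable (g : Coord m → Matrix (Fin m) (Fin m) ℝ) (h : Coord n → Matrix (Fin n) (Fin n) ℝ)
  (Φ : Coord m → Coord n)

theorem secondFundForm_eq (i j : Fin m) : secondFundForm g h Φ i j = fun x =>
    covAlong h Φ (dmap Φ j) i x - ∑ k, christoffel g k i j x • dmap Φ k x := by
  ext x a
  simp [secondFundForm, Finset.sum_apply]

theorem tension_eq_sum :
    tension g h Φ = fun x => ∑ i, ∑ j, (g x)⁻¹ i j • secondFundForm g h Φ i j x := by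
  ext x a
  simp [tension, Finset.sum_apply]

theorem bitension_eq_sum (x : Coord m) :
    bitension g h Φ x = ∑ i, ∑ j, (g x)⁻¹ i j •
      (covAlong h Φ (covAlong h Φ (tension g h Φ) j) i x
        - ∑ k, christoffel g k i j x • covAlong h Φ (tension g h Φ) k x
        - riemannVec h (Φ x) (dmap Φ i x) (tension g h Φ x) (dmap Φ j x)) := by
  ext a
  simp [bitension, roughLaplacian, Finset.sum_apply, mul_sub, Finset.sum_sub_distrib]

/-- The squared norm `⟨τ(Φ), τ(Φ)⟩` of the tension field. -/
noncomputable def tensionNormSq (x : Coord m) : ℝ :=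
  dot (h (Φ x)) (tension g h Φ x) (tension g h Φ x)

end Traces

namespace IsometricOn

variable {g : Coord m → Matrix (Fin m) (Fin m) ℝ}
  {h : Coord n → Matrix (Fin n) (Fin n) ℝ} {W : Set (Coord n)}
  {Φ : Coord m → Coord n} {U : Set (Coord m)} {x : Coord m}

theorem restrict {U' : Set (Coord m)} {W' : Set (Coord n)} (H : IsometricOn g h W Φ U)
    (hU : U' ⊆ U) (hU' : IsOpen U') (hW : W' ⊆ W) (hW' : IsOpen W')
    (mapsTo : Set.MapsTo Φ U' W') : IsometricOn g h W' Φ U' :=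
  ⟨H.toMapOn.restrict hU hU' hW hW' mapsTo, fun x hx => H.posDef x (hU hx),
    fun x hx => H.isometric x (hU hx)⟩

theorem mono {U' : Set (Coord m)} (H : IsometricOn g h W Φ U) (hU : U' ⊆ U)
    (hU' : IsOpen U') : IsometricOn g h W Φ U' :=
  H.restrict hU hU' subset_rfl H.metric.isOpen (H.mapsTo.mono_left hU)

theorem metricOn (H : IsometricOn g h W Φ U) : MetricOn g U where
  isOpen := H.isOpen
  smooth i j := (H.contDiffOn_dot (H.contDiffOn_dmap i) (H.contDiffOn_dmap j)).congr
    fun x hx => H.isometric x hx i j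
  posDef := H.posDef

theorem dot_dmapDir_dmap (H : IsometricOn g h W Φ U) (hx : x ∈ U) (X : Coord m) (k : Fin m) :
    dot (h (Φ x)) (dmapDir Φ X x) (dmap Φ k x) = (g x).mulVec X k := by
  rw [dmapDir_eq_sum, dot_sum_left]
  refine Finset.sum_congr rfl fun i _ => ?_
  rw [dot_smul_left, ← H.isometric x hx, (H.metricOn.isSymm hx).apply k i, mul_comm]

theorem dot_dmapDir_dmapDir (H : IsometricOn g h W Φ U) (hx : x ∈ U) (X Y : Coord m) :
    dot (h (Φ x)) (dmapDir Φ X x) (dmapDir Φ Y x) = dot (g x) X Y := by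
  rw [dmapDir_eq_sum Φ Y, dot_sum_right, dot_comm X Y (H.metricOn.isSymm hx), dot_eq_dotProduct]
  exact Finset.sum_congr rfl fun j _ => by rw [dot_smul_right, H.dot_dmapDir_dmap hx]

theorem dot_dmap_dualFrame (H : IsometricOn g h W Φ U) (hx : x ∈ U) (i k : Fin m) :
    dot (h (Φ x)) (dmap Φ k x) (dualFrame g Φ i x) = if i = k then 1 else 0 := by
  rw [← Matrix.one_apply, ← H.metricOn.inv_mul hx, dot_dualFrame, Matrix.mul_apply]
  refine Finset.sum_congr rfl fun j _ => ?_
  rw [← H.isometric x hx, (H.metricOn.isSymm hx).apply]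

theorem contDiffOn_dualFrame (H : IsometricOn g h W Φ U) (i : Fin m) :
    ContDiffOn ℝ ∞ (dualFrame g Φ i) U :=
  ContDiffOn.sum fun j _ => (H.metricOn.contDiffOn_inv i j).smul (H.contDiffOn_dmap j)

theorem dot_dmap_covAlong_dualFrame (H : IsometricOn g h W Φ U) (hx : x ∈ U)
    (i k l : Fin m) : dot (h (Φ x)) (dmap Φ k x) (covAlong h Φ (dualFrame g Φ i) l x)
      = -dot (h (Φ x)) (covAlong h Φ (dmap Φ k) l x) (dualFrame g Φ i x) := by
  have pd_eq_zero : pd l (fun y => dot (h (Φ y)) (dmap Φ k y) (dualFrame g Φ i y)) x = 0 :=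
    dd_eq_zero_of_const H.isOpen hx fun y hy => H.dot_dmap_dualFrame hy i k
  rw [H.pd_dot hx l (H.contDiffOn_dmap k) (H.contDiffOn_dualFrame i)] at pd_eq_zero
  linarith

theorem dot_covAlong_dmap (H : IsometricOn g h W Φ U) (hx : x ∈ U) (i j k : Fin m) :
    dot (h (Φ x)) (covAlong h Φ (dmap Φ j) i x) (dmap Φ k x)
      = (g x).mulVec (fun l => christoffel g l i j x) k := by
  have compatible (i j k : Fin m) : pd i (fun z => g z j k) x
      = dot (h (Φ x)) (covAlong h Φ (dmap Φ j) i x) (dmap Φ k x)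
        + dot (h (Φ x)) (covAlong h Φ (dmap Φ k) i x) (dmap Φ j x) := by
    rw [pd_eq_dd, dd_congr H.isOpen hx fun y hy => H.isometric y hy j k, ← pd_eq_dd,
      H.pd_dot hx i (H.contDiffOn_dmap j) (H.contDiffOn_dmap k), H.dot_comm hx (dmap Φ j x)]
  rw [H.metricOn.metric_mulVec_christoffel hx]
  change _ = (1 / 2) * (pd i (fun z => g z j k) x + pd j (fun z => g z i k) x
    - pd k (fun z => g z i j) x)
  rw [compatible i j k, compatible j i k, compatible k i j, H.covAlong_dmap_comm hx j i,
    H.covAlong_dmap_comm hx k i, H.covAlong_dmap_comm hx k j]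
  ring

theorem dot_secondFundForm_dmap (H : IsometricOn g h W Φ U) (hx : x ∈ U) (i j k : Fin m) :
    dot (h (Φ x)) (secondFundForm g h Φ i j x) (dmap Φ k x) = 0 := by
  rw [secondFundForm_eq, dot_sub_left, H.dot_covAlong_dmap hx, sub_eq_zero,
    ← H.dot_dmapDir_dmap hx (WithLp.toLp 2 fun l => christoffel g l i j x), dmapDir_eq_sum]

theorem dot_tension_dmap (H : IsometricOn g h W Φ U) (hx : x ∈ U) (k : Fin m) :
    dot (h (Φ x)) (tension g h Φ x) (dmap Φ k x) = 0 := by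
  simp only [tension_eq_sum, dot_sum_left, dot_smul_left, H.dot_secondFundForm_dmap hx, mul_zero,
    Finset.sum_const_zero]

theorem contDiffOn_tension (H : IsometricOn g h W Φ U) : ContDiffOn ℝ ∞ (tension g h Φ) U := by
  simp only [tension_eq_sum, secondFundForm_eq, covAlong_eq]
  exact ContDiffOn.sum fun i _ => ContDiffOn.sum fun j _ =>
    (H.metricOn.contDiffOn_inv i j).smul ((H.contDiffOn_covDir (H.contDiffOn_dmap j)).sub
      (ContDiffOn.sum fun k _ =>
        (H.metricOn.contDiffOn_christoffel k i j).smul (H.contDiffOn_dmap k)))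

theorem contDiffOn_tensionNormSq (H : IsometricOn g h W Φ U) :
    ContDiffOn ℝ ∞ (tensionNormSq g h Φ) U :=
  H.contDiffOn_dot H.contDiffOn_tension H.contDiffOn_tension

theorem tensionNormSq_nonneg (H : IsometricOn g h W Φ U) (hx : x ∈ U) :
    0 ≤ tensionNormSq g h Φ x := by
  rw [tensionNormSq, dot_eq_dotProduct]
  exact (H.metric.posDef _ (H.mapsTo hx)).posSemidef.dotProduct_mulVec_nonneg _

end IsometricOn

/-- `Φ` is an isometric immersion of a hypersurface into a space of constant curvature `c`, with
the unit normal field `η` and the tension field `F η`. -/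
structure HypersurfaceOn (c : ℝ) (g : Coord m → Matrix (Fin m) (Fin m) ℝ)
    (h : Coord (m + 1) → Matrix (Fin (m + 1)) (Fin (m + 1)) ℝ) (W : Set (Coord (m + 1)))
    (Φ : Coord m → Coord (m + 1)) (U : Set (Coord m)) (F : Coord m → ℝ)
    (η : Coord m → Fin (m + 1) → ℝ) : Prop extends IsometricOn g h W Φ U where
  curvature : ∀ y ∈ W, ∀ X Y Z : Fin (m + 1) → ℝ,
    riemannVec h y X Y Z = c • (dot (h y) Y Z • X - dot (h y) X Z • Y)
  smooth_F : ContDiffOn ℝ ∞ F U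
  smooth_normal : ContDiffOn ℝ ∞ η U
  unit : ∀ x ∈ U, dot (h (Φ x)) (η x) (η x) = 1
  normal : ∀ x ∈ U, ∀ i, dot (h (Φ x)) (η x) (dmap Φ i x) = 0
  tension_eq : ∀ x ∈ U, tension g h Φ x = F x • η x

namespace HypersurfaceOn

variable {c : ℝ} {g : Coord m → Matrix (Fin m) (Fin m) ℝ}
  {h : Coord (m + 1) → Matrix (Fin (m + 1)) (Fin (m + 1)) ℝ} {W : Set (Coord (m + 1))}
  {Φ : Coord m → Coord (m + 1)} {U : Set (Coord m)} {F : Coord m → ℝ}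
  {η : Coord m → Fin (m + 1) → ℝ} {x : Coord m}

theorem mono {U' : Set (Coord m)} (H : HypersurfaceOn c g h W Φ U F η) (hU : U' ⊆ U)
    (ho : IsOpen U') : HypersurfaceOn c g h W Φ U' F η :=
  ⟨H.toIsometricOn.mono hU ho, H.curvature, H.smooth_F.mono hU, H.smooth_normal.mono hU,
    fun x hx => H.unit x (hU hx), fun x hx => H.normal x (hU hx),
    fun x hx => H.tension_eq x (hU hx)⟩

theorem dot_normal_dmapDir (H : HypersurfaceOn c g h W Φ U F η) (hx : x ∈ U) (X : Coord m) :
    dot (h (Φ x)) (η x) (dmapDir Φ X x) = 0 := by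
  simp only [dmapDir_eq_sum, dot_sum_right, dot_smul_right, H.normal x hx, mul_zero,
    Finset.sum_const_zero]

theorem dot_normal_dualFrame (H : HypersurfaceOn c g h W Φ U F η) (hx : x ∈ U) (i : Fin m) :
    dot (h (Φ x)) (η x) (dualFrame g Φ i x) = 0 := by
  simp only [dot_dualFrame, H.normal x hx, mul_zero, Finset.sum_const_zero]

theorem ext_dot (H : HypersurfaceOn c g h W Φ U F η) (hx : x ∈ U) {u v : Fin (m + 1) → ℝ}
    (hη : dot (h (Φ x)) u (η x) = dot (h (Φ x)) v (η x))
    (hT : ∀ i, dot (h (Φ x)) u (dmap Φ i x) = dot (h (Φ x)) v (dmap Φ i x)) : u = v := by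
  let components : (Fin (m + 1) → ℝ) →ₗ[ℝ] (Fin (m + 1) → ℝ) :=
    { toFun := fun w => Fin.cons (dot (h (Φ x)) w (η x)) fun i => dot (h (Φ x)) w (dmap Φ i x)
      map_add' := fun a b => funext <| Fin.cases (by simp [dot_add_left]) (by simp [dot_add_left])
      map_smul' := fun t a =>
        funext <| Fin.cases (by simp [dot_smul_left]) (by simp [dot_smul_left]) }
  have surjective : Function.Surjective components := fun r => by
    refine ⟨r 0 • η x + ∑ i, r i.succ • dualFrame g Φ i x, funext <| Fin.cases ?_ fun i => ?_⟩
    · change dot (h (Φ x)) _ (η x) = r 0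
      simp only [H.dot_comm hx _ (η x), dot_add_right, dot_smul_right, dot_sum_right,
        H.unit x hx, H.dot_normal_dualFrame hx, mul_one, mul_zero, Finset.sum_const_zero, add_zero]
    · change dot (h (Φ x)) _ (dmap Φ i x) = r i.succ
      simp only [dot_add_left, dot_smul_left, dot_sum_left, H.normal x hx,
        H.dot_comm hx (dualFrame g Φ _ x), H.dot_dmap_dualFrame hx, mul_zero, zero_add, mul_ite,
        mul_one, Finset.sum_ite_eq', Finset.mem_univ, if_true]
  exact LinearMap.injective_iff_surjective.2 surjective (funext <| Fin.cases hη hT)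

theorem eq_sum_smul_dualFrame (H : HypersurfaceOn c g h W Φ U F η) (hx : x ∈ U)
    {u : Fin (m + 1) → ℝ} (hu : dot (h (Φ x)) u (η x) = 0) :
    u = ∑ i, dot (h (Φ x)) u (dmap Φ i x) • dualFrame g Φ i x :=
  H.ext_dot hx
    (by simp only [hu, H.dot_comm hx _ (η x), dot_sum_right, dot_smul_right,
      H.dot_normal_dualFrame hx, mul_zero, Finset.sum_const_zero])
    fun k => by simp only [dot_sum_left, dot_smul_left, H.dot_comm hx (dualFrame g Φ _ x),
      H.dot_dmap_dualFrame hx, mul_ite, mul_one, mul_zero, Finset.sum_ite_eq', Finset.mem_univ,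
      if_true]

theorem eq_sum_smul_dmap (H : HypersurfaceOn c g h W Φ U F η) (hx : x ∈ U)
    {u : Fin (m + 1) → ℝ} (hu : dot (h (Φ x)) u (η x) = 0) :
    u = ∑ i, dot (h (Φ x)) u (dualFrame g Φ i x) • dmap Φ i x := by
  conv_lhs => rw [H.eq_sum_smul_dualFrame hx hu]
  simp only [dualFrame, dot_sum_right, dot_smul_right, Finset.smul_sum, Finset.sum_smul]
  rw [Finset.sum_comm]
  refine Finset.sum_congr rfl fun i _ => Finset.sum_congr rfl fun j _ => ?_
  rw [smul_smul, mul_comm, H.metricOn.inv_symm hx]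

theorem dot_covDir_normal (H : HypersurfaceOn c g h W Φ U F η) (hx : x ∈ U) (X : Coord m) :
    dot (h (Φ x)) (covDir h Φ X η x) (η x) = 0 := by
  have dd_unit := H.dd_dot hx H.smooth_normal H.smooth_normal (X := X)
  rw [dd_eq_zero_of_const H.isOpen hx H.unit, H.dot_comm hx (η x)] at dd_unit
  linarith

theorem dot_covDir_normal_dmapDir (H : HypersurfaceOn c g h W Φ U F η) (hx : x ∈ U)
    (X Y : Coord m) : dot (h (Φ x)) (covDir h Φ X η x) (dmapDir Φ Y x)
      = -dot (h (Φ x)) (η x) (covDir h Φ X (dmapDir Φ Y) x) := by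
  have dd_normal := H.dd_dot hx H.smooth_normal (H.contDiffOn_dmapDir (X := Y)) (X := X)
  rw [dd_eq_zero_of_const H.isOpen hx fun y hy => H.dot_normal_dmapDir hy Y] at dd_normal
  linarith

theorem dot_covDir_normal_symm (H : HypersurfaceOn c g h W Φ U F η) (hx : x ∈ U)
    (X Y : Coord m) : dot (h (Φ x)) (covDir h Φ X η x) (dmapDir Φ Y x)
      = dot (h (Φ x)) (covDir h Φ Y η x) (dmapDir Φ X x) := by
  rw [H.dot_covDir_normal_dmapDir hx, H.dot_covDir_normal_dmapDir hx, H.covDir_dmapDir_comm hx]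

theorem codazzi (H : HypersurfaceOn c g h W Φ U F η) (hx : x ∈ U) (X Y : Coord m) :
    covDir h Φ X (covDir h Φ Y η) x = covDir h Φ Y (covDir h Φ X η) x := by
  have curvature := H.covDir_covDir_sub hx H.smooth_normal (X := X) (Y := Y)
  rw [H.curvature _ (H.mapsTo hx), H.dot_comm hx _ (η x), H.dot_comm hx _ (η x),
    H.dot_normal_dmapDir hx, H.dot_normal_dmapDir hx] at curvature
  simpa [sub_eq_zero] using curvature

theorem dot_secondFundForm_normal (H : HypersurfaceOn c g h W Φ U F η) (hx : x ∈ U)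
    (i j : Fin m) : dot (h (Φ x)) (secondFundForm g h Φ i j x) (η x)
      = -dot (h (Φ x)) (covAlong h Φ η i x) (dmap Φ j x) := by
  rw [covAlong_eq, dmap_eq_dmapDir, H.dot_covDir_normal_dmapDir hx, neg_neg, H.dot_comm hx,
    ← dmap_eq_dmapDir, ← covAlong_eq]
  simp only [secondFundForm_eq, dot_sub_right, dot_sum_right, dot_smul_right, H.normal x hx,
    mul_zero, Finset.sum_const_zero, sub_zero]

theorem F_eq_neg_trace (H : HypersurfaceOn c g h W Φ U F η) (hx : x ∈ U) :
    F x = -∑ i, dot (h (Φ x)) (covAlong h Φ η i x) (dualFrame g Φ i x) := by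
  have F_eq_dot : F x = dot (h (Φ x)) (tension g h Φ x) (η x) := by
    rw [H.tension_eq x hx, dot_smul_left, H.unit x hx, mul_one]
  simp only [F_eq_dot, tension_eq_sum, dot_sum_left, dot_smul_left, dot_dualFrame,
    H.dot_secondFundForm_normal hx, mul_neg, Finset.sum_neg_distrib]

end HypersurfaceOn

end Coord

namespace Coord

namespace HypersurfaceOn

variable {m : ℕ} {c : ℝ} {g : Coord m → Matrix (Fin m) (Fin m) ℝ}
  {h : Coord (m + 1) → Matrix (Fin (m + 1)) (Fin (m + 1)) ℝ} {W : Set (Coord (m + 1))}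
  {Φ : Coord m → Coord (m + 1)} {U : Set (Coord m)} {F : Coord m → ℝ}
  {η : Coord m → Fin (m + 1) → ℝ} {x : Coord m}

theorem contDiffOn_covAlong_normal (H : HypersurfaceOn c g h W Φ U F η) (i : Fin m) :
    ContDiffOn ℝ ∞ (covAlong h Φ η i) U := by
  rw [covAlong_eq]
  exact H.contDiffOn_covDir H.smooth_normal

theorem dot_covAlong_normal_symm (H : HypersurfaceOn c g h W Φ U F η) (hx : x ∈ U) (i j : Fin m) :
    dot (h (Φ x)) (covAlong h Φ η i x) (dmap Φ j x)
      = dot (h (Φ x)) (covAlong h Φ η j x) (dmap Φ i x) := by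
  rw [covAlong_eq, covAlong_eq]
  exact H.dot_covDir_normal_symm hx _ _

theorem dot_covAlong_normal (H : HypersurfaceOn c g h W Φ U F η) (hx : x ∈ U) (i : Fin m) :
    dot (h (Φ x)) (covAlong h Φ η i x) (η x) = 0 := by
  rw [covAlong_eq]
  exact H.dot_covDir_normal hx _

theorem covAlong_covAlong_normal_comm (H : HypersurfaceOn c g h W Φ U F η) (hx : x ∈ U)
    (i j : Fin m) :
    covAlong h Φ (covAlong h Φ η j) i x = covAlong h Φ (covAlong h Φ η i) j x := by
  simp only [covAlong_eq]
  exact H.codazzi hx _ _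

theorem pd_F (H : HypersurfaceOn c g h W Φ U F η) (hx : x ∈ U) (l : Fin m) :
    pd l F x
      = -∑ i, dot (h (Φ x)) (covAlong h Φ (covAlong h Φ η i) l x) (dualFrame g Φ i x)
        + ∑ i, ∑ k, dot (h (Φ x)) (covAlong h Φ η i x) (dualFrame g Φ k x) *
          dot (h (Φ x)) (covAlong h Φ (dmap Φ k) l x) (dualFrame g Φ i x) := by
  have smooth_summand (i : Fin m) : ContDiffOn ℝ ∞
      (fun y => -dot (h (Φ y)) (covAlong h Φ η i y) (dualFrame g Φ i y)) U :=
    (H.contDiffOn_dot (H.contDiffOn_covAlong_normal i) (H.contDiffOn_dualFrame i)).neg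
  have pd_summand (i : Fin m) :
      pd l (fun y => -dot (h (Φ y)) (covAlong h Φ η i y) (dualFrame g Φ i y)) x
        = -dot (h (Φ x)) (covAlong h Φ (covAlong h Φ η i) l x) (dualFrame g Φ i x)
          - dot (h (Φ x)) (covAlong h Φ η i x) (covAlong h Φ (dualFrame g Φ i) l x) := by
    rw [pd_eq_dd, dd_neg, ← pd_eq_dd,
      H.pd_dot hx l (H.contDiffOn_covAlong_normal i) (H.contDiffOn_dualFrame i), neg_add']
  have dot_covAlong_dualFrame (i : Fin m) :
      dot (h (Φ x)) (covAlong h Φ η i x) (covAlong h Φ (dualFrame g Φ i) l x)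
        = -∑ k, dot (h (Φ x)) (covAlong h Φ η i x) (dualFrame g Φ k x) *
          dot (h (Φ x)) (covAlong h Φ (dmap Φ k) l x) (dualFrame g Φ i x) := by
    conv_lhs => rw [H.eq_sum_smul_dmap hx (H.dot_covAlong_normal hx i)]
    simp only [dot_sum_left, dot_smul_left, H.dot_dmap_covAlong_dualFrame hx, mul_neg,
      Finset.sum_neg_distrib]
  rw [pd_eq_dd, dd_congr H.isOpen hx fun y hy =>
      (H.F_eq_neg_trace hy).trans (Finset.sum_neg_distrib _).symm,
    dd_sum fun i _ => H.differentiableAt hx (smooth_summand i)]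
  simp only [← pd_eq_dd, pd_summand, dot_covAlong_dualFrame, sub_neg_eq_add,
    Finset.sum_add_distrib, Finset.sum_neg_distrib]

theorem dot_covAlong_normal_covAlong_dmap (H : HypersurfaceOn c g h W Φ U F η) (hx : x ∈ U)
    (i j l : Fin m) : dot (h (Φ x)) (covAlong h Φ η l x) (covAlong h Φ (dmap Φ j) i x)
      = ∑ k, christoffel g k i j x * dot (h (Φ x)) (covAlong h Φ η k x) (dmap Φ l x) := by
  have dot_secondFundForm :
      dot (h (Φ x)) (covAlong h Φ η l x) (secondFundForm g h Φ i j x) = 0 := by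
    rw [H.eq_sum_smul_dmap hx (H.dot_covAlong_normal hx l)]
    simp only [dot_sum_left, dot_smul_left, H.dot_comm hx (dmap Φ _ x),
      H.dot_secondFundForm_dmap hx, mul_zero, Finset.sum_const_zero]
  simp only [secondFundForm_eq, dot_sub_right, dot_sum_right, dot_smul_right,
    H.dot_covAlong_normal_symm hx l] at dot_secondFundForm
  exact sub_eq_zero.1 dot_secondFundForm

theorem dot_covAlong_covAlong_normal_dmap (H : HypersurfaceOn c g h W Φ U F η) (hx : x ∈ U)
    (i j l : Fin m) : dot (h (Φ x)) (covAlong h Φ (covAlong h Φ η j) i x) (dmap Φ l x)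
      = dot (h (Φ x)) (covAlong h Φ (covAlong h Φ η i) l x) (dmap Φ j x)
        + dot (h (Φ x)) (covAlong h Φ η l x) (covAlong h Φ (dmap Φ j) i x)
        - dot (h (Φ x)) (covAlong h Φ η j x) (covAlong h Φ (dmap Φ i) l x) := by
  have pd_symm : pd i (fun y => dot (h (Φ y)) (covAlong h Φ η j y) (dmap Φ l y)) x
      = pd i (fun y => dot (h (Φ y)) (covAlong h Φ η l y) (dmap Φ j y)) x :=
    dd_congr H.isOpen hx fun y hy => H.dot_covAlong_normal_symm hy j l
  rw [H.pd_dot hx i (H.contDiffOn_covAlong_normal j) (H.contDiffOn_dmap l),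
    H.pd_dot hx i (H.contDiffOn_covAlong_normal l) (H.contDiffOn_dmap j)] at pd_symm
  rw [H.covAlong_covAlong_normal_comm hx l i, H.covAlong_dmap_comm hx l i]
  linarith

theorem sum_inv_mul_dot_covAlong_normal (H : HypersurfaceOn c g h W Φ U F η) (hx : x ∈ U)
    (V : Fin m → Fin (m + 1) → ℝ) :
    ∑ i, ∑ j, (g x)⁻¹ i j * dot (h (Φ x)) (covAlong h Φ η j x) (V i)
      = ∑ k, ∑ i, dot (h (Φ x)) (covAlong h Φ η k x) (dualFrame g Φ i x) *
          dot (h (Φ x)) (V i) (dualFrame g Φ k x) := by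
  have expand (j : Fin m) (v : Fin (m + 1) → ℝ) : dot (h (Φ x)) (covAlong h Φ η j x) v
      = ∑ k, dot (h (Φ x)) (covAlong h Φ η k x) (dmap Φ j x) *
          dot (h (Φ x)) v (dualFrame g Φ k x) := by
    conv_lhs => rw [H.eq_sum_smul_dualFrame hx (H.dot_covAlong_normal hx j)]
    simp only [H.dot_covAlong_normal_symm hx j, H.dot_comm hx _ v, dot_sum_right, dot_smul_right]
  rw [Finset.sum_comm (f := fun k i => _ * dot _ (V i) (dualFrame g Φ k x))]
  refine Finset.sum_congr rfl fun i _ => ?_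
  simp only [expand _ (V i), dot_dualFrame _ g Φ (covAlong h Φ η _ x), Finset.mul_sum,
    Finset.sum_mul, mul_assoc]
  exact Finset.sum_comm

theorem divergence_weingarten (H : HypersurfaceOn c g h W Φ U F η) (hx : x ∈ U) (l : Fin m) :
    ∑ i, ∑ j, (g x)⁻¹ i j *
      (dot (h (Φ x)) (covAlong h Φ (covAlong h Φ η j) i x) (dmap Φ l x)
        - ∑ k, christoffel g k i j x * dot (h (Φ x)) (covAlong h Φ η k x) (dmap Φ l x))
      = -pd l F x := by
  have summand (i j : Fin m) :
      dot (h (Φ x)) (covAlong h Φ (covAlong h Φ η j) i x) (dmap Φ l x)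
        - ∑ k, christoffel g k i j x * dot (h (Φ x)) (covAlong h Φ η k x) (dmap Φ l x)
      = dot (h (Φ x)) (covAlong h Φ (covAlong h Φ η i) l x) (dmap Φ j x)
        - dot (h (Φ x)) (covAlong h Φ η j x) (covAlong h Φ (dmap Φ i) l x) := by
    rw [H.dot_covAlong_covAlong_normal_dmap hx, H.dot_covAlong_normal_covAlong_dmap hx i j l]
    ring
  simp only [summand, mul_sub, Finset.sum_sub_distrib]
  rw [H.sum_inv_mul_dot_covAlong_normal hx fun i => covAlong h Φ (dmap Φ i) l x, H.pd_F hx]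
  simp only [dot_dualFrame _ g Φ (covAlong h Φ (covAlong h Φ η _) l x)]
  ring

theorem covAlong_tension (H : HypersurfaceOn c g h W Φ U F η) (hx : x ∈ U) (j : Fin m) :
    covAlong h Φ (tension g h Φ) j x = pd j F x • η x + F x • covAlong h Φ η j x := by
  rw [covAlong_eq, covAlong_eq, H.covDir_congr hx H.tension_eq,
    H.covDir_smul hx H.smooth_F H.smooth_normal]
  rfl

theorem covAlong_covAlong_tension (H : HypersurfaceOn c g h W Φ U F η) (hx : x ∈ U)
    (i j : Fin m) : covAlong h Φ (covAlong h Φ (tension g h Φ) j) i x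
      = (pd i (pd j F) x • η x + pd j F x • covAlong h Φ η i x)
        + (pd i F x • covAlong h Φ η j x + F x • covAlong h Φ (covAlong h Φ η j) i x) := by
  have smooth_pd : ContDiffOn ℝ ∞ (pd j F) U := contDiffOn_dd H.isOpen H.smooth_F
  have smooth_cov := H.contDiffOn_covAlong_normal j
  have smooth_normal_part : ContDiffOn ℝ ∞ (fun y => pd j F y • η y) U :=
    smooth_pd.smul H.smooth_normal
  have smooth_tangent_part : ContDiffOn ℝ ∞ (fun y => F y • covAlong h Φ η j y) U :=
    H.smooth_F.smul smooth_cov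
  rw [covAlong_eq h Φ (covAlong h Φ (tension g h Φ) j), H.covDir_congr hx
    (fun y hy => H.covAlong_tension hy j), H.covDir_add hx smooth_normal_part smooth_tangent_part,
    H.covDir_smul hx smooth_pd H.smooth_normal, H.covDir_smul hx H.smooth_F smooth_cov,
    ← covAlong_eq, ← covAlong_eq]
  rfl

theorem riemannVec_tension (H : HypersurfaceOn c g h W Φ U F η) (hx : x ∈ U) (i j : Fin m) :
    riemannVec h (Φ x) (dmap Φ i x) (tension g h Φ x) (dmap Φ j x)
      = (-(c * g x i j * F x)) • η x := by
  rw [H.curvature _ (H.mapsTo hx), H.dot_tension_dmap hx, ← H.isometric x hx, H.tension_eq x hx,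
    zero_smul, zero_sub, smul_neg, smul_smul, smul_smul, neg_smul, mul_assoc]

theorem biharmonic_normal (H : HypersurfaceOn c g h W Φ U F η) (hx : x ∈ U)
    (hb : bitension g h Φ x = 0) :
    ∑ i, ∑ j, (g x)⁻¹ i j * (pd i (pd j F) x - ∑ k, christoffel g k i j x * pd k F x)
      = (∑ i, ∑ j, (g x)⁻¹ i j * dot (h (Φ x)) (covAlong h Φ η i x) (covAlong h Φ η j x)
          - m * c) * F x := by
  have dot_covAlong_covAlong (i j : Fin m) :
      dot (h (Φ x)) (covAlong h Φ (covAlong h Φ η j) i x) (η x)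
        = -dot (h (Φ x)) (covAlong h Φ η i x) (covAlong h Φ η j x) := by
    have pd_eq_zero : pd i (fun y => dot (h (Φ y)) (covAlong h Φ η j y) (η y)) x = 0 :=
      dd_eq_zero_of_const H.isOpen hx fun y hy => H.dot_covAlong_normal hy j
    rw [H.pd_dot hx i (H.contDiffOn_covAlong_normal j) H.smooth_normal,
      H.dot_comm hx (covAlong h Φ η j x)] at pd_eq_zero
    linarith
  have normal_part : dot (h (Φ x)) (bitension g h Φ x) (η x) = 0 := by rw [hb, dot_zero_left]
  simp only [bitension_eq_sum, dot_sum_left, dot_smul_left, dot_sub_left, dot_add_left,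
    H.covAlong_covAlong_tension hx, H.covAlong_tension hx, H.riemannVec_tension hx, H.unit x hx,
    H.dot_covAlong_normal hx, dot_covAlong_covAlong, mul_zero, mul_one, add_zero, zero_add]
    at normal_part
  have summand (i j : Fin m) : (g x)⁻¹ i j * (pd i (pd j F) x
        + F x * -dot (h (Φ x)) (covAlong h Φ η i x) (covAlong h Φ η j x)
        - ∑ k, christoffel g k i j x * pd k F x - -(c * g x i j * F x))
      = (g x)⁻¹ i j * (pd i (pd j F) x - ∑ k, christoffel g k i j x * pd k F x)
        - F x * ((g x)⁻¹ i j * dot (h (Φ x)) (covAlong h Φ η i x) (covAlong h Φ η j x))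
        + c * F x * ((g x)⁻¹ i j * g x i j) := by ring
  rw [Finset.sum_congr rfl fun i _ => Finset.sum_congr rfl fun j _ => summand i j] at normal_part
  simp only [Finset.sum_add_distrib, Finset.sum_sub_distrib, ← Finset.mul_sum,
    H.metricOn.sum_inv_mul hx] at normal_part
  linarith

theorem biharmonic_tangent (H : HypersurfaceOn c g h W Φ U F η) (hx : x ∈ U)
    (hb : bitension g h Φ x = 0) (l : Fin m) :
    2 * ∑ i, ∑ j, (g x)⁻¹ i j * pd j F x * dot (h (Φ x)) (covAlong h Φ η i x) (dmap Φ l x)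
      = F x * pd l F x := by
  have tangent_part : dot (h (Φ x)) (bitension g h Φ x) (dmap Φ l x) = 0 := by
    rw [hb, dot_zero_left]
  simp only [bitension_eq_sum, dot_sum_left, dot_smul_left, dot_sub_left, dot_add_left,
    H.covAlong_covAlong_tension hx, H.covAlong_tension hx, H.riemannVec_tension hx,
    H.normal x hx, mul_zero, zero_add, sub_zero, mul_left_comm _ (F x), ← Finset.mul_sum]
    at tangent_part
  have summand (i j : Fin m) :
      (g x)⁻¹ i j * (pd j F x * dot (h (Φ x)) (covAlong h Φ η i x) (dmap Φ l x)
        + (pd i F x * dot (h (Φ x)) (covAlong h Φ η j x) (dmap Φ l x)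
          + F x * dot (h (Φ x)) (covAlong h Φ (covAlong h Φ η j) i x) (dmap Φ l x))
        - F x * ∑ k, christoffel g k i j x * dot (h (Φ x)) (covAlong h Φ η k x) (dmap Φ l x))
      = (g x)⁻¹ i j * pd j F x * dot (h (Φ x)) (covAlong h Φ η i x) (dmap Φ l x)
        + (g x)⁻¹ j i * pd i F x * dot (h (Φ x)) (covAlong h Φ η j x) (dmap Φ l x)
        + F x * ((g x)⁻¹ i j * (dot (h (Φ x)) (covAlong h Φ (covAlong h Φ η j) i x) (dmap Φ l x)
          - ∑ k, christoffel g k i j x * dot (h (Φ x)) (covAlong h Φ η k x) (dmap Φ l x))) := by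
    rw [H.metricOn.inv_symm hx j i]
    ring
  rw [Finset.sum_congr rfl fun i _ => Finset.sum_congr rfl fun j _ => summand i j] at tangent_part
  simp only [Finset.sum_add_distrib, ← Finset.mul_sum, H.divergence_weingarten hx l]
    at tangent_part
  rw [Finset.sum_comm (f := fun i j =>
    (g x)⁻¹ j i * pd i F x * dot (h (Φ x)) (covAlong h Φ η j x) (dmap Φ l x))] at tangent_part
  linarith

end HypersurfaceOn

end Coord

namespace Coord

variable {m n : ℕ}

theorem isLinearMap_dmapDir (Φ : Coord m → Coord n) (x : Coord m) :
    IsLinearMap ℝ fun X => dmapDir Φ X x where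
  map_add X Y := funext fun _ => map_add _ X Y
  map_smul r X := funext fun _ => map_smul _ r X

theorem isLinearMap_covDir (h : Coord n → Matrix (Fin n) (Fin n) ℝ) (Φ : Coord m → Coord n)
    (V : Coord m → Fin n → ℝ) (x : Coord m) : IsLinearMap ℝ fun X => covDir h Φ X V x where
  map_add X Y := by
    simp only [covDir_eq_sum, PiLp.add_apply, add_smul, Finset.sum_add_distrib]
  map_smul r X := by
    simp only [covDir_eq_sum, PiLp.smul_apply, smul_eq_mul, mul_smul, Finset.smul_sum]

theorem dmapDir_sum_smul {ι : Type*} (s : Finset ι) (Φ : Coord m → Coord n) (r : ι → ℝ)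
    (E : ι → Coord m) (x : Coord m) :
    dmapDir Φ (∑ a ∈ s, r a • E a) x = ∑ a ∈ s, r a • dmapDir Φ (E a) x :=
  (map_sum (IsLinearMap.mk' _ (isLinearMap_dmapDir Φ x)) _ s).trans
    (Finset.sum_congr rfl fun a _ => (isLinearMap_dmapDir Φ x).map_smul (r a) (E a))

theorem covDir_sum_smul {ι : Type*} (s : Finset ι) (h : Coord n → Matrix (Fin n) (Fin n) ℝ)
    (Φ : Coord m → Coord n) (V : Coord m → Fin n → ℝ) (r : ι → ℝ) (E : ι → Coord m)
    (x : Coord m) :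
    covDir h Φ (∑ a ∈ s, r a • E a) V x = ∑ a ∈ s, r a • covDir h Φ (E a) V x :=
  (map_sum (IsLinearMap.mk' _ (isLinearMap_covDir h Φ V x)) _ s).trans
    (Finset.sum_congr rfl fun a _ => (isLinearMap_covDir h Φ V x).map_smul (r a) (E a))

open scoped MatrixOrder Matrix.Norms.L2Operator in
theorem exists_simultaneous_diagonalization {G b : Matrix (Fin m) (Fin m) ℝ} (hG : G.PosDef)
    (hb : b.IsSymm) : ∃ (Q : Matrix (Fin m) (Fin m) ℝ) (κ : Fin m → ℝ),
      Q.transpose * G * Q = 1 ∧ b * Q = G * Q * Matrix.diagonal κ := by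
  obtain ⟨B, hB⟩ := CStarAlgebra.nonneg_iff_eq_star_mul_self.mp hG.posSemidef.nonneg
  rw [Matrix.star_eq_conjTranspose, Matrix.conjTranspose_eq_transpose_of_trivial] at hB
  have det_B : IsUnit B.det := by
    have det_G := hG.det_pos
    rw [hB, Matrix.det_mul] at det_G
    exact (right_ne_zero_of_mul det_G.ne').isUnit
  have mul_inv : B * B⁻¹ = 1 := Matrix.mul_nonsing_inv _ det_B
  have transpose_mul_inv : B.transpose * (B⁻¹).transpose = 1 := by
    rw [← Matrix.transpose_mul, Matrix.nonsing_inv_mul _ det_B, Matrix.transpose_one]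
  have hermitian : ((B⁻¹).transpose * b * B⁻¹).IsHermitian := by
    rw [Matrix.IsHermitian, Matrix.conjTranspose_eq_transpose_of_trivial]
    simp only [Matrix.transpose_mul, Matrix.transpose_transpose, hb.eq, Matrix.mul_assoc]
  let O : Matrix (Fin m) (Fin m) ℝ := hermitian.eigenvectorUnitary
  have orthogonal : O.transpose * O = 1 := by
    have unitary := Matrix.mem_unitaryGroup_iff'.1 hermitian.eigenvectorUnitary.2
    rwa [Matrix.star_eq_conjTranspose, Matrix.conjTranspose_eq_transpose_of_trivial] at unitary
  have spectral : (B⁻¹).transpose * b * B⁻¹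
      = O * Matrix.diagonal hermitian.eigenvalues * O.transpose := by
    have spectral := hermitian.spectral_theorem
    rwa [Unitary.conjStarAlgAut_apply, Matrix.star_eq_conjTranspose,
      Matrix.conjTranspose_eq_transpose_of_trivial] at spectral
  refine ⟨B⁻¹ * O, hermitian.eigenvalues, ?_, ?_⟩
  · calc (B⁻¹ * O).transpose * G * (B⁻¹ * O)
        = O.transpose * ((B * B⁻¹).transpose * (B * B⁻¹)) * O := by
          simp only [hB, Matrix.transpose_mul, Matrix.mul_assoc]
      _ = 1 := by
          rw [mul_inv, Matrix.transpose_one, Matrix.mul_one, Matrix.mul_one, orthogonal]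
  · calc b * (B⁻¹ * O)
        = (B.transpose * (B⁻¹).transpose) * b * (B⁻¹ * O) := by
          rw [transpose_mul_inv, Matrix.one_mul]
      _ = B.transpose * ((B⁻¹).transpose * b * B⁻¹) * O := by simp only [Matrix.mul_assoc]
      _ = B.transpose * (O * Matrix.diagonal hermitian.eigenvalues * O.transpose) * O :=
          congrArg (B.transpose * · * O) spectral
      _ = B.transpose * (B * B⁻¹) * O * Matrix.diagonal hermitian.eigenvalues
            * (O.transpose * O) := by
          rw [mul_inv, Matrix.mul_one]
          simp only [Matrix.mul_assoc]
      _ = G * (B⁻¹ * O) * Matrix.diagonal hermitian.eigenvalues := by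
          rw [orthogonal, Matrix.mul_one, hB]
          simp only [Matrix.mul_assoc]

/-- `E` is a frame of principal directions at `x` with the principal curvatures `κ`, orthonormal
for the metric `g`. The Weingarten equation reads `∇_X η = -dΦ(A X)`. -/
structure IsPrincipalFrame (g : Coord m → Matrix (Fin m) (Fin m) ℝ)
    (h : Coord n → Matrix (Fin n) (Fin n) ℝ) (Φ : Coord m → Coord n)
    (η : Coord m → Fin n → ℝ) (x : Coord m) (E : Fin m → Coord m) (κ : Fin m → ℝ) : Prop where
  orthonormal : ∀ a b, dot (g x) (E a) (E b) = if a = b then 1 else 0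
  weingarten : ∀ a, covDir h Φ (E a) η x = -κ a • dmapDir Φ (E a) x

namespace IsPrincipalFrame

variable {g : Coord m → Matrix (Fin m) (Fin m) ℝ} {h : Coord n → Matrix (Fin n) (Fin n) ℝ}
  {Φ : Coord m → Coord n} {η : Coord m → Fin n → ℝ} {x : Coord m} {E : Fin m → Coord m}
  {κ : Fin m → ℝ}

theorem inv_apply (P : IsPrincipalFrame g h Φ η x E κ) (i j : Fin m) :
    (g x)⁻¹ i j = ∑ a, E a i * E a j := by
  let Q : Matrix (Fin m) (Fin m) ℝ := Matrix.of fun i a => E a i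
  have gram : Q.transpose * g x * Q = 1 := by
    ext a b
    rw [Matrix.one_apply, ← P.orthonormal, Matrix.mul_apply, dot, Finset.sum_comm]
    simp only [Matrix.mul_apply, Finset.sum_mul, Matrix.transpose_apply, Matrix.of_apply, Q,
      mul_comm (E a _)]
  have inv_eq : (g x)⁻¹ = Q * Q.transpose :=
    Matrix.inv_eq_left_inv (by rw [Matrix.mul_assoc, mul_eq_one_comm.1 gram])
  rw [inv_eq]
  rfl

theorem sum_inv_mul (P : IsPrincipalFrame g h Φ η x E κ) (S : Fin m → Fin m → ℝ) :
    ∑ i, ∑ j, (g x)⁻¹ i j * S i j = ∑ a, ∑ i, ∑ j, E a i * E a j * S i j := by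
  simp only [P.inv_apply, Finset.sum_mul]
  rw [Finset.sum_comm]
  exact (Finset.sum_congr rfl fun _ _ => Finset.sum_comm).trans
    (Finset.sum_comm.trans (Finset.sum_congr rfl fun _ _ => Finset.sum_comm))

theorem eq_sum_smul (P : IsPrincipalFrame g h Φ η x E κ) (hg : IsUnit (g x).det) (X : Coord m) :
    X = ∑ a, dot (g x) (E a) X • E a := by
  ext i
  calc X i = ((g x)⁻¹.mulVec ((g x).mulVec X)) i := by
        rw [Matrix.mulVec_mulVec, Matrix.nonsing_inv_mul _ hg, Matrix.one_mulVec]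
    _ = ∑ j, ∑ a, E a i * E a j * (g x).mulVec X j := by
        simp only [Matrix.mulVec, dotProduct, P.inv_apply, Finset.sum_mul]
    _ = ∑ a, dot (g x) (E a) X * E a i := by
        rw [Finset.sum_comm]
        refine Finset.sum_congr rfl fun a _ => ?_
        rw [dot_eq_dotProduct, dotProduct, Finset.sum_mul]
        exact Finset.sum_congr rfl fun j _ => by ring
    _ = (∑ a, dot (g x) (E a) X • E a) i := by
        simp only [WithLp.ofLp_sum, WithLp.ofLp_smul, Finset.sum_apply, Pi.smul_apply, smul_eq_mul]

theorem ne_zero (P : IsPrincipalFrame g h Φ η x E κ) (a : Fin m) : E a ≠ 0 := by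
  intro E_eq_zero
  have unit := P.orthonormal a a
  rw [E_eq_zero, if_pos rfl] at unit
  exact zero_ne_one ((dot_zero_left _ _).symm.trans unit)

theorem exists_dot_ne_zero (P : IsPrincipalFrame g h Φ η x E κ) (hg : IsUnit (g x).det)
    {X : Coord m} (hX : X ≠ 0) : ∃ a, dot (g x) (E a) X ≠ 0 := by
  by_contra! orthogonal
  refine hX ((P.eq_sum_smul hg X).trans (Finset.sum_eq_zero fun a _ => ?_))
  rw [orthogonal a, zero_smul]

theorem dmapDir_eq_sum (P : IsPrincipalFrame g h Φ η x E κ) (hg : IsUnit (g x).det)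
    (X : Coord m) : dmapDir Φ X x = ∑ a, dot (g x) (E a) X • dmapDir Φ (E a) x := by
  conv_lhs => rw [P.eq_sum_smul hg X, dmapDir_sum_smul]

theorem covDir_eq_sum (P : IsPrincipalFrame g h Φ η x E κ) (hg : IsUnit (g x).det)
    (X : Coord m) :
    covDir h Φ X η x = ∑ a, (-κ a * dot (g x) (E a) X) • dmapDir Φ (E a) x := by
  conv_lhs => rw [P.eq_sum_smul hg X, covDir_sum_smul]
  exact Finset.sum_congr rfl fun a _ => by rw [P.weingarten, smul_smul, mul_comm]

variable {W : Set (Coord n)} {U : Set (Coord m)}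

theorem dot_sum_smul (P : IsPrincipalFrame g h Φ η x E κ) (H : IsometricOn g h W Φ U)
    (hx : x ∈ U) (r s : Fin m → ℝ) :
    dot (h (Φ x)) (∑ a, r a • dmapDir Φ (E a) x) (∑ a, s a • dmapDir Φ (E a) x)
      = ∑ a, r a * s a := by
  simp only [dot_sum_left, dot_sum_right, dot_smul_left, dot_smul_right,
    H.dot_dmapDir_dmapDir hx, P.orthonormal, mul_ite, mul_one, mul_zero, Finset.sum_ite_eq',
    Finset.mem_univ, if_true]
  exact Finset.sum_congr rfl fun a _ => mul_comm _ _

theorem dot_dmapDir_dmapDir (P : IsPrincipalFrame g h Φ η x E κ) (H : IsometricOn g h W Φ U)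
    (hx : x ∈ U) (X Y : Coord m) : dot (h (Φ x)) (dmapDir Φ X x) (dmapDir Φ Y x)
      = ∑ a, dot (g x) (E a) X * dot (g x) (E a) Y := by
  rw [P.dmapDir_eq_sum (H.metricOn.isUnit_det hx) X, P.dmapDir_eq_sum (H.metricOn.isUnit_det hx) Y,
    P.dot_sum_smul H hx]

theorem dot_covDir_dmapDir (P : IsPrincipalFrame g h Φ η x E κ) (H : IsometricOn g h W Φ U)
    (hx : x ∈ U) (X Y : Coord m) : dot (h (Φ x)) (covDir h Φ X η x) (dmapDir Φ Y x)
      = ∑ a, -κ a * dot (g x) (E a) X * dot (g x) (E a) Y := by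
  rw [P.covDir_eq_sum (H.metricOn.isUnit_det hx), P.dmapDir_eq_sum (H.metricOn.isUnit_det hx),
    P.dot_sum_smul H hx]

theorem dot_covDir_covDir (P : IsPrincipalFrame g h Φ η x E κ) (H : IsometricOn g h W Φ U)
    (hx : x ∈ U) (X Y : Coord m) : dot (h (Φ x)) (covDir h Φ X η x) (covDir h Φ Y η x)
      = ∑ a, κ a ^ 2 * dot (g x) (E a) X * dot (g x) (E a) Y := by
  rw [P.covDir_eq_sum (H.metricOn.isUnit_det hx), P.covDir_eq_sum (H.metricOn.isUnit_det hx),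
    P.dot_sum_smul H hx]
  exact Finset.sum_congr rfl fun a _ => by ring

theorem sum_inv_mul_dot_covAlong_dmap (P : IsPrincipalFrame g h Φ η x E κ)
    (H : IsometricOn g h W Φ U) (hx : x ∈ U) :
    ∑ i, ∑ j, (g x)⁻¹ i j * dot (h (Φ x)) (covAlong h Φ η i x) (dmap Φ j x) = -∑ a, κ a := by
  rw [P.sum_inv_mul, ← Finset.sum_neg_distrib]
  refine Finset.sum_congr rfl fun a _ => ?_
  calc ∑ i, ∑ j, E a i * E a j * dot (h (Φ x)) (covAlong h Φ η i x) (dmap Φ j x)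
      = dot (h (Φ x)) (covDir h Φ (E a) η x) (dmapDir Φ (E a) x) := by
        simp only [Coord.covDir_eq_sum, Coord.dmapDir_eq_sum, dot_sum_left, dot_sum_right,
          dot_smul_left, dot_smul_right, Finset.mul_sum, mul_assoc]
        rw [Finset.sum_comm]
        exact Finset.sum_congr rfl fun _ _ => Finset.sum_congr rfl fun _ _ => by ring
    _ = -κ a := by
        rw [P.weingarten, dot_smul_left, H.dot_dmapDir_dmapDir hx, P.orthonormal, if_pos rfl,
          mul_one]

theorem sum_inv_mul_dot_covAlong_covAlong (P : IsPrincipalFrame g h Φ η x E κ)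
    (H : IsometricOn g h W Φ U) (hx : x ∈ U) :
    ∑ i, ∑ j, (g x)⁻¹ i j * dot (h (Φ x)) (covAlong h Φ η i x) (covAlong h Φ η j x)
      = ∑ a, κ a ^ 2 := by
  rw [P.sum_inv_mul]
  refine Finset.sum_congr rfl fun a _ => ?_
  calc ∑ i, ∑ j, E a i * E a j * dot (h (Φ x)) (covAlong h Φ η i x) (covAlong h Φ η j x)
      = dot (h (Φ x)) (covDir h Φ (E a) η x) (covDir h Φ (E a) η x) := by
        simp only [Coord.covDir_eq_sum, dot_sum_left, dot_sum_right, dot_smul_left,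
          dot_smul_right, Finset.mul_sum, mul_assoc]
        rw [Finset.sum_comm]
        exact Finset.sum_congr rfl fun _ _ => Finset.sum_congr rfl fun _ _ => by ring
    _ = κ a ^ 2 := by
        rw [P.weingarten, dot_smul_left, dot_smul_right, H.dot_dmapDir_dmapDir hx,
          P.orthonormal, if_pos rfl]
        ring

end IsPrincipalFrame

namespace HypersurfaceOn

variable {c : ℝ} {g : Coord m → Matrix (Fin m) (Fin m) ℝ}
  {h : Coord (m + 1) → Matrix (Fin (m + 1)) (Fin (m + 1)) ℝ} {W : Set (Coord (m + 1))}
  {Φ : Coord m → Coord (m + 1)} {U : Set (Coord m)} {F : Coord m → ℝ}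
  {η : Coord m → Fin (m + 1) → ℝ} {x : Coord m} {E : Fin m → Coord m} {κ : Fin m → ℝ}

theorem exists_isPrincipalFrame (H : HypersurfaceOn c g h W Φ U F η) (hx : x ∈ U) :
    ∃ E κ, IsPrincipalFrame g h Φ η x E κ := by
  let b : Matrix (Fin m) (Fin m) ℝ :=
    Matrix.of fun i j => -dot (h (Φ x)) (covAlong h Φ η i x) (dmap Φ j x)
  have b_symm : b.IsSymm := by
    ext i j
    exact congrArg Neg.neg (H.dot_covAlong_normal_symm hx j i)
  obtain ⟨Q, κ, orthonormal, eigen⟩ := exists_simultaneous_diagonalization (H.posDef x hx) b_symm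
  refine ⟨fun a => WithLp.toLp 2 fun i => Q i a, κ, fun a b => ?_, fun a => ?_⟩
  · rw [← Matrix.one_apply, ← orthonormal, Matrix.mul_assoc, dot_eq_dotProduct]
    rfl
  · refine H.ext_dot hx ?_ fun k => ?_
    · rw [H.dot_covDir_normal hx, dot_smul_left, H.dot_comm hx, H.dot_normal_dmapDir hx, mul_zero]
    · have eigen_apply := congrFun (congrFun eigen k) a
      rw [Matrix.mul_diagonal] at eigen_apply
      have second_form : dot (h (Φ x)) (covDir h Φ (WithLp.toLp 2 fun i => Q i a) η x)
          (dmap Φ k x) = -(b * Q) k a := by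
        simp only [covDir_eq_sum, dot_sum_left, dot_smul_left, Matrix.mul_apply, b,
          Matrix.of_apply, ← Finset.sum_neg_distrib]
        exact Finset.sum_congr rfl fun i _ => by
          rw [H.dot_covAlong_normal_symm hx k i]; ring
      rw [second_form, eigen_apply, dot_smul_left, H.dot_dmapDir_dmap hx, neg_mul, mul_comm]
      rfl

theorem isUnitNormal (H : HypersurfaceOn c g h W Φ U F η) (hx : x ∈ U) :
    IsUnitNormal h Φ x (η x) := ⟨H.normal x hx, H.unit x hx⟩

theorem isPrincipalCurvature (H : HypersurfaceOn c g h W Φ U F η) (hx : x ∈ U)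
    (P : IsPrincipalFrame g h Φ η x E κ) (a : Fin m) :
    IsPrincipalCurvature g h Φ x (η x) (κ a) := by
  refine ⟨E a, fun E_eq_zero => P.ne_zero a (by ext i; exact congrFun E_eq_zero i), fun j => ?_⟩
  have weingarten := congrArg (fun u => dot (h (Φ x)) u (dmap Φ j x)) (P.weingarten a)
  simp only [covDir_eq_sum, dmapDir_eq_sum, dot_smul_left, dot_sum_left] at weingarten
  simp only [H.dot_secondFundForm_normal hx, H.isometric x hx, mul_neg, Finset.sum_neg_distrib,
    weingarten]
  ring

theorem F_eq_sum (H : HypersurfaceOn c g h W Φ U F η) (hx : x ∈ U)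
    (P : IsPrincipalFrame g h Φ η x E κ) : F x = ∑ a, κ a := by
  simp only [H.F_eq_neg_trace hx, dot_dualFrame, P.sum_inv_mul_dot_covAlong_dmap H.toIsometricOn hx,
    neg_neg]

end HypersurfaceOn

end Coord

/-! ### Two principal curvatures -/

namespace Coord

variable {m n : ℕ}

theorem eq_of_ne_of_encard_le_two {α : Type*} {S : Set α} (hS : S.encard ≤ 2) {a b c : α}
    (ha : a ∈ S) (hb : b ∈ S) (hc : c ∈ S) (hab : a ≠ b) (hca : c ≠ a) : c = b := by
  by_contra hcb
  have subset : {c, a, b} ⊆ S := by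
    rintro k (rfl | rfl | rfl) <;> assumption
  have card : ({c, a, b} : Set α).encard = 2 + 1 := by
    rw [Set.encard_insert_of_notMem (by simp [hca, hcb]), Set.encard_pair hab]
  exact absurd (card ▸ (Set.encard_le_encard subset).trans hS) (by decide)

theorem sum_comp_of_two_values {ι : Type*} [Fintype ι] {κ : ι → ℝ} {μ ν : ℝ}
    (two_values : ∀ a, κ a ≠ μ → κ a = ν) (f : ℝ → ℝ) :
    ∑ a, f (κ a) = (Finset.univ.filter fun a => κ a = μ).card * f μ
      + (Fintype.card ι - (Finset.univ.filter fun a => κ a = μ).card) * f ν := by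
  have split (a : ι) : f (κ a) = (if κ a = μ then f μ - f ν else 0) + f ν := by
    split_ifs with eq
    · rw [eq]; ring
    · rw [two_values a eq, zero_add]
  simp only [split, Finset.sum_add_distrib, ← Finset.sum_filter, Finset.sum_const, nsmul_eq_mul,
    Finset.card_univ]
  ring

/-- The gradient of `F` with respect to the metric `g`. -/
noncomputable def gradVec (g : Coord m → Matrix (Fin m) (Fin m) ℝ) (F : Coord m → ℝ)
    (x : Coord m) : Coord m :=
  WithLp.toLp 2 ((g x)⁻¹.mulVec fun j => pd j F x)

/-- If `-1/2` and `t` are the eigenvalues, of multiplicities `d` and `m - d`, of an operator of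
trace `1`, then `t = complementaryRatio m d`. -/
noncomputable def complementaryRatio (m d : ℕ) : ℝ := (1 + d / 2) / (m - d)

/-- A frame of principal directions in which the principal curvature `-F/2` has multiplicity `d`
and all others are equal; their common value is prescribed by the trace `F` of the Weingarten
operator. -/
structure IsAdaptedFrame (g : Coord m → Matrix (Fin m) (Fin m) ℝ)
    (h : Coord n → Matrix (Fin n) (Fin n) ℝ) (Φ : Coord m → Coord n)
    (η : Coord m → Fin n → ℝ) (F : Coord m → ℝ) (x : Coord m) (d : ℕ) (E : Fin m → Coord m)
    (κ : Fin m → ℝ) : Prop extends IsPrincipalFrame g h Φ η x E κ where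
  card_eq : (Finset.univ.filter fun a => κ a = -F x / 2).card = d
  eq_of_ne : ∀ a, κ a ≠ -F x / 2 → κ a = complementaryRatio m d * F x

namespace HypersurfaceOn

variable {c : ℝ} {g : Coord m → Matrix (Fin m) (Fin m) ℝ}
  {h : Coord (m + 1) → Matrix (Fin (m + 1)) (Fin (m + 1)) ℝ} {W : Set (Coord (m + 1))}
  {Φ : Coord m → Coord (m + 1)} {U : Set (Coord m)} {F : Coord m → ℝ}
  {η : Coord m → Fin (m + 1) → ℝ} {x : Coord m} {E : Fin m → Coord m} {κ : Fin m → ℝ}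

theorem dot_dmapDir_gradVec (H : HypersurfaceOn c g h W Φ U F η) (hx : x ∈ U) (X : Coord m) :
    dot (h (Φ x)) (dmapDir Φ X x) (dmapDir Φ (gradVec g F x) x) = dd X F x := by
  rw [H.dot_dmapDir_dmapDir hx, dot_eq_dotProduct, gradVec, Matrix.mulVec_mulVec,
    H.metricOn.mul_inv hx, Matrix.one_mulVec, dd_eq_sum_pd]
  rfl

theorem covDir_gradVec (H : HypersurfaceOn c g h W Φ U F η) (hx : x ∈ U)
    (hb : bitension g h Φ x = 0) :
    covDir h Φ (gradVec g F x) η x = (F x / 2) • dmapDir Φ (gradVec g F x) x := by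
  refine H.ext_dot hx ?_ fun l => ?_
  · rw [H.dot_covDir_normal hx, dot_smul_left, H.dot_comm hx, H.dot_normal_dmapDir hx, mul_zero]
  · have tangent := H.biharmonic_tangent hx hb l
    have expand : dot (h (Φ x)) (covDir h Φ (gradVec g F x) η x) (dmap Φ l x)
        = ∑ i, ∑ j, (g x)⁻¹ i j * pd j F x * dot (h (Φ x)) (covAlong h Φ η i x) (dmap Φ l x) := by
      simp only [covDir_eq_sum, dot_sum_left, dot_smul_left, ← Finset.sum_mul]
      rfl
    have dual : dot (h (Φ x)) (dmapDir Φ (gradVec g F x) x) (dmap Φ l x) = pd l F x := by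
      rw [H.dot_comm hx, dmap_eq_dmapDir, H.dot_dmapDir_gradVec hx, pd_eq_dd]
    rw [expand, dot_smul_left, dual]
    linarith

theorem principalCurvature_of_dot_gradVec_ne_zero (H : HypersurfaceOn c g h W Φ U F η)
    (hx : x ∈ U) (hb : bitension g h Φ x = 0) (P : IsPrincipalFrame g h Φ η x E κ) {a : Fin m}
    (ha : dot (g x) (E a) (gradVec g F x) ≠ 0) : κ a = -F x / 2 := by
  have eigen := P.dot_covDir_dmapDir H.toIsometricOn hx (gradVec g F x) (E a)
  rw [H.covDir_gradVec hx hb, dot_smul_left, H.dot_comm hx, H.dot_dmapDir_dmapDir hx] at eigen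
  simp only [P.orthonormal, mul_ite, mul_one, mul_zero, Finset.sum_ite_eq', Finset.mem_univ,
    if_true] at eigen
  have := mul_right_cancel₀ ha eigen
  linarith

theorem exists_principalCurvature_ne (H : HypersurfaceOn c g h W Φ U F η) (hx : x ∈ U)
    (hF : 0 < F x) (P : IsPrincipalFrame g h Φ η x E κ) : ∃ a, κ a ≠ -F x / 2 := by
  by_contra! eq
  have trace := H.F_eq_sum hx P
  simp only [eq, Finset.sum_const, Finset.card_univ, Fintype.card_fin, nsmul_eq_mul] at trace
  have : 0 ≤ m * F x := by positivity
  linarith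

theorem exists_isAdaptedFrame (H : HypersurfaceOn c g h W Φ U F η) (hx : x ∈ U)
    (hb : bitension g h Φ x = 0)
    (hk : {k : ℝ | IsPrincipalCurvature g h Φ x (η x) k}.encard ≤ 2)
    (hF : 0 < F x) (hgrad : gradVec g F x ≠ 0) :
    ∃ d E κ, 1 ≤ d ∧ d < m ∧ IsAdaptedFrame g h Φ η F x d E κ := by
  obtain ⟨E, κ, P⟩ := H.exists_isPrincipalFrame hx
  obtain ⟨a₀, dot_ne_zero⟩ := P.exists_dot_ne_zero (H.metricOn.isUnit_det hx) hgrad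
  have κ₀ := H.principalCurvature_of_dot_gradVec_ne_zero hx hb P dot_ne_zero
  obtain ⟨a₁, κ₁⟩ := H.exists_principalCurvature_ne hx hF P
  have principal := H.isPrincipalCurvature hx P
  have two_values (a : Fin m) (ha : κ a ≠ -F x / 2) : κ a = κ a₁ :=
    eq_of_ne_of_encard_le_two hk (κ₀ ▸ principal a₀) (principal a₁) (principal a) κ₁.symm ha
  let d := (Finset.univ.filter fun a => κ a = -F x / 2).card
  have d_lt : d < m := by
    simpa using Finset.card_lt_card (Finset.filter_ssubset.2 ⟨a₁, Finset.mem_univ a₁, κ₁⟩)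
  have κ₁_eq : κ a₁ = complementaryRatio m d * F x := by
    have trace := (H.F_eq_sum hx P).trans (sum_comp_of_two_values two_values id)
    have : (m : ℝ) - d ≠ 0 := sub_ne_zero.2 (by exact_mod_cast d_lt.ne')
    rw [Fintype.card_fin, id, id] at trace
    rw [complementaryRatio, div_mul_eq_mul_div, eq_div_iff this]
    linarith
  exact ⟨d, E, κ, Finset.card_pos.2 ⟨a₀, by simp [κ₀]⟩, d_lt, P, rfl,
    fun a ha => (two_values a ha).trans κ₁_eq⟩

end HypersurfaceOn

namespace IsAdaptedFrame

variable {g : Coord m → Matrix (Fin m) (Fin m) ℝ} {h : Coord n → Matrix (Fin n) (Fin n) ℝ}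
  {Φ : Coord m → Coord n} {η : Coord m → Fin n → ℝ} {F : Coord m → ℝ} {x : Coord m} {d : ℕ}
  {E : Fin m → Coord m} {κ : Fin m → ℝ} {W : Set (Coord n)} {U : Set (Coord m)}

theorem sum_inv_mul_dot_covAlong_covAlong_eq (P : IsAdaptedFrame g h Φ η F x d E κ)
    (H : IsometricOn g h W Φ U) (hx : x ∈ U) :
    ∑ i, ∑ j, (g x)⁻¹ i j * dot (h (Φ x)) (covAlong h Φ η i x) (covAlong h Φ η j x)
      = F x ^ 2 * (d / 4 + (m - d) * complementaryRatio m d ^ 2) := by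
  rw [P.sum_inv_mul_dot_covAlong_covAlong H hx,
    sum_comp_of_two_values P.eq_of_ne fun k => k ^ 2, P.card_eq, Fintype.card_fin]
  ring

/-- This is `(A + F/2) (A - t F) = 0` for the Weingarten operator `A`, with `t` the complementary
ratio. -/
theorem dot_weingarten_factors (P : IsAdaptedFrame g h Φ η F x d E κ)
    (H : IsometricOn g h W Φ U) (hx : x ∈ U) (X Y : Coord m) :
    dot (h (Φ x)) (covDir h Φ X η x - (F x / 2) • dmapDir Φ X x)
      (covDir h Φ Y η x + (complementaryRatio m d * F x) • dmapDir Φ Y x) = 0 := by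
  simp only [dot_sub_left, dot_add_right, dot_smul_left, dot_smul_right]
  rw [Coord.dot_comm (dmapDir Φ X x) (covDir h Φ Y η x) (H.isSymm hx), P.dot_covDir_covDir H hx,
    P.dot_covDir_dmapDir H hx, P.dot_covDir_dmapDir H hx, P.dot_dmapDir_dmapDir H hx]
  simp only [Finset.mul_sum, ← Finset.sum_add_distrib, ← Finset.sum_sub_distrib]
  refine Finset.sum_eq_zero fun a _ => ?_
  by_cases eq : κ a = -F x / 2
  · rw [eq]; ring
  · rw [P.eq_of_ne a eq]; ring

theorem exists_orthogonal_eigenvector (P : IsAdaptedFrame g h Φ η F x d E κ) (hd : 2 ≤ d)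
    (u : Coord m) : ∃ v : Coord m, v ≠ 0 ∧ dot (g x) v u = 0 ∧
      covDir h Φ v η x = (F x / 2) • dmapDir Φ v x := by
  have eigen (a : Fin m) (ha : κ a = -F x / 2) :
      covDir h Φ (E a) η x = (F x / 2) • dmapDir Φ (E a) x := by
    rw [P.weingarten, ha]
    congr 1
    ring
  rw [← P.card_eq] at hd
  obtain ⟨a, ha, b, hb, ne⟩ := Finset.one_lt_card.1 hd
  have κ_a := (Finset.mem_filter.1 ha).2
  have κ_b := (Finset.mem_filter.1 hb).2
  by_cases orthogonal : dot (g x) (E a) u = 0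
  · exact ⟨E a, P.ne_zero a, orthogonal, eigen a κ_a⟩
  refine ⟨dot (g x) (E b) u • E a - dot (g x) (E a) u • E b, fun eq_zero => orthogonal ?_, ?_, ?_⟩
  · have component := congrArg (fun w : Coord m => dot (g x) (E b) w) eq_zero
    simpa [dot_sub_right, dot_smul_right, dot_zero_right, P.orthonormal, ne.symm] using component
  · simp only [WithLp.ofLp_sub, WithLp.ofLp_smul, dot_sub_left, dot_smul_left]
    ring
  · simp only [(isLinearMap_covDir h Φ η x).map_sub, (isLinearMap_covDir h Φ η x).map_smul,
      (isLinearMap_dmapDir Φ x).map_sub, (isLinearMap_dmapDir Φ x).map_smul, eigen a κ_a,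
      eigen b κ_b]
    module

theorem covDir_eq_of_simple (P : IsAdaptedFrame g h Φ η F x 1 E κ) (H : IsometricOn g h W Φ U)
    (hx : x ∈ U) {u : Coord m} (hu : u ≠ 0)
    (eigen : ∀ a, dot (g x) (E a) u ≠ 0 → κ a = -F x / 2) (X : Coord m) :
    covDir h Φ X η x = -(complementaryRatio m 1 * F x) • dmapDir Φ X x
      + ((complementaryRatio m 1 + 1 / 2) * F x * dot (g x) X u / dot (g x) u u)
        • dmapDir Φ u x := by
  have hg := H.metricOn.isUnit_det hx
  obtain ⟨a₀, dot_ne_zero⟩ := P.exists_dot_ne_zero hg hu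
  have κ₀ := eigen a₀ dot_ne_zero
  have κ_ne (a : Fin m) (ha : a ≠ a₀) : κ a ≠ -F x / 2 := fun eq =>
    ha (Finset.card_le_one.1 P.card_eq.le a (by simp [eq]) a₀ (by simp [κ₀]))
  have u_eq : u = dot (g x) (E a₀) u • E a₀ := by
    conv_lhs => rw [P.eq_sum_smul hg u]
    exact Finset.sum_eq_single a₀ (fun a _ ha => by
      rw [not_imp_comm.1 (eigen a) (κ_ne a ha), zero_smul]) fun h => absurd (Finset.mem_univ _) h
  set r := dot (g x) (E a₀) u
  have dot_u : dot (g x) u u = r ^ 2 := by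
    simp only [u_eq, WithLp.ofLp_smul, dot_smul_left, dot_smul_right, P.orthonormal, if_true]
    ring
  have dot_X : dot (g x) X u = r * dot (g x) (E a₀) X := by
    rw [Coord.dot_comm _ _ (H.metricOn.isSymm hx), u_eq, WithLp.ofLp_smul, dot_smul_left]
  have dmapDir_u : dmapDir Φ u x = r • dmapDir Φ (E a₀) x := by
    conv_lhs => rw [u_eq, (isLinearMap_dmapDir Φ x).map_smul]
  have off_diagonal (a : Fin m) (ha : a ∈ Finset.univ.erase a₀) :
      (-κ a * dot (g x) (E a) X) • dmapDir Φ (E a) x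
        = -(complementaryRatio m 1 * F x) • dot (g x) (E a) X • dmapDir Φ (E a) x := by
    rw [P.eq_of_ne a (κ_ne a (Finset.ne_of_mem_erase ha)), smul_smul, neg_mul]
  rw [P.covDir_eq_sum hg X, P.dmapDir_eq_sum hg X, dot_u, dot_X, dmapDir_u,
    ← Finset.sum_erase_add _ _ (Finset.mem_univ a₀), Finset.sum_congr rfl off_diagonal,
    ← Finset.smul_sum, ← Finset.sum_erase_add _ _ (Finset.mem_univ a₀), κ₀, smul_add, smul_smul,
    smul_smul, add_assoc, ← add_smul]
  congr 2
  field_simp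
  ring

end IsAdaptedFrame

end Coord

namespace Coord

variable {m : ℕ} {c : ℝ} {g : Coord m → Matrix (Fin m) (Fin m) ℝ}
  {h : Coord (m + 1) → Matrix (Fin (m + 1)) (Fin (m + 1)) ℝ} {W : Set (Coord (m + 1))}
  {Φ : Coord m → Coord (m + 1)} {U : Set (Coord m)} {F : Coord m → ℝ}
  {η : Coord m → Fin (m + 1) → ℝ} {x : Coord m} {t : ℝ} {s : Coord m → ℝ}
  {N : Coord m → Fin (m + 1) → ℝ}

namespace HypersurfaceOn

/-- Differentiate `⟨(A + F/2) p, (A - t F) q⟩ = 0`: since `(A + F/2) p` vanishes at `x`, only the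
derivative of that factor survives, and `(A - t F) q` is a nonzero multiple of `q` at `x`. -/
theorem dot_covDir_covDir_eigen (H : HypersurfaceOn c g h W Φ U F η)
    (factors : ∀ y ∈ U, ∀ X Y, dot (h (Φ y)) (covDir h Φ X η y - (F y / 2) • dmapDir Φ X y)
      (covDir h Φ Y η y + (t * F y) • dmapDir Φ Y y) = 0)
    (hx : x ∈ U) (ht : 0 < t) (hF : 0 < F x) {p q : Coord m}
    (hp : covDir h Φ p η x = (F x / 2) • dmapDir Φ p x)
    (hq : covDir h Φ q η x = (F x / 2) • dmapDir Φ q x) (Z : Coord m) :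
    dot (h (Φ x)) (covDir h Φ Z (covDir h Φ p η) x) (dmapDir Φ q x)
      = F x / 2 * dot (h (Φ x)) (covDir h Φ Z (dmapDir Φ p) x) (dmapDir Φ q x)
        + dd Z F x / 2 * dot (h (Φ x)) (dmapDir Φ p x) (dmapDir Φ q x) := by
  have smooth_half : ContDiffOn ℝ ∞ (fun y => F y / 2) U := H.smooth_F.div_const 2
  have smooth_half_p : ContDiffOn ℝ ∞ (fun y => (F y / 2) • dmapDir Φ p y) U :=
    smooth_half.smul H.contDiffOn_dmapDir
  have smooth_p : ContDiffOn ℝ ∞ (fun y => covDir h Φ p η y - (F y / 2) • dmapDir Φ p y) U :=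
    (H.contDiffOn_covDir H.smooth_normal).sub smooth_half_p
  have smooth_q : ContDiffOn ℝ ∞ (fun y => covDir h Φ q η y + (t * F y) • dmapDir Φ q y) U :=
    (H.contDiffOn_covDir H.smooth_normal).add
      ((contDiffOn_const.mul H.smooth_F).smul H.contDiffOn_dmapDir)
  have derivative := H.dd_dot hx smooth_p smooth_q (X := Z)
  rw [dd_eq_zero_of_const H.isOpen hx fun y hy => factors y hy p q, sub_eq_zero.2 hp,
    dot_zero_left, add_zero, hq, ← add_smul, dot_smul_right] at derivative
  have factor_ne_zero : F x / 2 + t * F x ≠ 0 := by positivity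
  have orthogonal := (mul_eq_zero.1 derivative.symm).resolve_left factor_ne_zero
  rw [H.covDir_sub hx (H.contDiffOn_covDir H.smooth_normal) smooth_half_p,
    H.covDir_smul hx smooth_half H.contDiffOn_dmapDir,
    dd_div_const (H.differentiableAt hx H.smooth_F), dot_sub_left, dot_add_left, dot_smul_left,
    dot_smul_left] at orthogonal
  linarith

theorem false_of_multiple (H : HypersurfaceOn c g h W Φ U F η)
    (factors : ∀ y ∈ U, ∀ X Y, dot (h (Φ y)) (covDir h Φ X η y - (F y / 2) • dmapDir Φ X y)
      (covDir h Φ Y η y + (t * F y) • dmapDir Φ Y y) = 0)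
    (hx : x ∈ U) (ht : 0 < t) (hF : 0 < F x) {u v : Coord m}
    (hu : covDir h Φ u η x = (F x / 2) • dmapDir Φ u x)
    (hv : covDir h Φ v η x = (F x / 2) • dmapDir Φ v x)
    (v_ne_zero : v ≠ 0) (orthogonal : dot (g x) v u = 0) (huF : dd u F x ≠ 0) : False := by
  have along_u := H.dot_covDir_covDir_eigen factors hx ht hF hv hv u
  have along_v := H.dot_covDir_covDir_eigen factors hx ht hF hu hv v
  have pos : 0 < dot (g x) v v := dot_self_pos (H.posDef x hx) (by simpa using v_ne_zero)
  rw [H.codazzi hx u v, along_v, H.covDir_dmapDir_comm hx (X := u) (Y := v),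
    H.dot_comm hx (dmapDir Φ u x), H.dot_dmapDir_dmapDir hx, H.dot_dmapDir_dmapDir hx,
    orthogonal] at along_u
  exact mul_ne_zero huF pos.ne' (by linarith)

end HypersurfaceOn

/-- A hypersurface with `dF = s ⟨·, N⟩`, where `N` is a unit tangent field, whose Weingarten
operator is `-F/2` on `N` and `t F` on the orthogonal complement of `N`. -/
structure SimpleHypersurfaceOn (c : ℝ) (g : Coord m → Matrix (Fin m) (Fin m) ℝ)
    (h : Coord (m + 1) → Matrix (Fin (m + 1)) (Fin (m + 1)) ℝ) (W : Set (Coord (m + 1)))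
    (Φ : Coord m → Coord (m + 1)) (U : Set (Coord m)) (F : Coord m → ℝ)
    (η : Coord m → Fin (m + 1) → ℝ) (t : ℝ) (s : Coord m → ℝ) (N : Coord m → Fin (m + 1) → ℝ) :
    Prop extends HypersurfaceOn c g h W Φ U F η where
  t_pos : 0 < t
  F_pos : ∀ x ∈ U, 0 < F x
  s_pos : ∀ x ∈ U, 0 < s x
  smooth_s : ContDiffOn ℝ ∞ s U
  smooth_N : ContDiffOn ℝ ∞ N U
  unit_N : ∀ x ∈ U, dot (h (Φ x)) (N x) (N x) = 1
  tangent_N : ∀ x ∈ U, ∃ u, dmapDir Φ u x = N x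
  dd_F : ∀ x ∈ U, ∀ X, dd X F x = s x * dot (h (Φ x)) (dmapDir Φ X x) (N x)
  weingarten : ∀ x ∈ U, ∀ X, covDir h Φ X η x = -(t * F x) • dmapDir Φ X x
    + ((t + 1 / 2) * (F x * dot (h (Φ x)) (dmapDir Φ X x) (N x))) • N x

namespace SimpleHypersurfaceOn

theorem contDiffOn_dot_N (H : SimpleHypersurfaceOn c g h W Φ U F η t s N) (X : Coord m) :
    ContDiffOn ℝ ∞ (fun y => dot (h (Φ y)) (dmapDir Φ X y) (N y)) U :=
  H.contDiffOn_dot H.contDiffOn_dmapDir H.smooth_N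

theorem dot_normal_N (H : SimpleHypersurfaceOn c g h W Φ U F η t s N) (hx : x ∈ U) :
    dot (h (Φ x)) (η x) (N x) = 0 := by
  obtain ⟨u, hu⟩ := H.tangent_N x hx
  rw [← hu, H.dot_normal_dmapDir hx]

theorem dot_covDir_N (H : SimpleHypersurfaceOn c g h W Φ U F η t s N) (hx : x ∈ U)
    (X : Coord m) : dot (h (Φ x)) (covDir h Φ X N x) (N x) = 0 := by
  have dd_unit := H.dd_dot hx H.smooth_N H.smooth_N (X := X)
  rw [dd_eq_zero_of_const H.isOpen hx H.unit_N, H.dot_comm hx (N x)] at dd_unit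
  linarith

theorem covDir_covDir_normal (H : SimpleHypersurfaceOn c g h W Φ U F η t s N) (hx : x ∈ U)
    (X Y : Coord m) : covDir h Φ X (covDir h Φ Y η) x
      = -(t * dd X F x) • dmapDir Φ Y x - (t * F x) • covDir h Φ X (dmapDir Φ Y) x
        + (((t + 1 / 2) * (dd X F x * dot (h (Φ x)) (dmapDir Φ Y x) (N x)
            + F x * dd X (fun y => dot (h (Φ y)) (dmapDir Φ Y y) (N y)) x)) • N x
          + ((t + 1 / 2) * (F x * dot (h (Φ x)) (dmapDir Φ Y x) (N x))) • covDir h Φ X N x) := by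
  have dF := H.differentiableAt hx H.smooth_F
  have smooth_tangent : ContDiffOn ℝ ∞ (fun y => -(t * F y)) U :=
    (contDiffOn_const.mul H.smooth_F).neg
  have smooth_product := H.smooth_F.mul (H.contDiffOn_dot_N Y)
  have smooth_N_part : ContDiffOn ℝ ∞
      (fun y => (t + 1 / 2) * (F y * dot (h (Φ y)) (dmapDir Φ Y y) (N y))) U :=
    contDiffOn_const.mul smooth_product
  rw [H.covDir_congr hx fun y hy => H.weingarten y hy Y,
    H.covDir_smul_add_smul hx smooth_tangent H.contDiffOn_dmapDir smooth_N_part H.smooth_N,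
    dd_neg, dd_const_mul _ dF,
    dd_const_mul _ (H.differentiableAt hx smooth_product),
    dd_mul dF (H.differentiableAt hx (H.contDiffOn_dot_N Y)), neg_smul (t * F x), ← sub_eq_add_neg]

theorem codazzi_N (H : SimpleHypersurfaceOn c g h W Φ U F η t s N) (hx : x ∈ U)
    (X Y : Coord m) :
    (-t * s x) • (dot (h (Φ x)) (dmapDir Φ X x) (N x) • dmapDir Φ Y x
        - dot (h (Φ x)) (dmapDir Φ Y x) (N x) • dmapDir Φ X x)
      + ((t + 1 / 2) * F x * (dd X (fun y => dot (h (Φ y)) (dmapDir Φ Y y) (N y)) x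
        - dd Y (fun y => dot (h (Φ y)) (dmapDir Φ X y) (N y)) x)) • N x
      + ((t + 1 / 2) * F x) • (dot (h (Φ x)) (dmapDir Φ Y x) (N x) • covDir h Φ X N x
        - dot (h (Φ x)) (dmapDir Φ X x) (N x) • covDir h Φ Y N x) = 0 := by
  have codazzi := sub_eq_zero.2 (H.codazzi hx X Y)
  rw [H.covDir_covDir_normal hx, H.covDir_covDir_normal hx,
    H.covDir_dmapDir_comm hx (X := X) (Y := Y), H.dd_F x hx, H.dd_F x hx] at codazzi
  rw [← codazzi]
  module

theorem dd_dot_N_comm (H : SimpleHypersurfaceOn c g h W Φ U F η t s N) (hx : x ∈ U)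
    (X Y : Coord m) : dd X (fun y => dot (h (Φ y)) (dmapDir Φ Y y) (N y)) x
      = dd Y (fun y => dot (h (Φ y)) (dmapDir Φ X y) (N y)) x := by
  have N_component := congrArg (fun v => dot (h (Φ x)) v (N x)) (H.codazzi_N hx X Y)
  simp only [dot_add_left, dot_sub_left, dot_smul_left, dot_zero_left, H.dot_covDir_N hx,
    H.unit_N x hx] at N_component
  have factor_ne_zero : (t + 1 / 2) * F x ≠ 0 := by
    have := H.t_pos
    have := H.F_pos x hx
    positivity
  refine sub_eq_zero.1 (mul_left_cancel₀ factor_ne_zero ?_)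
  linear_combination N_component

/-- Hence the integral curves of `N` are geodesics of the hypersurface. -/
theorem covDir_self_N (H : SimpleHypersurfaceOn c g h W Φ U F η t s N) (hx : x ∈ U)
    {u : Coord m} (hu : dmapDir Φ u x = N x) : covDir h Φ u N x = (-F x / 2) • η x := by
  refine H.ext_dot hx ?_ fun i => ?_
  · have dd_orthogonal := H.dd_dot hx H.smooth_N H.smooth_normal (X := u)
    rw [dd_eq_zero_of_const H.isOpen hx (c := 0) fun y hy => by
        rw [H.dot_comm hy, H.dot_normal_N hy],
      H.weingarten x hx u, hu, dot_add_right, dot_smul_right, dot_smul_right,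
      H.unit_N x hx] at dd_orthogonal
    rw [dot_smul_left, H.unit x hx, mul_one]
    linarith
  · have closed := H.dd_dot_N_comm hx (EuclideanSpace.single i 1) u
    rw [H.dd_dot hx H.contDiffOn_dmapDir H.smooth_N, H.dd_dot hx H.contDiffOn_dmapDir H.smooth_N,
      H.covDir_dmapDir_comm hx (X := u), hu, H.dot_comm hx (N x), H.dot_covDir_N hx,
      H.dot_comm hx (dmapDir Φ _ x)] at closed
    rw [dot_smul_left, H.normal x hx, mul_zero, dmap_eq_dmapDir]
    linarith

end SimpleHypersurfaceOn

/-- The principal curvature of the level sets of `F` in a `SimpleHypersurfaceOn`, with respect to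
the unit normal `N`. -/
noncomputable def levelCurvature (t : ℝ) (s F : Coord m → ℝ) (x : Coord m) : ℝ :=
  -(t / (t + 1 / 2)) * (s x * (F x)⁻¹)

namespace SimpleHypersurfaceOn

theorem covDir_N (H : SimpleHypersurfaceOn c g h W Φ U F η t s N) (hx : x ∈ U) (X : Coord m) :
    covDir h Φ X N x = levelCurvature t s F x •
        (dmapDir Φ X x - dot (h (Φ x)) (dmapDir Φ X x) (N x) • N x)
      + (-(1 / 2) * (F x * dot (h (Φ x)) (dmapDir Φ X x) (N x))) • η x := by
  obtain ⟨u, hu⟩ := H.tangent_N x hx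
  have codazzi := H.codazzi_N hx X u
  rw [H.dd_dot_N_comm hx X u, H.covDir_self_N hx hu, hu, H.unit_N x hx] at codazzi
  have ht := H.t_pos
  have hF := H.F_pos x hx
  have ratio : (t + 1 / 2) * F x * levelCurvature t s F x = -t * s x := by
    rw [levelCurvature]
    field_simp
  have factor_ne_zero : (t + 1 / 2) * F x ≠ 0 := by positivity
  refine smul_right_injective _ factor_ne_zero ?_
  simp only [smul_add, smul_smul, ratio]
  rw [← sub_eq_zero, ← codazzi]
  module

theorem contDiffOn_levelCurvature (H : SimpleHypersurfaceOn c g h W Φ U F η t s N) :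
    ContDiffOn ℝ ∞ (levelCurvature t s F) U :=
  contDiffOn_const.mul (H.smooth_s.mul (H.smooth_F.inv fun y hy => (H.F_pos y hy).ne'))

theorem covDir_covDir_N (H : SimpleHypersurfaceOn c g h W Φ U F η t s N) (hx : x ∈ U)
    (X Y : Coord m) : covDir h Φ X (covDir h Φ Y N) x
      = dd X (levelCurvature t s F) x •
          (dmapDir Φ Y x - dot (h (Φ x)) (dmapDir Φ Y x) (N x) • N x)
        + levelCurvature t s F x • (covDir h Φ X (dmapDir Φ Y) x
          - (dd X (fun y => dot (h (Φ y)) (dmapDir Φ Y y) (N y)) x • N x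
            + dot (h (Φ x)) (dmapDir Φ Y x) (N x) • covDir h Φ X N x))
        + (dd X (fun y => -(1 / 2) * (F y * dot (h (Φ y)) (dmapDir Φ Y y) (N y))) x • η x
          + (-(1 / 2) * (F x * dot (h (Φ x)) (dmapDir Φ Y x) (N x))) • covDir h Φ X η x) := by
  have smooth_N_part : ContDiffOn ℝ ∞
      (fun y => dot (h (Φ y)) (dmapDir Φ Y y) (N y) • N y) U :=
    (H.contDiffOn_dot_N Y).smul H.smooth_N
  have smooth_tangent : ContDiffOn ℝ ∞
      (fun y => dmapDir Φ Y y - dot (h (Φ y)) (dmapDir Φ Y y) (N y) • N y) U :=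
    H.contDiffOn_dmapDir.sub smooth_N_part
  have smooth_normal_part : ContDiffOn ℝ ∞
      (fun y => -(1 / 2) * (F y * dot (h (Φ y)) (dmapDir Φ Y y) (N y))) U :=
    contDiffOn_const.mul (H.smooth_F.mul (H.contDiffOn_dot_N Y))
  rw [H.covDir_congr hx fun y hy => H.covDir_N hy Y,
    H.covDir_smul_add_smul hx H.contDiffOn_levelCurvature smooth_tangent smooth_normal_part
      H.smooth_normal,
    H.covDir_sub hx H.contDiffOn_dmapDir smooth_N_part,
    H.covDir_smul hx (H.contDiffOn_dot_N Y) H.smooth_N]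

/-- The Riccati equation satisfied by the level sets of `F`: the Gauss equation for a plane
containing `N`. -/
theorem dd_levelCurvature (H : SimpleHypersurfaceOn c g h W Φ U F η t s N) (hx : x ∈ U)
    {u v : Coord m} (hu : dmapDir Φ u x = N x)
    (orthogonal : dot (h (Φ x)) (dmapDir Φ v x) (N x) = 0) (v_ne_zero : v ≠ 0) :
    dd u (levelCurvature t s F) x + levelCurvature t s F x ^ 2 - t / 2 * F x ^ 2 = -c := by
  have curvature := H.covDir_covDir_sub hx H.smooth_N (X := u) (Y := v)
  rw [H.curvature _ (H.mapsTo hx), H.covDir_covDir_N hx u v, H.covDir_covDir_N hx v u,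
    H.covDir_dmapDir_comm hx (X := u) (Y := v)] at curvature
  have component := congrArg (fun w => dot (h (Φ x)) w (dmapDir Φ v x)) curvature
  simp only [hu, H.covDir_N hx v, H.weingarten x hx v, dot_add_left, dot_sub_left, dot_smul_left,
    orthogonal, H.dot_comm hx (N x) (dmapDir Φ v x), H.unit_N x hx, H.dot_normal_dmapDir hx v,
    H.dot_dmapDir_dmapDir hx v] at component
  have pos : 0 < dot (g x) v v := dot_self_pos (H.posDef x hx) (by simpa using v_ne_zero)
  refine mul_right_cancel₀ pos.ne' ?_
  linear_combination component

end SimpleHypersurfaceOn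

end Coord

namespace Coord

section ODE

variable {m : ℕ} {U : Set (Coord m)} {F s : Coord m → ℝ} {x u : Coord m} {A B C D K L : ℝ}

theorem dd_eq_of_first_integral (hU : IsOpen U) (hx : x ∈ U) (smooth_F : ContDiffOn ℝ ∞ F U)
    (smooth_s : ContDiffOn ℝ ∞ s U) (hs : s x ≠ 0) (dd_F : dd u F x = s x)
    (first_integral : ∀ y ∈ U, A * s y ^ 2 = B * F y ^ 4 + C * F y ^ 2) :
    A * dd u s x = 2 * B * F x ^ 3 + C * F x := by
  have dF := differentiableAt_of_contDiffOn hU hx smooth_F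
  have ds := differentiableAt_of_contDiffOn hU hx smooth_s
  have derivative := dd_congr (X := u) hU hx first_integral
  rw [dd_const_mul _ (ds.fun_pow 2), dd_pow ds, dd_add ((dF.fun_pow 4).const_mul B)
    ((dF.fun_pow 2).const_mul C), dd_const_mul _ (dF.fun_pow 4), dd_const_mul _ (dF.fun_pow 2),
    dd_pow dF, dd_pow dF, dd_F] at derivative
  refine mul_left_cancel₀ hs ?_
  norm_num at derivative
  linear_combination derivative / 2

theorem false_of_ode (hU : IsOpen U) (hx : x ∈ U) (smooth_F : ContDiffOn ℝ ∞ F U)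
    (smooth_s : ContDiffOn ℝ ∞ s U) (F_pos : ∀ y ∈ U, 0 < F y) (s_pos : ∀ y ∈ U, 0 < s y)
    (ode : ∀ y ∈ U, ∃ u, dd u F y = s y ∧
      dd u s y * F y = K * F y ^ 4 - D * F y ^ 2 - L * s y ^ 2)
    (first_integral : ∀ y ∈ U, A * s y ^ 2 = B * F y ^ 4 + C * F y ^ 2)
    (ne : A * K ≠ (L + 2) * B) : False := by
  have F_sq (y : Coord m) (hy : y ∈ U) :
      F y ^ 2 = (A * D + (L + 1) * C) / (A * K - (L + 2) * B) := by
    obtain ⟨u, dd_F, dd_s⟩ := ode y hy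
    have dd_s' := dd_eq_of_first_integral hU hy smooth_F smooth_s (s_pos y hy).ne' dd_F
      first_integral
    rw [eq_div_iff (sub_ne_zero.2 ne)]
    refine mul_left_cancel₀ (pow_ne_zero 2 (F_pos y hy).ne') ?_
    linear_combination F y * dd_s' - A * dd_s + L * first_integral y hy
  obtain ⟨u, dd_F, -⟩ := ode x hx
  have dd_F_sq := dd_eq_zero_of_const (X := u) hU hx F_sq
  rw [dd_pow (differentiableAt_of_contDiffOn hU hx smooth_F), dd_F] at dd_F_sq
  have := F_pos x hx
  have := s_pos x hx
  exact absurd dd_F_sq (by positivity)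

end ODE

namespace IsometricOn

variable {m n : ℕ} {g : Coord m → Matrix (Fin m) (Fin m) ℝ}
  {h : Coord n → Matrix (Fin n) (Fin n) ℝ} {W : Set (Coord n)} {Φ : Coord m → Coord n}
  {U : Set (Coord m)} {x : Coord m}

theorem sum_inv_mul_dot_dmapDir (H : IsometricOn g h W Φ U) (hx : x ∈ U) (u : Coord m)
    (i : Fin m) : ∑ j, (g x)⁻¹ i j * dot (h (Φ x)) (dmap Φ j x) (dmapDir Φ u x) = u i := by
  have index_lowering (j : Fin m) :
      dot (h (Φ x)) (dmap Φ j x) (dmapDir Φ u x) = (g x).mulVec u j := by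
    rw [Coord.dot_comm _ _ (H.isSymm hx), H.dot_dmapDir_dmap hx]
  simp only [index_lowering]
  change (g x)⁻¹.mulVec ((g x).mulVec u) i = u i
  rw [Matrix.mulVec_mulVec, H.metricOn.inv_mul hx, Matrix.one_mulVec]

theorem sum_inv_mul_mul_dot_dmapDir (H : IsometricOn g h W Φ U) (hx : x ∈ U) (u : Coord m)
    (p : Fin m → ℝ) :
    ∑ i, ∑ j, (g x)⁻¹ i j * (p i * dot (h (Φ x)) (dmap Φ j x) (dmapDir Φ u x))
      = ∑ i, u i * p i := by
  refine Finset.sum_congr rfl fun i _ => ?_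
  rw [← H.sum_inv_mul_dot_dmapDir hx u i, Finset.sum_mul]
  exact Finset.sum_congr rfl fun j _ => by ring

theorem sum_inv_mul_dot_mul_dot (H : IsometricOn g h W Φ U) (hx : x ∈ U) (u : Coord m) :
    ∑ i, ∑ j, (g x)⁻¹ i j * (dot (h (Φ x)) (dmap Φ i x) (dmapDir Φ u x)
        * dot (h (Φ x)) (dmap Φ j x) (dmapDir Φ u x))
      = dot (h (Φ x)) (dmapDir Φ u x) (dmapDir Φ u x) := by
  rw [H.sum_inv_mul_mul_dot_dmapDir hx]
  conv_rhs => rw [dmapDir_eq_sum Φ u x, dot_sum_left, ← dmapDir_eq_sum]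
  simp only [dot_smul_left]

end IsometricOn

variable {m : ℕ} {c : ℝ} {g : Coord m → Matrix (Fin m) (Fin m) ℝ}
  {h : Coord (m + 1) → Matrix (Fin (m + 1)) (Fin (m + 1)) ℝ} {W : Set (Coord (m + 1))}
  {Φ : Coord m → Coord (m + 1)} {U : Set (Coord m)} {F : Coord m → ℝ}
  {η : Coord m → Fin (m + 1) → ℝ} {x : Coord m} {t : ℝ} {s : Coord m → ℝ}
  {N : Coord m → Fin (m + 1) → ℝ}

namespace SimpleHypersurfaceOn

theorem sum_inv_mul_dot_N_mul_dot_N (H : SimpleHypersurfaceOn c g h W Φ U F η t s N)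
    (hx : x ∈ U) :
    ∑ i, ∑ j, (g x)⁻¹ i j * (dot (h (Φ x)) (dmap Φ i x) (N x)
      * dot (h (Φ x)) (dmap Φ j x) (N x)) = 1 := by
  obtain ⟨u, hu⟩ := H.tangent_N x hx
  rw [← H.unit_N x hx, ← hu, H.sum_inv_mul_dot_mul_dot hx]

theorem covAlong_normal (H : SimpleHypersurfaceOn c g h W Φ U F η t s N) (hx : x ∈ U)
    (i : Fin m) : covAlong h Φ η i x = -(t * F x) • dmap Φ i x
      + ((t + 1 / 2) * (F x * dot (h (Φ x)) (dmap Φ i x) (N x))) • N x := by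
  rw [covAlong_eq, H.weingarten x hx, dmap_eq_dmapDir]

theorem t_mul (H : SimpleHypersurfaceOn c g h W Φ U F η t s N) (hx : x ∈ U) :
    t * (m - 1) = 3 / 2 := by
  have entry (i j : Fin m) : (g x)⁻¹ i j * dot (h (Φ x)) (covAlong h Φ η i x) (dmap Φ j x)
      = -(t * F x) * ((g x)⁻¹ i j * g x i j) + (t + 1 / 2) * F x *
        ((g x)⁻¹ i j * (dot (h (Φ x)) (dmap Φ i x) (N x)
          * dot (h (Φ x)) (dmap Φ j x) (N x))) := by
    rw [H.covAlong_normal hx, dot_add_left, dot_smul_left, dot_smul_left, ← H.isometric x hx,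
      H.dot_comm hx (N x)]
    ring
  have trace := H.F_eq_neg_trace hx
  simp only [dot_dualFrame, entry, Finset.sum_add_distrib, ← Finset.mul_sum] at trace
  rw [H.metricOn.sum_inv_mul hx, H.sum_inv_mul_dot_N_mul_dot_N hx] at trace
  refine mul_left_cancel₀ (H.F_pos x hx).ne' ?_
  linear_combination -trace

theorem sum_inv_mul_dot_covAlong_covAlong (H : SimpleHypersurfaceOn c g h W Φ U F η t s N)
    (hx : x ∈ U) :
    ∑ i, ∑ j, (g x)⁻¹ i j * dot (h (Φ x)) (covAlong h Φ η i x) (covAlong h Φ η j x)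
      = F x ^ 2 * (1 / 4 + (m - 1) * t ^ 2) := by
  have entry (i j : Fin m) :
      (g x)⁻¹ i j * dot (h (Φ x)) (covAlong h Φ η i x) (covAlong h Φ η j x)
        = t ^ 2 * F x ^ 2 * ((g x)⁻¹ i j * g x i j) + (1 / 4 - t ^ 2) * F x ^ 2 *
          ((g x)⁻¹ i j * (dot (h (Φ x)) (dmap Φ i x) (N x)
            * dot (h (Φ x)) (dmap Φ j x) (N x))) := by
    simp only [H.covAlong_normal hx, dot_add_left, dot_add_right, dot_smul_left, dot_smul_right,
      ← H.isometric x hx, H.unit_N x hx, H.dot_comm hx (N x) (dmap Φ _ x)]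
    ring
  simp only [entry, Finset.sum_add_distrib, ← Finset.mul_sum]
  rw [H.metricOn.sum_inv_mul hx, H.sum_inv_mul_dot_N_mul_dot_N hx]
  ring

theorem dot_secondFundForm_N (H : SimpleHypersurfaceOn c g h W Φ U F η t s N) (hx : x ∈ U)
    (i j : Fin m) : dot (h (Φ x)) (secondFundForm g h Φ i j x) (N x) = 0 := by
  obtain ⟨u, hu⟩ := H.tangent_N x hx
  simp only [← hu, dmapDir_eq_sum, dot_sum_right, dot_smul_right, H.dot_secondFundForm_dmap hx,
    mul_zero, Finset.sum_const_zero]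

theorem pd_dot_N (H : SimpleHypersurfaceOn c g h W Φ U F η t s N) (hx : x ∈ U) (i j : Fin m) :
    pd i (fun y => dot (h (Φ y)) (dmap Φ j y) (N y)) x
      = ∑ k, christoffel g k i j x * dot (h (Φ x)) (dmap Φ k x) (N x)
        + levelCurvature t s F x * (g x i j
          - dot (h (Φ x)) (dmap Φ i x) (N x) * dot (h (Φ x)) (dmap Φ j x) (N x)) := by
  have covDir_dmap : covDir h Φ (EuclideanSpace.single i 1) (dmap Φ j) x
      = secondFundForm g h Φ i j x + ∑ k, christoffel g k i j x • dmap Φ k x := by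
    rw [secondFundForm_eq, covAlong_eq, sub_add_cancel]
  rw [pd_eq_dd, H.dd_dot hx (H.contDiffOn_dmap j) H.smooth_N, covDir_dmap, H.covDir_N hx,
    ← dmap_eq_dmapDir]
  simp only [dot_add_left, dot_add_right, dot_sub_right, dot_sum_left, dot_smul_left,
    dot_smul_right, H.dot_secondFundForm_N hx, H.dot_comm hx (dmap Φ j x) (η x), H.normal x hx,
    ← H.isometric x hx, (H.metricOn.isSymm hx).apply i j]
  ring

theorem hessian_F (H : SimpleHypersurfaceOn c g h W Φ U F η t s N) (hx : x ∈ U) (i j : Fin m) :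
    pd i (pd j F) x - ∑ k, christoffel g k i j x * pd k F x
      = pd i s x * dot (h (Φ x)) (dmap Φ j x) (N x) + s x * levelCurvature t s F x * (g x i j
          - dot (h (Φ x)) (dmap Φ i x) (N x) * dot (h (Φ x)) (dmap Φ j x) (N x)) := by
  have pd_F (k : Fin m) (y : Coord m) (hy : y ∈ U) :
      pd k F y = s y * dot (h (Φ y)) (dmap Φ k y) (N y) := H.dd_F y hy _
  have second_derivative : pd i (pd j F) x
      = pd i s x * dot (h (Φ x)) (dmap Φ j x) (N x)
        + s x * pd i (fun y => dot (h (Φ y)) (dmap Φ j y) (N y)) x :=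
    (dd_congr H.isOpen hx (pd_F j)).trans (dd_mul (H.differentiableAt hx H.smooth_s)
      (H.differentiableAt hx (H.contDiffOn_dot_N _)))
  simp only [second_derivative, H.pd_dot_N hx, pd_F _ x hx, mul_left_comm _ (s x),
    ← Finset.mul_sum]
  ring

theorem laplacian_F (H : SimpleHypersurfaceOn c g h W Φ U F η t s N) (hx : x ∈ U)
    {u : Coord m} (hu : dmapDir Φ u x = N x) :
    ∑ i, ∑ j, (g x)⁻¹ i j * (pd i (pd j F) x - ∑ k, christoffel g k i j x * pd k F x)
      = dd u s x + (m - 1) * (s x * levelCurvature t s F x) := by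
  have entry (i j : Fin m) :
      (g x)⁻¹ i j * (pd i (pd j F) x - ∑ k, christoffel g k i j x * pd k F x)
        = (g x)⁻¹ i j * (pd i s x * dot (h (Φ x)) (dmap Φ j x) (dmapDir Φ u x))
          + s x * levelCurvature t s F x * ((g x)⁻¹ i j * g x i j)
          - s x * levelCurvature t s F x * ((g x)⁻¹ i j
            * (dot (h (Φ x)) (dmap Φ i x) (N x) * dot (h (Φ x)) (dmap Φ j x) (N x))) := by
    rw [H.hessian_F hx, hu]
    ring
  simp only [entry, Finset.sum_add_distrib, Finset.sum_sub_distrib, ← Finset.mul_sum]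
  rw [H.sum_inv_mul_mul_dot_dmapDir hx, H.metricOn.sum_inv_mul hx, H.sum_inv_mul_dot_N_mul_dot_N hx,
    ← dd_eq_sum_pd]
  ring

theorem one_lt_dim (H : SimpleHypersurfaceOn c g h W Φ U F η t s N) (hx : x ∈ U) : 1 < m := by
  have pos : 0 < t * (m - 1) := H.t_mul hx ▸ by norm_num
  exact_mod_cast sub_pos.1 ((mul_pos_iff_of_pos_left H.t_pos).1 pos)

theorem exists_orthogonal (H : SimpleHypersurfaceOn c g h W Φ U F η t s N) (hx : x ∈ U) :
    ∃ v : Coord m, v ≠ 0 ∧ dot (h (Φ x)) (dmapDir Φ v x) (N x) = 0 := by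
  let component : Coord m →ₗ[ℝ] ℝ :=
    { toFun := fun v => dot (h (Φ x)) (dmapDir Φ v x) (N x)
      map_add' := fun v w => by rw [(isLinearMap_dmapDir Φ x).map_add, dot_add_left]
      map_smul' := fun r v => by
        rw [(isLinearMap_dmapDir Φ x).map_smul, dot_smul_left, RingHom.id_apply, smul_eq_mul] }
  have ker_ne_bot : LinearMap.ker component ≠ ⊥ :=
    LinearMap.ker_ne_bot_of_finrank_lt (by simpa using H.one_lt_dim hx)
  obtain ⟨v, mem_ker, v_ne_zero⟩ := (Submodule.ne_bot_iff _).1 ker_ne_bot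
  exact ⟨v, v_ne_zero, mem_ker⟩

theorem dd_F_of_dmapDir_eq (H : SimpleHypersurfaceOn c g h W Φ U F η t s N) (hx : x ∈ U)
    {u : Coord m} (hu : dmapDir Φ u x = N x) : dd u F x = s x := by
  rw [H.dd_F x hx, hu, H.unit_N x hx, mul_one]

theorem dd_s_mul_F (H : SimpleHypersurfaceOn c g h W Φ U F η t s N) (hx : x ∈ U)
    (hb : bitension g h Φ x = 0) {u : Coord m} (hu : dmapDir Φ u x = N x) :
    dd u s x * F x = (1 / 4 + (m - 1) * t ^ 2) * F x ^ 4 - m * c * F x ^ 2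
      - (m - 1) * -(t / (t + 1 / 2)) * s x ^ 2 := by
  have normal := H.biharmonic_normal hx hb
  rw [H.laplacian_F hx hu, H.sum_inv_mul_dot_covAlong_covAlong hx, levelCurvature] at normal
  have F_mul_inv := mul_inv_cancel₀ (H.F_pos x hx).ne'
  linear_combination F x * normal + (m - 1) * (t / (t + 1 / 2)) * s x ^ 2 * F_mul_inv

theorem dd_levelCurvature_mul_F_sq (H : SimpleHypersurfaceOn c g h W Φ U F η t s N) (hx : x ∈ U)
    {u : Coord m} (hu : dmapDir Φ u x = N x) :
    dd u (levelCurvature t s F) x * F x ^ 2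
      = -(t / (t + 1 / 2)) * (dd u s x * F x - s x ^ 2) := by
  have hF := (H.F_pos x hx).ne'
  have dF := H.differentiableAt hx H.smooth_F
  have ds := H.differentiableAt hx H.smooth_s
  have derivative : dd u (levelCurvature t s F) x
      = -(t / (t + 1 / 2)) * (dd u s x * (F x)⁻¹ + s x * (-s x / F x ^ 2)) := by
    refine (dd_const_mul _ (ds.fun_mul (dF.fun_inv hF))).trans ?_
    rw [dd_mul ds (dF.fun_inv hF), dd_inv dF hF, H.dd_F_of_dmapDir_eq hx hu]
  rw [derivative]
  field_simp
  ring

theorem first_integral (H : SimpleHypersurfaceOn c g h W Φ U F η t s N) (hx : x ∈ U)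
    (hb : bitension g h Φ x = 0) {a K : ℝ} (ha : a = -(t / (t + 1 / 2)))
    (hK : K = 1 / 4 + (m - 1) * t ^ 2) :
    ((m - 2) * a ^ 2 + a) * s x ^ 2
      = (a * K - t / 2) * F x ^ 4 + c * (1 - a * m) * F x ^ 2 := by
  obtain ⟨u, hu⟩ := H.tangent_N x hx
  obtain ⟨v, v_ne_zero, orthogonal⟩ := H.exists_orthogonal hx
  have riccati := H.dd_levelCurvature hx hu orthogonal v_ne_zero
  have derivative := H.dd_levelCurvature_mul_F_sq hx hu
  have ode := H.dd_s_mul_F hx hb hu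
  have square : levelCurvature t s F x ^ 2 * F x ^ 2 = a ^ 2 * s x ^ 2 := by
    have := (H.F_pos x hx).ne'
    rw [levelCurvature, ← ha]
    field_simp
  rw [← ha] at derivative ode
  rw [← hK] at ode
  linear_combination square - F x ^ 2 * riccati + derivative + a * ode

theorem false_of_biharmonic (H : SimpleHypersurfaceOn c g h W Φ U F η t s N) (hx : x ∈ U)
    (hb : ∀ y ∈ U, bitension g h Φ y = 0) : False := by
  refine false_of_ode (K := 1 / 4 + (m - 1) * t ^ 2) (D := m * c)
    (L := (m - 1) * -(t / (t + 1 / 2))) H.isOpen hx H.smooth_F H.smooth_s H.F_pos H.s_pos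
    (fun y hy => ?_) (fun y hy => H.first_integral hy (hb y hy) rfl rfl) ?_
  · obtain ⟨u, hu⟩ := H.tangent_N y hy
    exact ⟨u, H.dd_F_of_dmapDir_eq hy hu, H.dd_s_mul_F hy (hb y hy) hu⟩
  · have ht := H.t_pos
    have hm : (m : ℝ) = 1 + 3 / (2 * t) := by
      field_simp
      linear_combination 2 * H.t_mul hx
    have difference_pos : 0 < 4 * t ^ 2 * (t + 1) / (2 * t + 1) ^ 2 := by positivity
    refine ne_of_gt (sub_pos.1 (difference_pos.trans_eq ?_))
    rw [hm]
    field_simp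
    ring

end SimpleHypersurfaceOn

end Coord

namespace Coord

theorem eventually_eq_of_continuousAt_comp {X ι α : Type*} [TopologicalSpace X]
    [TopologicalSpace α] [T1Space α] {d : X → ι} {ψ : ι → α} {S : Set ι} (hS : S.Finite)
    (hψ : S.InjOn ψ) {x : X} (mem : ∀ᶠ y in nhds x, d y ∈ S)
    (continuousAt : ContinuousAt (fun y => ψ (d y)) x) : ∀ᶠ y in nhds x, d y = d x := by
  have isOpen : IsOpen ((ψ '' S) \ {ψ (d x)})ᶜ :=
    ((hS.image ψ).subset Set.sdiff_subset).isClosed.isOpen_compl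
  filter_upwards [mem, continuousAt (isOpen.mem_nhds fun h => h.2 rfl)] with y hy notMem
  by_contra ne
  exact notMem ⟨⟨d y, hy, rfl⟩, fun eq => ne (hψ hy mem.self_of_nhds eq)⟩

variable {m : ℕ}

theorem complementaryRatio_pos {d : ℕ} (hd : d < m) : 0 < complementaryRatio m d := by
  have : (0 : ℝ) < m - d := sub_pos.2 (by exact_mod_cast hd)
  rw [complementaryRatio]
  positivity

theorem strictMonoOn_add_mul_complementaryRatio_sq :
    StrictMonoOn (fun d : ℕ => (d : ℝ) / 4 + (m - d) * complementaryRatio m d ^ 2)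
      (Set.Iio m) := by
  intro d hd e he lt
  have lt' : (d : ℝ) < e := by exact_mod_cast lt
  have pos {k : ℕ} (hk : k < m) : (0 : ℝ) < m - k := sub_pos.2 (by exact_mod_cast hk)
  have mul_sq {k : ℕ} (hk : k < m) :
      (m - k) * complementaryRatio m k ^ 2 = (1 + (k : ℝ) / 2) ^ 2 / (m - k) := by
    have := (pos hk).ne'
    rw [complementaryRatio]
    field_simp
  have pos_e := pos he
  simp only [mul_sq hd, mul_sq he]
  gcongr

/-- The norm of the gradient of `F` with respect to the metric `g`. -/
noncomputable def gradNorm (g : Coord m → Matrix (Fin m) (Fin m) ℝ) (F : Coord m → ℝ)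
    (x : Coord m) : ℝ :=
  √(dot (g x) (gradVec g F x) (gradVec g F x))

variable {c : ℝ} {g : Coord m → Matrix (Fin m) (Fin m) ℝ}
  {h : Coord (m + 1) → Matrix (Fin (m + 1)) (Fin (m + 1)) ℝ} {W : Set (Coord (m + 1))}
  {Φ : Coord m → Coord (m + 1)} {U : Set (Coord m)} {F : Coord m → ℝ}
  {η : Coord m → Fin (m + 1) → ℝ} {x : Coord m}

namespace HypersurfaceOn

theorem contDiffOn_dmapDir_gradVec (H : HypersurfaceOn c g h W Φ U F η) :
    ContDiffOn ℝ ∞ (fun y => dmapDir Φ (gradVec g F y) y) U := by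
  have smooth_coord (i : Fin m) : ContDiffOn ℝ ∞ (fun y => gradVec g F y i) U := by
    change ContDiffOn ℝ ∞ (fun y => ∑ j, (g y)⁻¹ i j * pd j F y) U
    exact ContDiffOn.sum fun j _ =>
      (H.metricOn.contDiffOn_inv i j).mul (contDiffOn_dd H.isOpen H.smooth_F)
  simp only [dmapDir_eq_sum Φ (gradVec g F _)]
  exact ContDiffOn.sum fun i _ => (smooth_coord i).smul (H.contDiffOn_dmap i)

theorem dot_gradVec_pos (H : HypersurfaceOn c g h W Φ U F η) (hx : x ∈ U)
    (hgrad : gradVec g F x ≠ 0) : 0 < dot (g x) (gradVec g F x) (gradVec g F x) :=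
  dot_self_pos (H.posDef x hx) (by simpa using hgrad)

theorem gradNorm_pos (H : HypersurfaceOn c g h W Φ U F η) (hx : x ∈ U)
    (hgrad : gradVec g F x ≠ 0) : 0 < gradNorm g F x :=
  Real.sqrt_pos.2 (H.dot_gradVec_pos hx hgrad)

theorem gradNorm_mul_self (H : HypersurfaceOn c g h W Φ U F η) (hx : x ∈ U)
    (hgrad : gradVec g F x ≠ 0) :
    gradNorm g F x * gradNorm g F x = dot (g x) (gradVec g F x) (gradVec g F x) :=
  Real.mul_self_sqrt (H.dot_gradVec_pos hx hgrad).le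

theorem contDiffOn_gradNorm (H : HypersurfaceOn c g h W Φ U F η)
    (hgrad : ∀ y ∈ U, gradVec g F y ≠ 0) : ContDiffOn ℝ ∞ (gradNorm g F) U := by
  refine ContDiffOn.sqrt ?_ fun y hy => (H.dot_gradVec_pos hy (hgrad y hy)).ne'
  exact (H.contDiffOn_dot H.contDiffOn_dmapDir_gradVec H.contDiffOn_dmapDir_gradVec).congr
    fun y hy => (H.dot_dmapDir_dmapDir hy _ _).symm

theorem simpleHypersurfaceOn (H : HypersurfaceOn c g h W Φ U F η) {t : ℝ} (ht : 0 < t)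
    (hF : ∀ y ∈ U, 0 < F y) (hgrad : ∀ y ∈ U, gradVec g F y ≠ 0)
    (weingarten : ∀ y ∈ U, ∀ X, covDir h Φ X η y = -(t * F y) • dmapDir Φ X y
      + ((t + 1 / 2) * F y * dot (g y) X (gradVec g F y)
        / dot (g y) (gradVec g F y) (gradVec g F y)) • dmapDir Φ (gradVec g F y) y) :
    SimpleHypersurfaceOn c g h W Φ U F η t (gradNorm g F)
      fun y => (gradNorm g F y)⁻¹ • dmapDir Φ (gradVec g F y) y where
  toHypersurfaceOn := H
  t_pos := ht
  F_pos := hF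
  s_pos y hy := H.gradNorm_pos hy (hgrad y hy)
  smooth_s := H.contDiffOn_gradNorm hgrad
  smooth_N := ContDiffOn.smul ((H.contDiffOn_gradNorm hgrad).inv
    fun y hy => (H.gradNorm_pos hy (hgrad y hy)).ne') H.contDiffOn_dmapDir_gradVec
  unit_N y hy := by
    have := (H.gradNorm_pos hy (hgrad y hy)).ne'
    rw [dot_smul_left, dot_smul_right, H.dot_dmapDir_dmapDir hy,
      ← H.gradNorm_mul_self hy (hgrad y hy)]
    field_simp
  tangent_N y _ := ⟨(gradNorm g F y)⁻¹ • gradVec g F y, (isLinearMap_dmapDir Φ y).map_smul _ _⟩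
  dd_F y hy X := by
    have := (H.gradNorm_pos hy (hgrad y hy)).ne'
    rw [dot_smul_right, H.dot_dmapDir_gradVec hy, mul_inv_cancel_left₀ this]
  weingarten y hy X := by
    have := (H.gradNorm_pos hy (hgrad y hy)).ne'
    rw [weingarten y hy, ← H.gradNorm_mul_self hy (hgrad y hy), dot_smul_right,
      H.dot_dmapDir_dmapDir hy, smul_smul]
    congr 2
    field_simp

theorem exists_constant_multiplicity (H : HypersurfaceOn c g h W Φ U F η) (hx : x ∈ U)
    (hF : ∀ y ∈ U, 0 < F y) {d : Coord m → ℕ} {E : Coord m → Fin m → Coord m}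
    {κ : Coord m → Fin m → ℝ} (hd : ∀ y ∈ U, d y < m)
    (P : ∀ y ∈ U, IsAdaptedFrame g h Φ η F y (d y) (E y) (κ y)) :
    ∃ V ⊆ U, IsOpen V ∧ x ∈ V ∧ ∀ y ∈ V, d y = d x := by
  have normSq (y : Coord m) (hy : y ∈ U) :
      (∑ i, ∑ j, (g y)⁻¹ i j * dot (h (Φ y)) (covAlong h Φ η i y) (covAlong h Φ η j y))
        / F y ^ 2 = d y / 4 + (m - d y) * complementaryRatio m (d y) ^ 2 := by
    rw [(P y hy).sum_inv_mul_dot_covAlong_covAlong_eq H.toIsometricOn hy,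
      mul_div_cancel_left₀ _ (pow_ne_zero 2 (hF y hy).ne')]
  have smooth_normSq : ContDiffOn ℝ ∞ (fun y => (∑ i, ∑ j, (g y)⁻¹ i j
      * dot (h (Φ y)) (covAlong h Φ η i y) (covAlong h Φ η j y)) / F y ^ 2) U :=
    (ContDiffOn.sum fun i _ => ContDiffOn.sum fun j _ => (H.metricOn.contDiffOn_inv i j).mul
      (H.contDiffOn_dot (H.contDiffOn_covAlong_normal i) (H.contDiffOn_covAlong_normal j))).div
      (H.smooth_F.pow 2) fun y hy => pow_ne_zero 2 (hF y hy).ne'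
  have mem_nhds := H.isOpen.mem_nhds hx
  have eventually_eq : ∀ᶠ y in nhds x, d y = d x :=
    eventually_eq_of_continuousAt_comp (Set.finite_Iio m)
      strictMonoOn_add_mul_complementaryRatio_sq.injOn
      (Filter.eventually_of_mem mem_nhds hd)
      ((smooth_normSq.congr fun y hy => (normSq y hy).symm).continuousOn.continuousAt mem_nhds)
  obtain ⟨V, subset, isOpen, hxV⟩ := mem_nhds_iff.1 (Filter.inter_mem mem_nhds eventually_eq)
  exact ⟨V, fun y hy => (subset hy).1, isOpen, hxV, fun y hy => (subset hy).2⟩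

theorem false_of_gradVec_ne_zero (H : HypersurfaceOn c g h W Φ U F η) (hx : x ∈ U)
    (hb : ∀ y ∈ U, bitension g h Φ y = 0)
    (hk : ∀ y ∈ U, {k : ℝ | IsPrincipalCurvature g h Φ y (η y) k}.encard ≤ 2)
    (hF : ∀ y ∈ U, 0 < F y) (hgrad : ∀ y ∈ U, gradVec g F y ≠ 0) : False := by
  choose! d E κ one_le lt_dim adapted using fun y (hy : y ∈ U) =>
    H.exists_isAdaptedFrame hy (hb y hy) (hk y hy) (hF y hy) (hgrad y hy)
  obtain ⟨V, hVU, hV, hxV, d_eq⟩ := H.exists_constant_multiplicity hx hF lt_dim adapted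
  have HV := H.mono hVU hV
  have ratio_pos := complementaryRatio_pos (lt_dim x hx)
  replace adapted (y : Coord m) (hy : y ∈ V) : IsAdaptedFrame g h Φ η F y (d x) (E y) (κ y) :=
    d_eq y hy ▸ adapted y (hVU hy)
  rcases (one_le x hx).eq_or_lt with simple | multiple
  · rw [← simple] at adapted ratio_pos
    exact (HV.simpleHypersurfaceOn ratio_pos (fun y hy => hF y (hVU hy))
      (fun y hy => hgrad y (hVU hy)) fun y hy => (adapted y hy).covDir_eq_of_simple
        HV.toIsometricOn hy (hgrad y (hVU hy)) fun _ => H.principalCurvature_of_dot_gradVec_ne_zero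
          (hVU hy) (hb y (hVU hy)) (adapted y hy).toIsPrincipalFrame).false_of_biharmonic
      hxV fun y hy => hb y (hVU hy)
  · obtain ⟨v, v_ne_zero, orthogonal, eigen⟩ :=
      (adapted x hxV).exists_orthogonal_eigenvector multiple (gradVec g F x)
    refine HV.false_of_multiple
      (fun y hy => (adapted y hy).dot_weingarten_factors HV.toIsometricOn hy) hxV ratio_pos
      (hF x hx) (H.covDir_gradVec hx (hb x hx)) eigen v_ne_zero orthogonal ?_
    rw [← H.dot_dmapDir_gradVec hx, H.dot_dmapDir_dmapDir hx]
    exact (H.dot_gradVec_pos hx (hgrad x hx)).ne'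

end HypersurfaceOn

namespace IsometricOn

theorem hypersurfaceOn (H : IsometricOn g h W Φ U)
    (curvature : ∀ y ∈ W, ∀ X Y Z : Fin (m + 1) → ℝ,
      riemannVec h y X Y Z = c • (dot (h y) Y Z • X - dot (h y) X Z • Y))
    (pos : ∀ y ∈ U, 0 < tensionNormSq g h Φ y) :
    HypersurfaceOn c g h W Φ U (fun y => √(tensionNormSq g h Φ y))
      fun y => (√(tensionNormSq g h Φ y))⁻¹ • tension g h Φ y where
  toIsometricOn := H
  curvature := curvature
  smooth_F := H.contDiffOn_tensionNormSq.sqrt fun y hy => (pos y hy).ne'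
  smooth_normal := ContDiffOn.smul
    ((H.contDiffOn_tensionNormSq.sqrt fun y hy => (pos y hy).ne').inv
      fun y hy => (Real.sqrt_pos.2 (pos y hy)).ne') H.contDiffOn_tension
  unit y hy := by
    rw [dot_smul_left, dot_smul_right, ← tensionNormSq, ← mul_assoc, ← mul_inv,
      Real.mul_self_sqrt (pos y hy).le, inv_mul_cancel₀ (pos y hy).ne']
  normal y hy i := by rw [dot_smul_left, H.dot_tension_dmap hy, mul_zero]
  tension_eq y hy := by rw [smul_inv_smul₀ (Real.sqrt_pos.2 (pos y hy)).ne']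

theorem dd_tensionNormSq (H : IsometricOn g h W Φ U)
    (curvature : ∀ y ∈ W, ∀ X Y Z : Fin (m + 1) → ℝ,
      riemannVec h y X Y Z = c • (dot (h y) Y Z • X - dot (h y) X Z • Y))
    (hb : ∀ y ∈ U, bitension g h Φ y = 0)
    (hk : ∀ y ∈ U, ∀ η, IsUnitNormal h Φ y η →
      {k : ℝ | IsPrincipalCurvature g h Φ y η k}.encard ≤ 2) (hx : x ∈ U) (X : Coord m) :
    dd X (tensionNormSq g h Φ) x = 0 := by
  by_contra dd_ne_zero
  have smooth := H.contDiffOn_tensionNormSq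
  have ne_zero : tensionNormSq g h Φ x ≠ 0 := by
    intro zero
    have isLocalMin : IsLocalMin (tensionNormSq g h Φ) x := by
      filter_upwards [H.isOpen.mem_nhds hx] with y hy
      exact zero ▸ H.tensionNormSq_nonneg hy
    exact dd_ne_zero (by rw [dd, isLocalMin.fderiv_eq_zero, zero_apply])
  let V := U ∩ (fun y => tensionNormSq g h Φ y * dd X (tensionNormSq g h Φ) y) ⁻¹' {0}ᶜ
  have hV : IsOpen V := (smooth.mul (contDiffOn_dd H.isOpen smooth)).continuousOn
    |>.isOpen_inter_preimage H.isOpen isOpen_compl_singleton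
  have pos (y : Coord m) (hy : y ∈ V) : 0 < tensionNormSq g h Φ y :=
    (H.tensionNormSq_nonneg hy.1).lt_of_ne' (left_ne_zero_of_mul hy.2)
  have HV := (H.mono Set.inter_subset_left hV).hypersurfaceOn curvature pos
  refine HV.false_of_gradVec_ne_zero (x := x) ⟨hx, mul_ne_zero ne_zero dd_ne_zero⟩
    (fun y hy => hb y hy.1) (fun y hy => hk y hy.1 _ (HV.isUnitNormal hy))
    (fun y hy => Real.sqrt_pos.2 (pos y hy)) fun y hy grad_zero => ?_
  have dd_sqrt : dd X (fun z => √(tensionNormSq g h Φ z)) y = 0 := by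
    rw [← HV.dot_dmapDir_gradVec hy X, grad_zero, (isLinearMap_dmapDir Φ y).map_zero,
      dot_zero_right]
  have dF := HV.differentiableAt hy HV.smooth_F
  refine right_ne_zero_of_mul hy.2 ?_
  rw [dd_congr hV hy fun z hz => (Real.mul_self_sqrt (pos z hz).le).symm, dd_mul dF dF, dd_sqrt,
    mul_zero, zero_mul, add_zero]

end IsometricOn

end Coord

/-! ### Change of charts -/

namespace Coord

variable {m n p : ℕ}

/-- The differential of `Ψ` at `y`, acting on coordinate vectors. -/
noncomputable def pushforward (Ψ : Coord n → Coord p) (y : Coord n) :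
    (Fin n → ℝ) →ₗ[ℝ] Fin p → ℝ :=
  Fintype.linearCombination ℝ fun a => dmap Ψ a y

theorem pushforward_apply (Ψ : Coord n → Coord p) (y : Coord n) (v : Fin n → ℝ) :
    pushforward Ψ y v = ∑ a, v a • dmap Ψ a y := rfl

section Composition

variable {g : Coord m → Matrix (Fin m) (Fin m) ℝ} {h : Coord n → Matrix (Fin n) (Fin n) ℝ}
  {k : Coord p → Matrix (Fin p) (Fin p) ℝ} {W : Set (Coord n)} {Z : Set (Coord p)}
  {Φ : Coord m → Coord n} {Ψ : Coord n → Coord p} {U : Set (Coord m)} {x : Coord m}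

theorem MapOn.comp (HΨ : MapOn k Z Ψ W) (HΦ : MapOn h W Φ U) :
    MapOn k Z (fun y => Ψ (Φ y)) U where
  metric := HΨ.metric
  isOpen := HΦ.isOpen
  smooth := HΨ.smooth.comp HΦ.smooth HΦ.mapsTo
  mapsTo := HΨ.mapsTo.comp HΦ.mapsTo

theorem dmapDir_comp (hΨ : DifferentiableAt ℝ Ψ (Φ x)) (hΦ : DifferentiableAt ℝ Φ x)
    (X : Coord m) :
    dmapDir (fun y => Ψ (Φ y)) X x = pushforward Ψ (Φ x) (dmapDir Φ X x) := by
  ext a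
  have dd_comp_apply := dd_comp (X := X) (f := fun z => Ψ z a) hΦ
    (differentiableAt_euclidean.1 hΨ a)
  simp only [pushforward_apply, Finset.sum_apply, Pi.smul_apply, smul_eq_mul]
  exact dd_comp_apply

theorem covDir_comp (hΨ : DifferentiableAt ℝ Ψ (Φ x)) (hΦ : DifferentiableAt ℝ Φ x)
    (X : Coord m) {Y : Coord n → Fin p → ℝ} (hY : DifferentiableAt ℝ Y (Φ x)) :
    covDir k (fun y => Ψ (Φ y)) X (fun y => Y (Φ y)) x
      = ∑ b, dmapDir Φ X x b • covAlong k Ψ Y b (Φ x) := by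
  have ddVec_comp : ddVec X (fun y => Y (Φ y)) x
      = ddVec (WithLp.toLp 2 (dmapDir Φ X x)) Y (Φ x) := by
    ext a
    simp only [ddVec, dd_comp (X := X) (f := fun z => Y z a) hΦ (differentiableAt_pi.1 hY a),
      dd_eq_sum_pd (WithLp.toLp 2 (dmapDir Φ X x))]
  have conn_comp : conn k (fun y => Ψ (Φ y)) X x
      = conn k Ψ (WithLp.toLp 2 (dmapDir Φ X x)) (Φ x) := by
    rw [conn, conn, dmapDir_comp hΨ hΦ, dmapDir_eq_sum Ψ]
    rfl
  rw [← covDir_eq_sum k Ψ (WithLp.toLp 2 (dmapDir Φ X x)), covDir, covDir, ddVec_comp, conn_comp]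

theorem conn_mulVec (h : Coord n → Matrix (Fin n) (Fin n) ℝ) (Φ : Coord m → Coord n)
    (X x : Coord m) (v : Fin n → ℝ) : (conn h Φ X x).mulVec v
      = ∑ a, ∑ b, (v a * dmapDir Φ X x b) • fun c => christoffel h c b a (Φ x) := by
  ext c
  simp only [conn, Matrix.sum_mulVec, Matrix.smul_mulVec, Finset.sum_apply, Pi.smul_apply]
  simp only [Matrix.mulVec, dotProduct, smul_eq_mul, Finset.mul_sum, christoffelMatrix,
    Matrix.of_apply]
  rw [Finset.sum_comm]
  exact Finset.sum_congr rfl fun a _ => Finset.sum_congr rfl fun b _ => by ring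

theorem covDir_pushforward (HΨ : MapOn k Z Ψ W) (HΦ : MapOn h W Φ U) (hx : x ∈ U)
    (X : Coord m) {V : Coord m → Fin n → ℝ} (hV : ContDiffOn ℝ ∞ V U) :
    covDir k (fun y => Ψ (Φ y)) X (fun y => pushforward Ψ (Φ y) (V y)) x
      = pushforward Ψ (Φ x) (covDir h Φ X V x)
        + ∑ a, ∑ b, (V x a * dmapDir Φ X x b) • secondFundForm h k Ψ b a (Φ x) := by
  have HΨΦ := HΨ.comp HΦ
  have hΦ := HΦ.differentiableAt hx HΦ.smooth
  have hΨ := HΨ.differentiableAt (HΦ.mapsTo hx) HΨ.smooth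
  have smooth_dmap (a : Fin n) : ContDiffOn ℝ ∞ (dmap Ψ a) W := HΨ.contDiffOn_dmapDir
  have smooth_dmap_comp (a : Fin n) : ContDiffOn ℝ ∞ (fun y => dmap Ψ a (Φ y)) U :=
    (smooth_dmap a).comp HΦ.smooth HΦ.mapsTo
  have covAlong_dmap (a b : Fin n) : covAlong k Ψ (dmap Ψ a) b (Φ x)
      = secondFundForm h k Ψ b a (Φ x)
        + pushforward Ψ (Φ x) fun c => christoffel h c b a (Φ x) := by
    rw [secondFundForm_eq, pushforward_apply, sub_add_cancel]
  have covDir_summand (a : Fin n) :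
      covDir k (fun y => Ψ (Φ y)) X (fun y => V y a • dmap Ψ a (Φ y)) x
        = ddVec X V x a • dmap Ψ a (Φ x)
          + ∑ b, ((V x a * dmapDir Φ X x b) • secondFundForm h k Ψ b a (Φ x)
            + (V x a * dmapDir Φ X x b) •
              pushforward Ψ (Φ x) fun c => christoffel h c b a (Φ x)) := by
    rw [HΨΦ.covDir_smul hx (contDiffOn_pi.1 hV a) (smooth_dmap_comp a),
      covDir_comp hΨ hΦ X (HΨ.differentiableAt (HΦ.mapsTo hx) (smooth_dmap a))]
    simp only [covAlong_dmap, Finset.smul_sum, smul_smul, smul_add]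
    rfl
  have smooth_summand (a : Fin n) : ContDiffOn ℝ ∞ (fun y => V y a • dmap Ψ a (Φ y)) U :=
    (contDiffOn_pi.1 hV a).smul (smooth_dmap_comp a)
  simp only [pushforward_apply Ψ _ (V _)]
  rw [HΨΦ.covDir_sum hx fun a _ => smooth_summand a, covDir.eq_def h, map_add, conn_mulVec,
    pushforward_apply Ψ _ (ddVec X V x)]
  simp only [covDir_summand, map_sum, map_smul, Finset.sum_add_distrib]
  abel

theorem secondFundForm_comp (HΨ : MapOn k Z Ψ W) (HΦ : MapOn h W Φ U) (hx : x ∈ U)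
    (i j : Fin m) : secondFundForm g k (fun y => Ψ (Φ y)) i j x
      = pushforward Ψ (Φ x) (secondFundForm g h Φ i j x)
        + ∑ a, ∑ b, (dmap Φ j x a * dmap Φ i x b) • secondFundForm h k Ψ b a (Φ x) := by
  have dmap_comp (l : Fin m) (y : Coord m) (hy : y ∈ U) :
      dmap (fun y => Ψ (Φ y)) l y = pushforward Ψ (Φ y) (dmap Φ l y) :=
    dmapDir_comp (HΨ.differentiableAt (HΦ.mapsTo hy) HΨ.smooth)
      (HΦ.differentiableAt hy HΦ.smooth) _
  simp only [secondFundForm_eq g, covAlong_eq, map_sub, map_sum, map_smul, dmap_comp _ x hx]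
  rw [(HΨ.comp HΦ).covDir_congr hx (dmap_comp j),
    covDir_pushforward HΨ HΦ hx _ (V := dmap Φ j) HΦ.contDiffOn_dmapDir, add_sub_right_comm]
  rfl

end Composition

section EqualDimension

variable {g : Coord n → Matrix (Fin n) (Fin n) ℝ} {h : Coord n → Matrix (Fin n) (Fin n) ℝ}
  {W : Set (Coord n)} {ψ : Coord n → Coord n} {U : Set (Coord n)} {x : Coord n}

/-- The Jacobian matrix of `ψ`. -/
noncomputable def jacobian (ψ : Coord n → Coord n) (x : Coord n) : Matrix (Fin n) (Fin n) ℝ :=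
  Matrix.of fun a i => dmap ψ i x a

namespace IsometricOn

theorem metric_eq_jacobian (H : IsometricOn g h W ψ U) (hx : x ∈ U) :
    g x = (jacobian ψ x).transpose * (h (ψ x) * jacobian ψ x) := by
  ext i j
  rw [H.isometric x hx, dot_eq_dotProduct]
  rfl

theorem det_jacobian_ne_zero (H : IsometricOn g h W ψ U) (hx : x ∈ U) :
    (jacobian ψ x).det ≠ 0 := by
  have det_ne_zero := (H.posDef x hx).det_pos.ne'
  rw [H.metric_eq_jacobian hx, ← mul_assoc, Matrix.det_mul] at det_ne_zero
  exact right_ne_zero_of_mul det_ne_zero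

theorem secondFundForm_eq_zero (H : IsometricOn g h W ψ U) (hx : x ∈ U) (i j : Fin n) :
    secondFundForm g h ψ i j x = 0 := by
  have det_ne_zero : (h (ψ x) * jacobian ψ x).det ≠ 0 := by
    rw [Matrix.det_mul]
    exact mul_ne_zero (H.metric.posDef _ (H.mapsTo hx)).det_pos.ne' (H.det_jacobian_ne_zero hx)
  refine Matrix.eq_zero_of_vecMul_eq_zero det_ne_zero (funext fun l => ?_)
  have normal := H.dot_secondFundForm_dmap hx i j l
  rwa [dot_eq_dotProduct] at normal

theorem jacobian_mul_inv_mul_transpose (H : IsometricOn g h W ψ U) (hx : x ∈ U) :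
    jacobian ψ x * (g x)⁻¹ * (jacobian ψ x).transpose = (h (ψ x))⁻¹ := by
  have isUnit_det : IsUnit (jacobian ψ x).det := (H.det_jacobian_ne_zero hx).isUnit
  have isUnit_det_transpose : IsUnit (jacobian ψ x).transpose.det := by
    rwa [Matrix.det_transpose]
  rw [H.metric_eq_jacobian hx, Matrix.mul_inv_rev, Matrix.mul_inv_rev, mul_assoc, mul_assoc,
    mul_assoc, Matrix.nonsing_inv_mul _ isUnit_det_transpose, mul_one, ← mul_assoc,
    Matrix.mul_nonsing_inv _ isUnit_det, one_mul]

end IsometricOn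

end EqualDimension

theorem tension_congr {g : Coord m → Matrix (Fin m) (Fin m) ℝ}
    {h : Coord n → Matrix (Fin n) (Fin n) ℝ} {W : Set (Coord n)} {Φ Φ' : Coord m → Coord n}
    {U : Set (Coord m)} {x : Coord m} (H : MapOn h W Φ U) (hx : x ∈ U)
    (hΦ : ∀ y ∈ U, Φ y = Φ' y) : tension g h Φ x = tension g h Φ' x := by
  have dmapDir_eq (X y : Coord m) (hy : y ∈ U) : dmapDir Φ X y = dmapDir Φ' X y :=
    funext fun a => dd_congr H.isOpen hy fun z hz => congrArg (· a) (hΦ z hz)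
  have dmap_eq (j : Fin m) : dmap Φ j x = dmap Φ' j x := dmapDir_eq _ x hx
  have covAlong_dmap_eq (i j : Fin m) :
      covAlong h Φ (dmap Φ j) i x = covAlong h Φ' (dmap Φ' j) i x := by
    rw [covAlong_eq, covAlong_eq,
      H.covDir_congr hx fun y hy => show dmap Φ j y = dmap Φ' j y from dmapDir_eq _ y hy]
    simp only [covDir, conn, dmapDir_eq _ x hx, hΦ x hx]
  simp only [tension_eq_sum, secondFundForm_eq, dmap_eq, covAlong_dmap_eq]

section ChangeOfCoordinates

variable {g₁ g₂ : Coord m → Matrix (Fin m) (Fin m) ℝ}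
  {h h₁ h₂ : Coord n → Matrix (Fin n) (Fin n) ℝ} {U U₁ U₂ : Set (Coord m)}
  {W W₁ W₂ : Set (Coord n)} {Φ Φ₁ Φ₂ : Coord m → Coord n} {ψ : Coord m → Coord m}
  {χ : Coord n → Coord n} {x : Coord m}

theorem tension_comp_isometry (H : MapOn h W Φ U₂) (Hψ : IsometricOn g₁ g₂ U₂ ψ U₁)
    (hx : x ∈ U₁) : tension g₁ h (fun y => Φ (ψ y)) x = tension g₂ h Φ (ψ x) := by
  have trace_eq (b a : Fin m) : (g₂ (ψ x))⁻¹ b a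
      = ∑ i, ∑ j, (g₁ x)⁻¹ i j * (dmap ψ j x a * dmap ψ i x b) := by
    rw [← Hψ.jacobian_mul_inv_mul_transpose hx, Matrix.mul_apply, Finset.sum_comm]
    refine Finset.sum_congr rfl fun j _ => ?_
    rw [Matrix.mul_apply, Finset.sum_mul]
    refine Finset.sum_congr rfl fun i _ => ?_
    simp only [jacobian, Matrix.transpose_apply, Matrix.of_apply]
    ring
  simp only [tension_eq_sum, secondFundForm_comp H Hψ.toMapOn hx (g := g₁),
    Hψ.secondFundForm_eq_zero hx, map_zero, zero_add, trace_eq, Finset.sum_smul, Finset.smul_sum,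
    smul_smul]
  rw [Finset.sum_comm_cycle, Finset.sum_congr rfl fun a _ => Finset.sum_comm_cycle,
    Finset.sum_comm]

theorem tension_isometry_comp (Hχ : IsometricOn h₁ h₂ W₂ χ W₁) (H : MapOn h₁ W₁ Φ U)
    (hx : x ∈ U) :
    tension g₁ h₂ (fun y => χ (Φ y)) x = pushforward χ (Φ x) (tension g₁ h₁ Φ x) := by
  simp only [tension_eq_sum, secondFundForm_comp Hχ.toMapOn H hx (g := g₁),
    Hχ.secondFundForm_eq_zero (H.mapsTo hx), smul_zero, Finset.sum_const_zero, add_zero, map_sum,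
    map_smul]

theorem tensionNormSq_eq_of_isometries (Hψ : IsometricOn g₁ g₂ U₂ ψ U₁)
    (Hχ : IsometricOn h₁ h₂ W₂ χ W₁) (H₁ : MapOn h₁ W₁ Φ₁ U₁) (H₂ : MapOn h₂ W₂ Φ₂ U₂)
    (hcomm : ∀ y ∈ U₁, Φ₂ (ψ y) = χ (Φ₁ y)) (hx : x ∈ U₁) :
    tensionNormSq g₂ h₂ Φ₂ (ψ x) = tensionNormSq g₁ h₁ Φ₁ x := by
  have tension_eq :
      tension g₂ h₂ Φ₂ (ψ x) = pushforward χ (Φ₁ x) (tension g₁ h₁ Φ₁ x) := by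
    rw [← tension_comp_isometry H₂ Hψ hx, tension_congr (H₂.comp Hψ.toMapOn) hx hcomm,
      tension_isometry_comp Hχ H₁ hx]
  have pushforward_eq (v : Fin n → ℝ) :
      pushforward χ (Φ₁ x) v = dmapDir χ (WithLp.toLp 2 v) (Φ₁ x) :=
    (dmapDir_eq_sum χ (WithLp.toLp 2 v) (Φ₁ x)).symm
  rw [tensionNormSq, tension_eq, pushforward_eq, hcomm x hx,
    Hχ.dot_dmapDir_dmapDir (H₁.mapsTo hx)]
  rfl

end ChangeOfCoordinates

theorem meanCurvature_eq_sqrt (g : Coord m → Matrix (Fin m) (Fin m) ℝ)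
    (h : Coord n → Matrix (Fin n) (Fin n) ℝ) (Φ : Coord m → Coord n) (x : Coord m) :
    meanCurvature g h Φ x = √((1 / (m : ℝ)) ^ 2 * tensionNormSq g h Φ x) := by
  have meanCurvatureVector_eq (a : Fin n) : 1 / (m : ℝ) * ∑ i, ∑ j, (g x)⁻¹ i j *
      secondFundForm g h Φ i j x a = ((1 / (m : ℝ)) • tension g h Φ x) a := rfl
  simp only [meanCurvature, meanCurvatureVector_eq]
  rw [tensionNormSq, sq, mul_assoc, ← dot_smul_right, ← dot_smul_left]

end Coord

section ChartDomain

variable {m n : ℕ} {M N : Type*} [TopologicalSpace M] [TopologicalSpace N] {φ : M → N}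
  {e : OpenPartialHomeomorph M (Coord m)} {e' : OpenPartialHomeomorph N (Coord n)} {x : Coord m}

/-- The set of coordinates on which `mapInCharts φ e e'` is the coordinate expression of `φ`. -/
def chartDomain (φ : M → N) (e : OpenPartialHomeomorph M (Coord m))
    (e' : OpenPartialHomeomorph N (Coord n)) : Set (Coord m) :=
  e.target ∩ e.symm ⁻¹' (φ ⁻¹' e'.source)

theorem isOpen_chartDomain (hφ : Continuous φ) : IsOpen (chartDomain φ e e') :=
  e.isOpen_inter_preimage_symm (e'.open_source.preimage hφ)

theorem mapsTo_mapInCharts :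
    Set.MapsTo (mapInCharts φ e e') (chartDomain φ e e') e'.target :=
  fun _ hx => e'.map_source hx.2

theorem symm_mapInCharts (hx : x ∈ chartDomain φ e e') :
    e'.symm (mapInCharts φ e e' x) = φ (e.symm x) :=
  e'.left_inv hx.2

theorem mem_chartDomain {p : M} (hp : p ∈ e.source) (hp' : φ p ∈ e'.source) :
    e p ∈ chartDomain φ e e' :=
  ⟨e.map_source hp, by rwa [Set.mem_preimage, e.left_inv hp]⟩

end ChartDomain

section SmoothCharts

variable {m n : ℕ} {M : Type*} [TopologicalSpace M] [ChartedSpace (Coord m) M]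
  {N : Type*} [TopologicalSpace N] [ChartedSpace (Coord n) N] {φ : M → N}
  {e : OpenPartialHomeomorph M (Coord m)} {e' : OpenPartialHomeomorph N (Coord n)} {x : Coord m}

theorem IsSmoothChart.contMDiffOn (he : IsSmoothChart e) :
    ContMDiffOn 𝓘(ℝ, Coord m) 𝓘(ℝ, Coord m) ∞ e e.source :=
  contMDiffOn_of_mem_maximalAtlas he

theorem IsSmoothChart.contMDiffOn_symm (he : IsSmoothChart e) :
    ContMDiffOn 𝓘(ℝ, Coord m) 𝓘(ℝ, Coord m) ∞ e.symm e.target :=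
  contMDiffOn_symm_of_mem_maximalAtlas he

theorem IsSmoothChart.hasMFDerivAt_symm (he : IsSmoothChart e) (hx : x ∈ e.target) :
    HasMFDerivAt 𝓘(ℝ, Coord m) 𝓘(ℝ, Coord m) e.symm x
      (mfderiv 𝓘(ℝ, Coord m) 𝓘(ℝ, Coord m) e.symm x) :=
  ((he.contMDiffOn_symm.contMDiffAt (e.open_target.mem_nhds hx)).mdifferentiableAt
    (by simp)).hasMFDerivAt

theorem IsSmoothChart.mfderiv_symm_injective (he : IsSmoothChart e) (hx : x ∈ e.target) :
    Function.Injective (mfderiv 𝓘(ℝ, Coord m) 𝓘(ℝ, Coord m) e.symm x) := by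
  have hd : e.MDifferentiable 𝓘(ℝ, Coord m) 𝓘(ℝ, Coord m) :=
    ⟨he.contMDiffOn.mdifferentiableOn (by simp), he.contMDiffOn_symm.mdifferentiableOn (by simp)⟩
  exact hd.symm.mfderiv_injective hx

theorem contDiffOn_mapInCharts (hφ : ContMDiff 𝓘(ℝ, Coord m) 𝓘(ℝ, Coord n) ∞ φ)
    (he : IsSmoothChart e) (he' : IsSmoothChart e') :
    ContDiffOn ℝ ∞ (mapInCharts φ e e') (chartDomain φ e e') := by
  rw [← contMDiffOn_iff_contDiffOn]
  exact he'.contMDiffOn.comp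
    (hφ.comp_contMDiffOn (he.contMDiffOn_symm.mono Set.inter_subset_left)) fun _ hx => hx.2

theorem differentiableAt_mapInCharts (hφ : ContMDiff 𝓘(ℝ, Coord m) 𝓘(ℝ, Coord n) ∞ φ)
    (he : IsSmoothChart e) (he' : IsSmoothChart e') (hx : x ∈ chartDomain φ e e') :
    DifferentiableAt ℝ (mapInCharts φ e e') x :=
  Coord.differentiableAt_of_contDiffOn (isOpen_chartDomain hφ.continuous) hx
    (contDiffOn_mapInCharts hφ he he')

theorem mfderiv_symm_fderiv_mapInCharts (hφ : ContMDiff 𝓘(ℝ, Coord m) 𝓘(ℝ, Coord n) ∞ φ)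
    (he : IsSmoothChart e) (he' : IsSmoothChart e') (hx : x ∈ chartDomain φ e e') (v : Coord m) :
    (mfderiv 𝓘(ℝ, Coord n) 𝓘(ℝ, Coord n) e'.symm (mapInCharts φ e e' x)
        (fderiv ℝ (mapInCharts φ e e') x v) : Coord n)
      = mfderiv 𝓘(ℝ, Coord m) 𝓘(ℝ, Coord n) φ (e.symm x)
          (mfderiv 𝓘(ℝ, Coord m) 𝓘(ℝ, Coord m) e.symm x v) := by
  have hΦ := (differentiableAt_mapInCharts hφ he he' hx).hasFDerivAt.hasMFDerivAt
  have hφx : HasMFDerivAt 𝓘(ℝ, Coord m) 𝓘(ℝ, Coord n) φ (e.symm x)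
      (mfderiv 𝓘(ℝ, Coord m) 𝓘(ℝ, Coord n) φ (e.symm x)) :=
    (hφ.mdifferentiableAt (by simp)).hasMFDerivAt
  have commutes : (e'.symm ∘ mapInCharts φ e e') =ᶠ[nhds x] φ ∘ e.symm := by
    filter_upwards [(isOpen_chartDomain hφ.continuous).mem_nhds hx] with y hy
    exact symm_mapInCharts hy
  have mfderiv_eq := hasMFDerivAt_unique
    ((hφx.comp x (he.hasMFDerivAt_symm hx.1)).congr_of_eventuallyEq commutes)
    ((he'.hasMFDerivAt_symm (mapsTo_mapInCharts hx)).comp x hΦ)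
  exact (DFunLike.congr_fun mfderiv_eq v).symm

end SmoothCharts

namespace SmoothMetric

open Coord

variable {n : ℕ} {N : Type*} [TopologicalSpace N] [ChartedSpace (Coord n) N]
  [IsManifold 𝓘(ℝ, Coord n) ∞ N]

theorem dot_inChart (h : SmoothMetric n N) (e : OpenPartialHomeomorph N (Coord n)) (x : Coord n)
    (u v : Fin n → ℝ) : dot (h.inChart e x) u v
      = h.inner (e.symm x)
          (mfderiv 𝓘(ℝ, Coord n) 𝓘(ℝ, Coord n) e.symm x (WithLp.toLp 2 u))
          (mfderiv 𝓘(ℝ, Coord n) 𝓘(ℝ, Coord n) e.symm x (WithLp.toLp 2 v)) := by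
  let L : Coord n →L[ℝ] Coord n := mfderiv 𝓘(ℝ, Coord n) 𝓘(ℝ, Coord n) e.symm x
  let B : Coord n →L[ℝ] Coord n →L[ℝ] ℝ := h.inner (e.symm x)
  change _ = B (L (WithLp.toLp 2 u)) (L (WithLp.toLp 2 v))
  rw [eq_sum_smul_single (WithLp.toLp 2 u), eq_sum_smul_single (WithLp.toLp 2 v)]
  simp only [map_sum, map_smul, sum_apply, smul_apply, smul_eq_mul, Finset.mul_sum]
  rw [Finset.sum_comm]
  refine Finset.sum_congr rfl fun i _ => Finset.sum_congr rfl fun j _ => ?_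
  change B (L (EuclideanSpace.single i 1)) (L (EuclideanSpace.single j 1)) * u i * v j = _
  ring

theorem contMDiffOn_coordinateField {e : OpenPartialHomeomorph N (Coord n)}
    (he : IsSmoothChart e) (v : Coord n) :
    ContMDiffOn 𝓘(ℝ, Coord n) (𝓘(ℝ, Coord n).prod 𝓘(ℝ, Coord n)) ∞
      (fun x => Bundle.TotalSpace.mk' (Coord n) (E := fun p : N => TangentSpace 𝓘(ℝ, Coord n) p)
        (e.symm x) (mfderiv 𝓘(ℝ, Coord n) 𝓘(ℝ, Coord n) e.symm x v)) e.target := by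
  have smooth_tangentMap := he.contMDiffOn_symm.contMDiffOn_tangentMapWithin (m := ∞) (by simp)
    e.open_target.uniqueMDiffOn
  have smooth_const : ContMDiff 𝓘(ℝ, Coord n) 𝓘(ℝ, Coord n).tangent ∞
      (fun x : Coord n => (⟨x, v⟩ : TangentBundle 𝓘(ℝ, Coord n) (Coord n))) :=
    contMDiff_vectorSpace_iff_contDiff.2 contDiff_const
  refine (smooth_tangentMap.comp (smooth_const.contMDiffOn (s := e.target)) fun x hx => hx).congr
    fun x hx => ?_
  simp only [Function.comp, tangentMapWithin, mfderivWithin_of_isOpen e.open_target hx]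

theorem contDiffOn_inChart (h : SmoothMetric n N) {e : OpenPartialHomeomorph N (Coord n)}
    (he : IsSmoothChart e) (i j : Fin n) :
    ContDiffOn ℝ ∞ (fun x => h.inChart e x i j) e.target := by
  have smooth_metric : ContMDiffOn 𝓘(ℝ, Coord n) (𝓘(ℝ, Coord n).prod
      𝓘(ℝ, Coord n →L[ℝ] Coord n →L[ℝ] ℝ)) ∞
      (fun x => Bundle.TotalSpace.mk' (Coord n →L[ℝ] Coord n →L[ℝ] ℝ)
        (E := fun p : N => (TangentSpace 𝓘(ℝ, Coord n) p →L[ℝ]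
          TangentSpace 𝓘(ℝ, Coord n) p →L[ℝ] Bundle.Trivial N ℝ p))
        (e.symm x) (h.inner (e.symm x))) e.target :=
    h.contMDiff.comp_contMDiffOn he.contMDiffOn_symm
  have smooth_section : ContMDiffOn 𝓘(ℝ, Coord n) (𝓘(ℝ, Coord n).prod 𝓘(ℝ)) ∞
      (fun x => Bundle.TotalSpace.mk' ℝ (E := Bundle.Trivial N ℝ) (e.symm x) (h.inner (e.symm x)
        (mfderiv 𝓘(ℝ, Coord n) 𝓘(ℝ, Coord n) e.symm x (EuclideanSpace.single i (1 : ℝ)))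
        (mfderiv 𝓘(ℝ, Coord n) 𝓘(ℝ, Coord n) e.symm x (EuclideanSpace.single j (1 : ℝ)))))
      e.target :=
    ContMDiffOn.clm_bundle_apply₂ (F₁ := Coord n) (F₂ := Coord n) smooth_metric
      (contMDiffOn_coordinateField he _) (contMDiffOn_coordinateField he _)
  rw [← contMDiffOn_iff_contDiffOn]
  exact fun x hx => (Bundle.contMDiffWithinAt_totalSpace.1 (smooth_section x hx)).2

theorem metricOn (h : SmoothMetric n N) {e : OpenPartialHomeomorph N (Coord n)}
    (he : IsSmoothChart e) : MetricOn (h.inChart e) e.target where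
  isOpen := e.open_target
  smooth := h.contDiffOn_inChart he
  posDef x hx := by
    refine Matrix.PosDef.of_dotProduct_mulVec_pos ?_ fun v hv => ?_
    · ext i j
      exact h.symm _ _ _
    · have pos : 0 < dot (h.inChart e x) v v := by
        rw [h.dot_inChart]
        refine h.pos _ _ fun zero => hv ?_
        exact (WithLp.toLp_eq_zero 2).1
          (he.mfderiv_symm_injective hx (zero.trans (map_zero _).symm))
      rwa [dot_eq_dotProduct] at pos

end SmoothMetric

section IsometricImmersions

open Coord

variable {m n : ℕ} {M : Type*} [TopologicalSpace M] [ChartedSpace (Coord m) M]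
  [IsManifold 𝓘(ℝ, Coord m) ∞ M] {N : Type*} [TopologicalSpace N] [ChartedSpace (Coord n) N]
  [IsManifold 𝓘(ℝ, Coord n) ∞ N] {g : SmoothMetric m M} {h : SmoothMetric n N} {φ : M → N}

theorem isIsometricImmersion_id (g : SmoothMetric m M) : IsIsometricImmersion g g id := by
  refine ⟨contMDiff_id, fun p u v => ?_⟩
  rw [mfderiv_id]
  rfl

namespace IsIsometricImmersion

theorem isometricOn (hφ : IsIsometricImmersion g h φ) {e : OpenPartialHomeomorph M (Coord m)}
    {e' : OpenPartialHomeomorph N (Coord n)} (he : IsSmoothChart e) (he' : IsSmoothChart e') :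
    IsometricOn (g.inChart e) (h.inChart e') e'.target (mapInCharts φ e e')
      (chartDomain φ e e') where
  metric := h.metricOn he'
  isOpen := isOpen_chartDomain hφ.1.continuous
  smooth := contDiffOn_mapInCharts hφ.1 he he'
  mapsTo := mapsTo_mapInCharts
  posDef x hx := (g.metricOn he).posDef x hx.1
  isometric x hx i j := by
    have toLp_dmap (i : Fin m) : WithLp.toLp 2 (dmap (mapInCharts φ e e') i x)
        = fderiv ℝ (mapInCharts φ e e') x (EuclideanSpace.single i 1) :=
      congrArg (WithLp.toLp 2) (ofLp_fderiv (differentiableAt_mapInCharts hφ.1 he he' hx)).symm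
    have inner_congr (q q' : N) (hq : q = q') (u v : Coord n) :
        (h.inner q u v : ℝ) = h.inner q' u v := by rw [hq]
    rw [h.dot_inChart, toLp_dmap, toLp_dmap]
    refine ((inner_congr _ _ (symm_mapInCharts hx) _ _).trans ?_).symm
    rw [mfderiv_symm_fderiv_mapInCharts hφ.1 he he' hx,
      mfderiv_symm_fderiv_mapInCharts hφ.1 he he' hx]
    exact hφ.2 _ _ _

theorem tensionNormSq_eq (hφ : IsIsometricImmersion g h φ)
    {e₁ e₂ : OpenPartialHomeomorph M (Coord m)} {e₁' e₂' : OpenPartialHomeomorph N (Coord n)}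
    (he₁ : IsSmoothChart e₁) (he₂ : IsSmoothChart e₂) (he₁' : IsSmoothChart e₁')
    (he₂' : IsSmoothChart e₂') {p : M} (hp₁ : p ∈ e₁.source) (hp₂ : p ∈ e₂.source)
    (hp₁' : φ p ∈ e₁'.source) (hp₂' : φ p ∈ e₂'.source) :
    tensionNormSq (g.inChart e₂) (h.inChart e₂') (mapInCharts φ e₂ e₂') (e₂ p)
      = tensionNormSq (g.inChart e₁) (h.inChart e₁') (mapInCharts φ e₁ e₁') (e₁ p) := by
  let U : Set (Coord m) :=
    e₁.target ∩ e₁.symm ⁻¹' (e₂.source ∩ φ ⁻¹' (e₁'.source ∩ e₂'.source))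
  have hU : IsOpen U := e₁.isOpen_inter_preimage_symm
    (e₂.open_source.inter ((e₁'.open_source.inter e₂'.open_source).preimage hφ.1.continuous))
  have hpU : e₁ p ∈ U := ⟨e₁.map_source hp₁, by
    rw [Set.mem_preimage, e₁.left_inv hp₁]
    exact ⟨hp₂, hp₁', hp₂'⟩⟩
  have transition_mem (x : Coord m) (hx : x ∈ U) :
      mapInCharts id e₁ e₂ x ∈ chartDomain φ e₂ e₂' :=
    mem_chartDomain hx.2.1 hx.2.2.2
  have map_mem (x : Coord m) (hx : x ∈ U) :
      mapInCharts φ e₁ e₁' x ∈ chartDomain id e₁' e₂' :=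
    mem_chartDomain hx.2.2.1 hx.2.2.2
  have Hψ : IsometricOn (g.inChart e₁) (g.inChart e₂) (chartDomain φ e₂ e₂')
      (mapInCharts id e₁ e₂) U :=
    ((isIsometricImmersion_id g).isometricOn he₁ he₂).restrict (fun x hx => ⟨hx.1, hx.2.1⟩) hU
      Set.inter_subset_left (isOpen_chartDomain hφ.1.continuous) transition_mem
  have Hφ : IsometricOn (g.inChart e₁) (h.inChart e₁') (chartDomain id e₁' e₂')
      (mapInCharts φ e₁ e₁') U :=
    (hφ.isometricOn he₁ he₁').restrict (fun x hx => ⟨hx.1, hx.2.2.1⟩) hU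
      Set.inter_subset_left (isOpen_chartDomain continuous_id) map_mem
  have commutes (x : Coord m) (hx : x ∈ U) : mapInCharts φ e₂ e₂' (mapInCharts id e₁ e₂ x)
      = mapInCharts id e₁' e₂' (mapInCharts φ e₁ e₁' x) := by
    simp only [mapInCharts, id, e₂.left_inv hx.2.1, e₁'.left_inv hx.2.2.1]
  have transition_apply : mapInCharts id e₁ e₂ (e₁ p) = e₂ p := congrArg e₂ (e₁.left_inv hp₁)
  rw [← transition_apply]
  exact tensionNormSq_eq_of_isometries Hψ ((isIsometricImmersion_id h).isometricOn he₁' he₂')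
    Hφ.toMapOn (hφ.isometricOn he₂ he₂').toMapOn commutes hpU

end IsIsometricImmersion

end IsometricImmersions

section Hypersurfaces

open Coord

variable {m : ℕ} {c : ℝ} {M : Type*} [TopologicalSpace M] [ChartedSpace (Coord m) M]
  [IsManifold 𝓘(ℝ, Coord m) ∞ M] {N : Type*} [TopologicalSpace N]
  [ChartedSpace (Coord (m + 1)) N] [IsManifold 𝓘(ℝ, Coord (m + 1)) ∞ N]
  {g : SmoothMetric m M} {h : SmoothMetric (m + 1) N} {φ : M → N}

theorem tensionNormSq_eventually_eq (hc : HasConstSectionalCurvature h c)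
    (hφ : IsIsometricImmersion g h φ) (hk : HasAtMostTwoPrincipalCurvatures g h φ)
    (hb : IsBiharmonicMap g h φ) {e : OpenPartialHomeomorph M (Coord m)}
    {e' : OpenPartialHomeomorph N (Coord (m + 1))} (he : IsSmoothChart e)
    (he' : IsSmoothChart e') {x : Coord m} (hx : x ∈ chartDomain φ e e') :
    ∀ᶠ y in nhds x, tensionNormSq (g.inChart e) (h.inChart e') (mapInCharts φ e e') y
      = tensionNormSq (g.inChart e) (h.inChart e') (mapInCharts φ e e') x := by
  have H := hφ.isometricOn he he'
  have fderiv_eq_zero (y : Coord m) (hy : y ∈ chartDomain φ e e') : fderiv ℝ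
      (tensionNormSq (g.inChart e) (h.inChart e') (mapInCharts φ e e')) y = 0 :=
    ContinuousLinearMap.ext fun X => H.dd_tensionNormSq
      (fun z hz => (h.metricOn he').riemannVec_of_const hz (hc e' he' z hz))
      (fun z hz => hb e e' he he' z hz.1 hz.2) (fun z hz => hk e e' he he' z hz.1 hz.2) hy X
  obtain ⟨ε, hε, ball_subset⟩ := Metric.isOpen_iff.1 H.isOpen x hx
  filter_upwards [Metric.ball_mem_nhds x hε] with y hy
  exact Metric.isOpen_ball.is_const_of_fderiv_eq_zero (𝕜 := ℝ) (convex_ball x ε).isPreconnected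
    ((H.contDiffOn_tensionNormSq.mono ball_subset).differentiableOn (by simp))
    (fun z hz => fderiv_eq_zero z (ball_subset hz)) hy (Metric.mem_ball_self hε)

theorem mainTheorem2_general (hc : HasConstSectionalCurvature h c)
    (hφ : IsIsometricImmersion g h φ) (hk : HasAtMostTwoPrincipalCurvatures g h φ)
    (hb : IsBiharmonicMap g h φ) : IsLocallyConstant (meanCurvatureAt g h φ) := by
  refine (IsLocallyConstant.iff_eventually_eq _).2 fun p => ?_
  have smooth_chart (q : M) : IsSmoothChart (chartAt (Coord m) q) :=
    IsManifold.chart_mem_maximalAtlas q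
  have smooth_chart' (q : N) : IsSmoothChart (chartAt (Coord (m + 1)) q) :=
    IsManifold.chart_mem_maximalAtlas q
  have tensionNormSq_const := (chartAt (Coord m) p).continuousAt (mem_chart_source _ p)
    |>.eventually (tensionNormSq_eventually_eq hc hφ hk hb (smooth_chart p) (smooth_chart' (φ p))
      (mem_chartDomain (mem_chart_source _ p) (mem_chart_source _ (φ p))))
  filter_upwards [tensionNormSq_const, chart_source_mem_nhds (Coord m) p,
    hφ.1.continuous.continuousAt.preimage_mem_nhds (chart_source_mem_nhds (Coord (m + 1)) (φ p))]
    with q tensionNormSq_eq hq hq'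
  rw [meanCurvatureAt, meanCurvatureAt, meanCurvature_eq_sqrt, meanCurvature_eq_sqrt,
    ← tensionNormSq_eq, hφ.tensionNormSq_eq (smooth_chart p) (smooth_chart q)
      (smooth_chart' (φ p)) (smooth_chart' (φ q)) hq (mem_chart_source _ q) hq'
      (mem_chart_source _ (φ q))]

end Hypersurfaces

theorem mainTheorem2 {m : ℕ} (c : ℝ)
    {M : Type*} [TopologicalSpace M] [ChartedSpace (Coord m) M]
    [IsManifold 𝓘(ℝ, Coord m) ∞ M] [ConnectedSpace M]
    {N : Type*} [TopologicalSpace N] [ChartedSpace (Coord (m + 1)) N]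
    [IsManifold 𝓘(ℝ, Coord (m + 1)) ∞ N]
    (g : SmoothMetric m M) (h : SmoothMetric (m + 1) N)
    (hc : HasConstSectionalCurvature h c)
    (φ : M → N) (hφ : IsIsometricImmersion g h φ)
    (hk : HasAtMostTwoPrincipalCurvatures g h φ)
    (hb : IsProperBiharmonicMap g h φ) :
    ∃ κ : ℝ, ∀ p : M, meanCurvatureAt g h φ p = κ := by
  obtain ⟨p₀⟩ : Nonempty M := inferInstance
  exact ⟨meanCurvatureAt g h φ p₀, fun p =>
    (mainTheorem2_general hc hφ hk hb.1).apply_eq_of_preconnectedSpace p p₀⟩
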